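/- Let $K$ be an arbitrary field. Let $\Lambda=\Lambda(x_i\mid i\ge 0)$ be the Grassmann algebra, let $\partial_i$ be its superderivations with $\partial_i(x_j)=\delta_{ij}$, and put $$v_i=\partial_i+x_ix_{i+1}\bigl(\partial_{i+3}+x_{i+3}x_{i+4}(\partial_{i+6}+\cdots)\bigr)\in\operatorname{End}\Lambda,\qquad i\ge 0 .$$ Let $\mathbf Q=\mathrm{Lie}(v_0,v_1,v_2)$ be the Lie superalgebra generated by $v_0,v_1,v_2$ under the supercommutator (and, which matters only if $\operatorname{char}K=2$, under squares of odd elements), and let $\mathbf A=\mathrm{Alg}(v_0,v_1,v_2)\subset\operatorname{End}\Lambda$ be the associative algebra without unit generated by them. Let $\tilde H_\infty$ be the Poisson superalgebra of all formal sums of monomials $x^{\alpha}y^{\beta}$ in odd letters $x_i,y_i$ ($i\ge0$) such that the largest index of a letter in $x^\alpha$ is smaller than the largest index of a letter in $y^\beta$ (the monomial $1$ is also allowed), with bracket determined by $\{y_i,x_j\}=\delta_{ij}$, $\{x_i,x_j\}=\{y_i,y_j\}=0$, and formal square $f^{[2]}=\sum_i \frac{\partial f}{\partial x_i}\frac{\partial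 f}{\partial y_i}$ of odd elements. Put $V_i=y_i+x_ix_{i+1}(y_{i+3}+x_{i+3}x_{i+4}(y_{i+6}+\cdots))$. Let $\mathbf P$ be the Poisson superalgebra with unit generated by $V_0,V_1,V_2$, and $\mathbf P^o$ the one without unit. If $\operatorname{char}K\neq2$, let $\mathbf J=\mathrm{Kan}(\mathbf P)=\mathbf P\oplus\overline{\mathbf P}$ be the Kantor double, with product $a\bullet b=ab$, $\bar a\bullet b=(-1)^{|b|}\overline{ab}$, $a\bullet\bar b=\overline{ab}$, $\bar a\bullet\bar b=(-1)^{|b|}\{a,b\}$, and $\mathbf J^o=\mathbf P^o\oplus\overline{\mathbf P}$. Let $\mathbf K=\mathrm{Kan}(\langle1\rangle\oplus\mathbf Q)$, where $\langle 1\rangle\oplus\mathbf Q$ is the Poisson superalgebra with unit $1$, zero product on $\mathbf Q$, and the bracket of $\mathbf Q$; let $\mathbf K^o=\mathbf Q\oplus\langle\bar1\rangle\oplus\overline{\mathbf Q}$. An algebra is *locally nilpotent* if every finitely generated subalgebra $S$ is nilpotent, that is, all products (with any bracketing and any of the operations of the algebra) of sufficiently many elements of $S$ vanish. **Theorem.**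 Let $X$ be one of $\mathbf Q,\mathbf A,\mathbf P^o$ or, if $\operatorname{char}K\ne2$, one of $\mathbf J^o,\mathbf K^o$. 1. $X=X_+\oplus X_-$ is a direct sum of vector spaces for suitable locally nilpotent ($\mathbb Z_2$-graded) subalgebras $X_+,X_-$. 2. There are at least continuum many different (unordered) decompositions of this kind. More precisely, let $\mu$ be the root of $t^3-t-2$ with positive imaginary part, and for $d=(d_0,d_1,d_2)\in\mathbb Z^3$ put $Y_2(d)+iY_3(d)=d_0+d_1\mu+d_2\mu^2$. Let $(\alpha,\beta)\in\mathbb R^2$ be such that $\ell(d)=\alpha Y_2(d)+\beta Y_3(d)\neq0$ for all $0\ne d\in\mathbb Z^3$. For $X=\mathbf Q,\mathbf A,\mathbf P^o$ let $X_+$ (respectively $X_-$) be the sum of the components of $X$ of multidegree $d$ in the generators with $\ell(d)>0$ (respectively $\ell(d)<0$); put $\mathbf J_+=\mathbf P_+\oplus\overline{\mathbf P_+}\oplus\langle\bar1\rangle$, $\mathbf J_-=\mathbf P_-\oplus\overline{\mathbf P_-}$, $\mathbf K_+=\mathbf Q_+\oplus\overline{\mathbf Q_+}\oplus\langle\bar1\rangle$,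 $\mathbf K_-=\mathbf Q_-\oplus\overline{\mathbf Q_-}$. Then $X=X_+\oplus X_-$ is a decomposition as in 1. Two such pairs $(\alpha,\beta)$ that are not proportional give different decompositions, and exactly continuum many decompositions arise in this way. -/

import Mathlib

open Cardinal

universe u

/-! ### Algebras with several operations, subalgebras, local nilpotency, multidegree -/

/-- The data of a superalgebra on a `K`-space `V`: the two parity components, the (bilinear)
products, and the quadratic maps `x ↦ x^[2]`, which are only ever applied to odd elements. -/
structure SuperData (K V : Type u) [Field K] [AddCommGroup V] [Module K V] where
  even : Submodule K V
  odd : Submodule K V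
  ops : Set (V → V → V)
  sqs : Set (V → V)

namespace SuperData

variable {K V : Type u} [Field K] [AddCommGroup V] [Module K V] (D : SuperData K V)

/-- The subspace `S` is closed under all products and under all squares of its odd elements. -/
def IsSubalgebra (S : Submodule K V) : Prop :=
  (∀ m ∈ D.ops, ∀ a ∈ S, ∀ b ∈ S, m a b ∈ S) ∧ ∀ q ∈ D.sqs, ∀ a ∈ S, a ∈ D.odd → q a ∈ S

/-- The subspace `S` is `ℤ/2`-graded. -/
def IsGraded (S : Submodule K V) : Prop :=
  S ≤ (S ⊓ D.even) ⊔ (S ⊓ D.odd)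

/-- The subalgebra (without unit) generated by `T`. -/
def adjoin (T : Set V) : Submodule K V :=
  sInf {S | D.IsSubalgebra S ∧ T ⊆ S}

/-- `D.IsProduct S n x`: `x` is a product, with some bracketing and some choice of the
operations, of `n` elements of `S` (a square of a product counts its factors twice). -/
inductive IsProduct (S : Set V) : ℕ → V → Prop
  | base (x : V) : x ∈ S → IsProduct S 1 x
  | op (m : V → V → V) (i j : ℕ) (x y : V) : m ∈ D.ops →
      IsProduct S i x → IsProduct S j y → IsProduct S (i + j) (m x y)
  | sq (q : V → V) (i : ℕ) (x : V) : q ∈ D.sqs → x ∈ D.odd →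
      IsProduct S i x → IsProduct S (2 * i) (q x)

/-- All sufficiently long products of elements of `S` vanish. -/
def IsNilpotent (S : Submodule K V) : Prop :=
  ∃ N : ℕ, ∀ n, N ≤ n → ∀ x, D.IsProduct (S : Set V) n x → x = 0

/-- Every finitely generated subalgebra of `S` is nilpotent. -/
def IsLocallyNilpotent (S : Submodule K V) : Prop :=
  ∀ T : Finset V, (T : Set V) ⊆ S → D.IsNilpotent (D.adjoin (T : Set V))

/-- `X = P ⊕ M` (direct sum of vector spaces), where `P` and `M` are locally nilpotent
(`ℤ/2`-graded) subalgebras. -/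
structure IsNilDecomposition (X P M : Submodule K V) : Prop where
  left_subalgebra : D.IsSubalgebra P
  right_subalgebra : D.IsSubalgebra M
  left_graded : D.IsGraded P
  right_graded : D.IsGraded M
  left_nil : D.IsLocallyNilpotent P
  right_nil : D.IsLocallyNilpotent M
  disjoint : P ⊓ M = ⊥
  sum : P ⊔ M = X

/-- The set of all (unordered) decompositions of `X` into a direct sum of two locally
nilpotent subalgebras. -/
def nilDecompositions (X : Submodule K V) : Set (Sym2 (Submodule K V)) :=
  {s | ∃ P M, s = s(P, M) ∧ D.IsNilDecomposition X P M}

/-- `D.IsMonomial g d x`: `x` is a monomial of multidegree `d` in the elements `g 0, g 1, g 2`. -/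
inductive IsMonomial (g : Fin 3 → V) : (Fin 3 → ℕ) → V → Prop
  | gen (i : Fin 3) : IsMonomial g (Pi.single i 1) (g i)
  | op (m : V → V → V) (d e : Fin 3 → ℕ) (x y : V) : m ∈ D.ops →
      IsMonomial g d x → IsMonomial g e y → IsMonomial g (d + e) (m x y)
  | sq (q : V → V) (d : Fin 3 → ℕ) (x : V) : q ∈ D.sqs → x ∈ D.odd →
      IsMonomial g d x → IsMonomial g (2 • d) (q x)

/-- The homogeneous component of multidegree `d` in the generators `g`. -/
def component (g : Fin 3 → V) (d : Fin 3 → ℕ) : Submodule K V :=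
  Submodule.span K {x | D.IsMonomial g d x}

end SuperData

/-! ### Planes through the axis `OY₁` -/

/-- The root `μ = ε θ₁ + ε² θ₂` of `t³ - t - 2` in the upper half-plane (Cardano), where
`ε = (-1 + √3 i)/2`. -/
noncomputable def mu : ℂ :=
  let ε : ℂ := (-1 + (Real.sqrt 3 : ℝ) * Complex.I) / 2
  let θ₁ : ℝ := (1 + Real.sqrt (26 / 27)) ^ (1 / 3 : ℝ)
  let θ₂ : ℝ := (1 - Real.sqrt (26 / 27)) ^ (1 / 3 : ℝ)
  ε * θ₁ + ε ^ 2 * θ₂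

/-- `Z₂ = Y₂ + i Y₃` at the lattice point `d = (X₁, X₂, X₃)`. -/
noncomputable def twisted (d : Fin 3 → ℤ) : ℂ :=
  (d 0 : ℂ) + d 1 * mu + d 2 * mu ^ 2

/-- The value at `d` of the linear form `α Y₂ + β Y₃`, `p = (α, β)`, whose zero set is a plane
through the axis `OY₁ = {Y₂ = Y₃ = 0}`. -/
noncomputable def planeForm (p : ℝ × ℝ) (d : Fin 3 → ℤ) : ℝ :=
  p.1 * (twisted d).re + p.2 * (twisted d).im

/-- The planes `α Y₂ + β Y₃ = 0` that meet the lattice `ℤ³` only at the origin. -/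
def genericPlanes : Set (ℝ × ℝ) :=
  {p | ∀ d : Fin 3 → ℤ, d ≠ 0 → planeForm p d ≠ 0}

/-- The two parameters `(α, β)` and `(α', β')` give the same plane. -/
def SamePlane (p q : ℝ × ℝ) : Prop := ∃ c : ℝ, c ≠ 0 ∧ q = c • p

namespace SuperData

variable {K V : Type u} [Field K] [AddCommGroup V] [Module K V] (D : SuperData K V)

/-- The sum of the homogeneous components lying on the side `α Y₂ + β Y₃ > 0` of the plane
(the other side is the side of `(-α, -β)`). -/
noncomputable def half (g : Fin 3 → V) (p : ℝ × ℝ) : Submodule K V :=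
  ⨆ d : Fin 3 → ℕ, ⨆ _ : 0 < planeForm p (fun i => (d i : ℤ)), D.component g d

/-- `X` is a direct sum of two locally nilpotent subalgebras; there are at least continuum many
such decompositions; more precisely, the pairs `F p`, where `p` runs over the planes through
`OY₁` that meet the lattice only at the origin, are such decompositions, different planes give
different decompositions, and exactly continuum many decompositions arise in this way. -/
structure SplitsByPlanes (X : Submodule K V)
    (F : ℝ × ℝ → Submodule K V × Submodule K V) : Prop where
  exists_decomposition : ∃ P M, D.IsNilDecomposition X P M
  continuum_le : 𝔠 ≤ #(D.nilDecompositions X)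
  plane_decomposition : ∀ p ∈ genericPlanes, D.IsNilDecomposition X (F p).1 (F p).2
  plane_injective : ∀ p ∈ genericPlanes, ∀ q ∈ genericPlanes, ¬ SamePlane p q →
    s((F p).1, (F p).2) ≠ s((F q).1, (F q).2)
  card_planes : #((fun p => s((F p).1, (F p).2)) '' genericPlanes) = 𝔠

end SuperData

/-! ### The Grassmann algebra `Λ = Λ(x_i | i ≥ 0)` and its operators -/

/-- The Grassmann algebra `Λ`, as a space with basis the monomials
`x^S = x_{i₁} ⋯ x_{i_t}`, `S = {i₁ < ⋯ < i_t}`. -/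
abbrev Gr (K : Type u) [Field K] : Type u := Finset ℕ →₀ K

/-- Endomorphisms of the space `Λ`. -/
abbrev EndGr (K : Type u) [Field K] : Type u := Module.End K (Gr K)

section Operators

variable (K : Type u) [Field K]

/-- Left multiplication by `x_i` on `Λ`. -/
noncomputable def opX (i : ℕ) : EndGr K :=
  Finsupp.linearCombination K fun S : Finset ℕ =>
    if i ∈ S then 0 else Finsupp.single (insert i S) ((-1 : K) ^ (S.filter (· < i)).card)

/-- The superderivative `∂_i` of `Λ`, `∂_i(x_j) = δ_{ij}`. -/
noncomputable def opD (i : ℕ) : EndGr K :=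
  Finsupp.linearCombination K fun S : Finset ℕ =>
    if i ∈ S then Finsupp.single (S.erase i) ((-1 : K) ^ (S.filter (· < i)).card) else 0

/-- The operator `x_n x_{n+1} x_{n+3} x_{n+4} ⋯ x_{n+3l-3} x_{n+3l-2}`. -/
noncomputable def opTail (n : ℕ) : ℕ → EndGr K
  | 0 => 1
  | l + 1 => opTail n l * (opX K (n + 3 * l) * opX K (n + 3 * l + 1))

/-- The pivot element `v_n = ∑_{l ≥ 0} x_n x_{n+1} ⋯ x_{n+3l-3} x_{n+3l-2} ∂_{n+3l}`; on the
monomial `x^S` the terms with `n + 3l > max S` vanish. -/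
noncomputable def pivot (n : ℕ) : EndGr K :=
  Finsupp.linearCombination K fun S : Finset ℕ =>
    ∑ l ∈ Finset.range (S.sup id + 1),
      opTail K n l (opD K (n + 3 * l) (Finsupp.single S 1))

/-- The projection of `Λ` onto its even part (`r = 0`) or its odd part (`r = 1`). -/
noncomputable def parityProj (r : ℕ) : EndGr K :=
  Finsupp.linearCombination K fun S : Finset ℕ =>
    if S.card % 2 = r then Finsupp.single S 1 else 0

variable {K}

/-- The even part of an endomorphism of `Λ`. -/
noncomputable def evenPart (a : EndGr K) : EndGr K :=
  parityProj K 0 * a * parityProj K 0 + parityProj K 1 * a * parityProj K 1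

/-- The odd part of an endomorphism of `Λ`. -/
noncomputable def oddPart (a : EndGr K) : EndGr K :=
  parityProj K 0 * a * parityProj K 1 + parityProj K 1 * a * parityProj K 0

/-- The supercommutator on `End Λ`: the bilinear operation with
`[a, b] = ab - (-1)^{|a||b|} ba` for homogeneous `a`, `b`. -/
noncomputable def superComm (a b : EndGr K) : EndGr K :=
  a * b - (evenPart b * a + oddPart b * evenPart a - oddPart b * oddPart a)

variable (K)

def endEven : Submodule K (EndGr K) where
  carrier := {a | parityProj K 0 * a * parityProj K 1 = 0 ∧ parityProj K 1 * a * parityProj K 0 = 0}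
  add_mem' := by
    rintro a b ⟨h1, h2⟩ ⟨h3, h4⟩
    exact ⟨by rw [mul_add, add_mul, h1, h3, add_zero], by rw [mul_add, add_mul, h2, h4, add_zero]⟩
  zero_mem' := by simp
  smul_mem' := by
    rintro c a ⟨h1, h2⟩
    exact ⟨by rw [mul_smul_comm, smul_mul_assoc, h1, smul_zero],
      by rw [mul_smul_comm, smul_mul_assoc, h2, smul_zero]⟩

def endOdd : Submodule K (EndGr K) where
  carrier := {a | parityProj K 0 * a * parityProj K 0 = 0 ∧ parityProj K 1 * a * parityProj K 1 = 0}
  add_mem' := by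
    rintro a b ⟨h1, h2⟩ ⟨h3, h4⟩
    exact ⟨by rw [mul_add, add_mul, h1, h3, add_zero], by rw [mul_add, add_mul, h2, h4, add_zero]⟩
  zero_mem' := by simp
  smul_mem' := by
    rintro c a ⟨h1, h2⟩
    exact ⟨by rw [mul_smul_comm, smul_mul_assoc, h1, smul_zero],
      by rw [mul_smul_comm, smul_mul_assoc, h2, smul_zero]⟩

/-- `End Λ` as a Lie superalgebra: the supercommutator, and the square of odd elements. If
`2 ≠ 0` then `a² = ½[a, a]` for odd `a`, so the square only matters in characteristic two. -/
noncomputable def lieData : SuperData K (EndGr K) where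
  even := endEven K
  odd := endOdd K
  ops := {superComm}
  sqs := {fun a => a * a}

/-- `End Λ` as an associative superalgebra. -/
noncomputable def assocData : SuperData K (EndGr K) where
  even := endEven K
  odd := endOdd K
  ops := {fun a b => a * b}
  sqs := ∅

/-- The generators `v₀, v₁, v₂`. -/
noncomputable def pivots : Fin 3 → EndGr K := fun i => pivot K i

/-- The Lie superalgebra `Q = Lie(v₀, v₁, v₂)`. -/
noncomputable def algQ : Submodule K (EndGr K) := (lieData K).adjoin (Set.range (pivots K))

/-- The associative hull `A = Alg(v₀, v₁, v₂)` (without unit). -/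
noncomputable def algA : Submodule K (EndGr K) := (assocData K).adjoin (Set.range (pivots K))

end Operators

/-! ### The completed Poisson superalgebra in the odd letters `x_i`, `y_i` -/

/-- The letters `x_i` and `y_i`; all `x`'s precede all `y`'s. -/
abbrev Letter : Type := Lex (ℕ ⊕ ℕ)

def lx (i : ℕ) : Letter := toLex (Sum.inl i)

def ly (i : ℕ) : Letter := toLex (Sum.inr i)

/-- The index of a letter. -/
def letterIndex (a : Letter) : ℕ := Sum.elim id id (ofLex a)

/-- Formal infinite sums of Grassmann monomials: `f S` is the coefficient of the monomial
`x^α y^β` (letters in increasing order) whose set of letters is `S`. -/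
abbrev Series (K : Type u) [Field K] : Type u := Finset Letter → K

section PoissonOps

variable {K : Type u} [Field K]

/-- The supercommutative product. -/
def gmul (f g : Series K) : Series K := fun S =>
  ∑ T ∈ S.powerset,
    (-1 : K) ^ ((T ×ˢ (S \ T)).filter fun z => z.2 < z.1).card * (f T * g (S \ T))

/-- The (left) partial derivative with respect to the letter `a`. -/
def pderivG (a : Letter) (f : Series K) : Series K := fun S =>
  if a ∈ S then 0 else (-1 : K) ^ (S.filter (· < a)).card * f (insert a S)

/-- The parity automorphism `f ↦ (-1)^{|f|} f`. -/
def signG (f : Series K) : Series K := fun S => (-1 : K) ^ S.card * f S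

/-- The `i`-th term `(-1)^{|f|-1} (∂f/∂x_i ∂g/∂y_i + ∂f/∂y_i ∂g/∂x_i)` of the bracket. -/
def bracketTerm (f g : Series K) (i : ℕ) : Series K :=
  -(gmul (pderivG (lx i) (signG f)) (pderivG (ly i) g)
    + gmul (pderivG (ly i) (signG f)) (pderivG (lx i) g))

/-- The Poisson bracket `{f, g} = ∑_i bracketTerm f g i`. In the coefficient at `S` only the
`i` smaller than the largest index of a letter of `S` contribute, if `f` and `g` belong to the
completion `Htilde` (see `bracketTerm_eq_zero`). -/
def pbracket (f g : Series K) : Series K := fun S =>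
  ∑ i ∈ Finset.range (S.sup letterIndex), bracketTerm f g i S

/-- The formal square `f^[2] = ∑_i ∂f/∂x_i ∂f/∂y_i` (for odd `f`): it is `½{f, f}` if `2 ≠ 0`.
It is quadratic with polarization the bracket, and it kills the odd monomials. -/
def psquare (f : Series K) : Series K := fun S =>
  ∑ i ∈ Finset.range (S.sup letterIndex), gmul (pderivG (lx i) f) (pderivG (ly i) f) S

variable (K)

/-- The completion: formal sums of the monomials `x^α y^β` with `max α < max β` (and of `1`). -/
def Htilde : Submodule K (Series K) where
  carrier := {f | ∀ S, f S ≠ 0 → ∀ i, lx i ∈ S → ∃ j, i < j ∧ ly j ∈ S}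
  add_mem' := by
    intro f g hf hg S hS
    by_cases h : f S = 0
    · exact hg S (by intro h'; exact hS (by simp [h, h']))
    · exact hf S h
  zero_mem' := by intro S hS; exact absurd rfl hS
  smul_mem' := by
    intro c f hf S hS
    exact hf S (by intro h; exact hS (by simp [h]))

variable {K}

theorem exists_of_gmul_ne_zero {f g : Series K} {S : Finset Letter} (h : gmul f g S ≠ 0) :
    ∃ T, T ⊆ S ∧ f T ≠ 0 ∧ g (S \ T) ≠ 0 := by
  obtain ⟨T, hT, hne⟩ := Finset.exists_ne_zero_of_sum_ne_zero h
  refine ⟨T, Finset.mem_powerset.1 hT, ?_, ?_⟩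
  · intro h0; exact hne (by simp [h0])
  · intro h0; exact hne (by simp [h0])

theorem of_pderivG_ne_zero {a : Letter} {f : Series K} {S : Finset Letter}
    (h : pderivG a f S ≠ 0) : a ∉ S ∧ f (insert a S) ≠ 0 := by
  unfold pderivG at h
  split_ifs at h with ha
  · exact absurd rfl h
  · exact ⟨ha, fun h0 => h (by simp [h0])⟩

theorem signG_mem {f : Series K} (hf : f ∈ Htilde K) : signG f ∈ Htilde K :=
  fun S hS => hf S (fun h0 => hS (by simp [signG, h0]))

theorem lx_ne_ly (i j : ℕ) : ly j ≠ lx i := by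
  intro h
  have h' := toLex.injective h
  cases h'

theorem exists_lt_of_pderivG_lx {f : Series K} (hf : f ∈ Htilde K) {i : ℕ} {T : Finset Letter}
    (h : pderivG (lx i) f T ≠ 0) : ∃ j, i < j ∧ ly j ∈ T := by
  obtain ⟨-, h2⟩ := of_pderivG_ne_zero h
  obtain ⟨j, hj, hm⟩ := hf _ h2 i (Finset.mem_insert_self _ _)
  exact ⟨j, hj, (Finset.mem_insert.1 hm).resolve_left (lx_ne_ly i j)⟩

/-- For `f, g` in the completion, the terms omitted in the definition of the bracket vanish. -/
theorem bracketTerm_eq_zero {f g : Series K} (hf : f ∈ Htilde K) (hg : g ∈ Htilde K)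
    {S : Finset Letter} {i : ℕ} (hi : S.sup letterIndex ≤ i) : bracketTerm f g i S = 0 := by
  have key : ∀ T, T ⊆ S → ¬ ∃ j, i < j ∧ ly j ∈ T := by
    rintro T hT ⟨j, hj, hm⟩
    have h1 : letterIndex (ly j) ≤ S.sup letterIndex := Finset.le_sup (hT hm)
    have h2 : letterIndex (ly j) = j := rfl
    omega
  have h1 : gmul (pderivG (lx i) (signG f)) (pderivG (ly i) g) S = 0 := by
    by_contra h
    obtain ⟨T, hT, ha, -⟩ := exists_of_gmul_ne_zero h
    exact key T hT (exists_lt_of_pderivG_lx (signG_mem hf) ha)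
  have h2 : gmul (pderivG (ly i) (signG f)) (pderivG (lx i) g) S = 0 := by
    by_contra h
    obtain ⟨T, hT, -, hb⟩ := exists_of_gmul_ne_zero h
    exact key _ Finset.sdiff_subset (exists_lt_of_pderivG_lx hg hb)
  simp [bracketTerm, h1, h2]

variable (K)

/-- The even (`r = 0`) or odd (`r = 1`) formal sums. -/
def seriesParity (r : ℕ) : Submodule K (Series K) where
  carrier := {f | ∀ S, S.card % 2 ≠ r → f S = 0}
  add_mem' := by
    intro f g hf hg S hS
    simp [hf S hS, hg S hS]
  zero_mem' := by intro S _; rfl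
  smul_mem' := by
    intro c f hf S hS
    simp [hf S hS]

/-- The Poisson superalgebra of formal sums: product, bracket, and formal square of odd
elements. If `2 ≠ 0`, the square only repeats `½{f, f}`. -/
def poissonData : SuperData K (Series K) where
  even := seriesParity K 0
  odd := seriesParity K 1
  ops := {gmul, pbracket}
  sqs := {psquare}

/-- The letters of `x_n x_{n+1} x_{n+3} x_{n+4} ⋯ x_{n+3l-3} x_{n+3l-2} y_{n+3l}`. -/
def pivotLetters (n l : ℕ) : Finset Letter :=
  insert (ly (n + 3 * l))
    ((Finset.range l).image (fun m => lx (n + 3 * m)) ∪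
      (Finset.range l).image (fun m => lx (n + 3 * m + 1)))

open Classical in
/-- The pivot element `V_n = ∑_{l ≥ 0} x_n x_{n+1} ⋯ x_{n+3l-3} x_{n+3l-2} y_{n+3l}`. -/
noncomputable def pivotV (n : ℕ) : Series K := fun S =>
  if ∃ l, S = pivotLetters n l then 1 else 0

/-- The unit `1`. -/
def unitG : Series K := Pi.single ∅ 1

/-- The generators `V₀, V₁, V₂`. -/
noncomputable def pivotsV : Fin 3 → Series K := fun i => pivotV K i

/-- The Poisson superalgebra `P = Poisson(V₀, V₁, V₂)` (with unit). -/
noncomputable def algP : Submodule K (Series K) :=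
  (poissonData K).adjoin (insert (unitG K) (Set.range (pivotsV K)))

/-- The Poisson superalgebra without unit `Pᵒ`. -/
noncomputable def algPo : Submodule K (Series K) :=
  (poissonData K).adjoin (Set.range (pivotsV K))

end PoissonOps

/-! ### The Kantor double and the Jordan superalgebras -/

/-- The product of the Kantor double `A ⊕ Ā`; the pair `(a, a')` stands for `a + ā'`, and `sgn`
is the map `b ↦ (-1)^{|b|} b`. Thus `a • b = ab`, `ā • b = (-1)^{|b|} \overline{ab}`,
`a • b̄ = \overline{ab}`, `ā • b̄ = (-1)^{|b|} {a, b}`. -/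
def kantorMul {V : Type u} [Add V] (mul br : V → V → V) (sgn : V → V) (a b : V × V) : V × V :=
  (mul a.1 b.1 + br a.2 (sgn b.2), mul a.2 (sgn b.1) + mul a.1 b.2)

section Jordan

variable (K : Type u) [Field K]

/-- The Kantor double of the algebra of formal sums. -/
def kantorData : SuperData K (Series K × Series K) where
  even := (seriesParity K 0).prod (seriesParity K 1)
  odd := (seriesParity K 1).prod (seriesParity K 0)
  ops := {kantorMul gmul pbracket signG}
  sqs := ∅

/-- The Jordan superalgebra without unit `Jᵒ ⊂ J = Kan(P) = P ⊕ P̄`. -/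
noncomputable def algJo : Submodule K (Series K × Series K) := (algPo K).prod (algP K)

/-- The product of `P(L) = ⟨1⟩ ⊕ L`, `L = End Λ`: `1` is the unit and `L · L = 0`. -/
noncomputable def trivMul (a b : K × EndGr K) : K × EndGr K := (a.1 * b.1, a.1 • b.2 + b.1 • a.2)

/-- The bracket of `P(L) = ⟨1⟩ ⊕ L`: that of `L`, and `{1, P(L)} = 0`. -/
noncomputable def trivBracket (a b : K × EndGr K) : K × EndGr K := (0, superComm a.2 b.2)

/-- The map `a ↦ (-1)^{|a|} a` on `P(L) = ⟨1⟩ ⊕ L`. -/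
noncomputable def trivSign (a : K × EndGr K) : K × EndGr K := (a.1, evenPart a.2 - oddPart a.2)

/-- The Kantor double `Jor(L) = Kan(P(L))`, `L = End Λ`. -/
noncomputable def jorData : SuperData K ((K × EndGr K) × (K × EndGr K)) where
  even := ((⊤ : Submodule K K).prod (endEven K)).prod ((⊥ : Submodule K K).prod (endOdd K))
  odd := ((⊥ : Submodule K K).prod (endOdd K)).prod ((⊤ : Submodule K K).prod (endEven K))
  ops := {kantorMul (trivMul K) (trivBracket K) (trivSign K)}
  sqs := ∅

/-- The Jordan superalgebra without unit `Kᵒ = Q ⊕ ⟨1̄⟩ ⊕ Q̄` of `K = Jor(Q)`. -/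
noncomputable def algKo : Submodule K ((K × EndGr K) × (K × EndGr K)) :=
  ((⊥ : Submodule K K).prod (algQ K)).prod ((⊤ : Submodule K K).prod (algQ K))

/-! ### The pairs of subspaces cut out by a plane -/

noncomputable def splitQ (p : ℝ × ℝ) : Submodule K (EndGr K) × Submodule K (EndGr K) :=
  ((lieData K).half (pivots K) p, (lieData K).half (pivots K) (-p))

noncomputable def splitA (p : ℝ × ℝ) : Submodule K (EndGr K) × Submodule K (EndGr K) :=
  ((assocData K).half (pivots K) p, (assocData K).half (pivots K) (-p))

noncomputable def splitP (p : ℝ × ℝ) : Submodule K (Series K) × Submodule K (Series K) :=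
  ((poissonData K).half (pivotsV K) p, (poissonData K).half (pivotsV K) (-p))

/-- `J₊ = P₊ ⊕ P̄₊ ⊕ ⟨1̄⟩` and `J₋ = P₋ ⊕ P̄₋`. -/
noncomputable def splitJ (p : ℝ × ℝ) :
    Submodule K (Series K × Series K) × Submodule K (Series K × Series K) :=
  ((splitP K p).1.prod ((splitP K p).1 ⊔ Submodule.span K {unitG K}),
    (splitP K p).2.prod (splitP K p).2)

/-- `K₊ = Q₊ ⊕ Q̄₊ ⊕ ⟨1̄⟩` and `K₋ = Q₋ ⊕ Q̄₋`. -/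
noncomputable def splitK (p : ℝ × ℝ) :
    Submodule K ((K × EndGr K) × (K × EndGr K)) × Submodule K ((K × EndGr K) × (K × EndGr K)) :=
  (((⊥ : Submodule K K).prod (splitQ K p).1).prod ((⊤ : Submodule K K).prod (splitQ K p).1),
    ((⊥ : Submodule K K).prod (splitQ K p).2).prod ((⊥ : Submodule K K).prod (splitQ K p).2))

end Jordan

/-! ### Filtrations, parts and local nilpotency for general `SuperData` -/

/-! Everything rests on the position of the multidegrees in space. The multidegrees of the pivot
elements satisfy `w(n+3) = w(n+1) + 2 w(n)`, a recursion with characteristic polynomial `t³ - t -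
2`, so the coordinate `Y₂ + iY₃` of `v_n` is `mu ^ n`. Here `|mu| ≤ 6/5`, while the total degree of
`v_n` grows at least like `(3/2)^n`: the pivot elements are far closer to the axis `OY₁` than to the
origin.

The same holds for all nonzero monomials, by self-similarity. The relation `v_n = ∂_n + x_n x_{n+1}
v_{n+3}` and the commutation rules rewrite every monomial, for each `n`, as a combination of words
in `v_n, v_{n+1}, v_{n+2}` multiplied by letters of small index. The letters contribute only
finitely many weights. Hence the distance to the axis is at most `C + δ · (total degree)`, with `δ`
as small as desired (`SelfSimilar.twisted_le`).

Local nilpotency follows (`nilFiltered_part`). Finitely many elements with `ℓ > 0` on their degrees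
satisfy `kℓ ≥ 3 + |τ|` for some `k`, where `τ` is the total degree. Products of `n` such elements
have `kℓ ≥ n` and `kℓ ≥ τ`, whereas a nonzero product has `ℓ ≤ C + τ/(2k) ≤ C + ℓ/2`; so `n` is
bounded. The halves `ℓ > 0` and `ℓ < 0` meet in zero because a weight on matrix entries (or on
monomials) separates the multidegrees, and they exhaust the algebra when the plane contains no
nonzero lattice point.

Two different planes are separated by a pivot element: no power `mu ^ n` with `n ≥ 1` is real, so
the arguments of these powers are dense in the circle (`exists_pivotWeight_between`). There are
continuum many generic planes, since each nonzero lattice point excludes at most one slope `t` among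
the forms `(1, t)`.

`IsPlaneGraded` collects what this argument needs. It is verified for the associative hull,
inherited by the Lie superalgebra, and verified for the Poisson superalgebra; there the infinite
bracket is first replaced by finitely many terms that give the same coefficients on finitely many
letters. For the Kantor doubles, a filtration of the base is shifted so that the barred unit gets
degree one (`IsKantorBase.isNilFiltration`). -/

namespace SuperData

variable {K V : Type u} [Field K] [AddCommGroup V] [Module K V] (D : SuperData K V)

/-- The component of the given parity (`true` is odd). -/
def par : Bool → Submodule K V
  | false => D.even
  | true => D.odd

/-- The products are bilinear and respect the parity, and the squares are quadratic maps on the odd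
part whose polarization is one of the products. -/
structure IsRegular : Prop where
  op_bilinear : ∀ m ∈ D.ops, ∃ B : V →ₗ[K] V →ₗ[K] V, ∀ a b, m a b = B a b
  op_parity : ∀ m ∈ D.ops, ∀ i j, ∀ a ∈ D.par i, ∀ b ∈ D.par j, m a b ∈ D.par (xor i j)
  sq_parity : ∀ q ∈ D.sqs, ∀ a ∈ D.odd, q a ∈ D.even
  sq_smul : ∀ q ∈ D.sqs, ∀ (c : K), ∀ a ∈ D.odd, q (c • a) = (c ^ 2) • q a
  sq_add : ∀ q ∈ D.sqs, ∃ m ∈ D.ops, ∀ a ∈ D.odd, ∀ b ∈ D.odd, q (a + b) = q a + q b + m a b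
  parity_disjoint : D.even ⊓ D.odd = ⊥

variable {D}

theorem par_cases {a : V} {i : Bool} (h : a ∈ D.par i) : a ∈ D.even ∨ a ∈ D.odd := by
  cases i
  · exact Or.inl h
  · exact Or.inr h

theorem span_le_parity_sup {G : Set V} (hG : ∀ a ∈ G, a ∈ D.even ∨ a ∈ D.odd) :
    Submodule.span K G ≤
      (Submodule.span K (G ∩ D.even) ⊔ Submodule.span K (G ∩ D.odd)) := by
  rw [Submodule.span_le]
  intro a ha
  rcases hG a ha with h | h
  · exact Submodule.mem_sup_left (Submodule.subset_span ⟨ha, h⟩)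
  · exact Submodule.mem_sup_right (Submodule.subset_span ⟨ha, h⟩)

theorem isGraded_span {G : Set V} (hG : ∀ a ∈ G, a ∈ D.even ∨ a ∈ D.odd) :
    D.IsGraded (Submodule.span K G) := by
  refine (span_le_parity_sup hG).trans (sup_le_sup ?_ ?_)
  · exact le_inf (Submodule.span_mono Set.inter_subset_left)
      (Submodule.span_le.2 Set.inter_subset_right)
  · exact le_inf (Submodule.span_mono Set.inter_subset_left)
      (Submodule.span_le.2 Set.inter_subset_right)

/-! ### Extending closure conditions from generators to spans -/

namespace IsRegular

variable (hD : D.IsRegular)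
include hD

theorem op_mem_span {m : V → V → V} (hm : m ∈ D.ops) {G H : Set V} {S : Submodule K V}
    (h : ∀ a ∈ G, ∀ b ∈ H, m a b ∈ S) :
    ∀ a ∈ Submodule.span K G, ∀ b ∈ Submodule.span K H, m a b ∈ S := by
  obtain ⟨B, hB⟩ := hD.op_bilinear m hm
  intro a ha b hb
  rw [hB]
  have h1 : ∀ a ∈ G, Submodule.span K H ≤ S.comap (B a) := by
    intro a ha
    rw [Submodule.span_le]
    intro b hb
    have := h a ha b hb
    rw [hB] at this
    exact this
  have h2 : Submodule.span K G ≤ S.comap (B.flip b) := by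
    rw [Submodule.span_le]
    intro a ha
    exact h1 a ha hb
  exact h2 ha

theorem op_mem_sup {m : V → V → V} (hm : m ∈ D.ops) {P Q S : Submodule K V}
    {P' Q' : Submodule K V} (h1 : ∀ a ∈ P, ∀ b ∈ Q, m a b ∈ S) (h2 : ∀ a ∈ P, ∀ b ∈ Q', m a b ∈ S)
    (h3 : ∀ a ∈ P', ∀ b ∈ Q, m a b ∈ S) (h4 : ∀ a ∈ P', ∀ b ∈ Q', m a b ∈ S) :
    ∀ a ∈ P ⊔ P', ∀ b ∈ Q ⊔ Q', m a b ∈ S := by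
  obtain ⟨B, hB⟩ := hD.op_bilinear m hm
  intro a ha b hb
  obtain ⟨a, ha0, a', ha', rfl⟩ := Submodule.mem_sup.1 ha
  obtain ⟨b, hb0, b', hb', rfl⟩ := Submodule.mem_sup.1 hb
  simp only [hB] at *
  simp only [map_add, LinearMap.add_apply]
  exact S.add_mem (S.add_mem (h1 a ha0 b hb0) (h3 a' ha' b hb0))
    (S.add_mem (h2 a ha0 b' hb') (h4 a' ha' b' hb'))

theorem op_zero_left {m : V → V → V} (hm : m ∈ D.ops) (b : V) : m 0 b = 0 := by
  obtain ⟨B, hB⟩ := hD.op_bilinear m hm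
  rw [hB]; simp

theorem op_zero_right {m : V → V → V} (hm : m ∈ D.ops) (a : V) : m a 0 = 0 := by
  obtain ⟨B, hB⟩ := hD.op_bilinear m hm
  rw [hB]; simp

theorem sq_zero {q : V → V} (hq : q ∈ D.sqs) : q 0 = 0 := by
  have := hD.sq_smul q hq 0 0 (Submodule.zero_mem _)
  simpa using this

theorem eq_zero_of_par {a : V} (h0 : a ∈ D.par false) (h1 : a ∈ D.par true) : a = 0 := by
  have : a ∈ D.even ⊓ D.odd := ⟨h0, h1⟩
  rw [hD.parity_disjoint] at this
  exact this

/-- The even component of an odd element is itself odd, hence zero. -/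
theorem mem_span_odd {G : Set V} (hG : ∀ a ∈ G, a ∈ D.even ∨ a ∈ D.odd) {f : V}
    (hf : f ∈ Submodule.span K G) (ho : f ∈ D.odd) : f ∈ Submodule.span K (G ∩ D.odd) := by
  obtain ⟨u, hu, v, hv, rfl⟩ := Submodule.mem_sup.1 (span_le_parity_sup hG hf)
  have hu' : u ∈ D.even := Submodule.span_le.2 Set.inter_subset_right hu
  have hv' : v ∈ D.odd := Submodule.span_le.2 Set.inter_subset_right hv
  have : u = 0 := by
    refine hD.eq_zero_of_par hu' ?_
    have := D.odd.sub_mem ho hv'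
    rwa [add_sub_cancel_right] at this
  rwa [this, zero_add]

/-- A square is not linear, but its polarization is one of the products; squares of odd generators
and products of generators therefore control it on the whole span. -/
theorem sq_mem_of_span {q : V → V} (hq : q ∈ D.sqs) {G : Set V} {S : Submodule K V}
    (hG : ∀ a ∈ G, a ∈ D.even ∨ a ∈ D.odd) (h1 : ∀ a ∈ G, a ∈ D.odd → q a ∈ S)
    (h2 : ∀ m ∈ D.ops, ∀ a ∈ G, ∀ b ∈ G, m a b ∈ S) :
    ∀ f ∈ Submodule.span K G, f ∈ D.odd → q f ∈ S := by
  intro f hf ho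
  obtain ⟨m, hm, hadd⟩ := hD.sq_add q hq
  have hf' := hD.mem_span_odd hG hf ho
  -- Oddness is carried along because the polarization formula requires it, and membership in the
  -- span of `G` because the products are only known to land in `S` there.
  have key : q f ∈ S ∧ f ∈ D.odd ∧ f ∈ Submodule.span K G := by
    clear hf ho
    induction hf' using Submodule.span_induction with
    | mem x hx => exact ⟨h1 x hx.1 hx.2, hx.2, Submodule.subset_span hx.1⟩
    | zero => rw [hD.sq_zero hq]; exact ⟨S.zero_mem, D.odd.zero_mem, Submodule.zero_mem _⟩
    | add x y _ _ hx hy =>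
      refine ⟨?_, D.odd.add_mem hx.2.1 hy.2.1, Submodule.add_mem _ hx.2.2 hy.2.2⟩
      rw [hadd x hx.2.1 y hy.2.1]
      exact S.add_mem (S.add_mem hx.1 hy.1)
        (hD.op_mem_span hm (h2 m hm) x hx.2.2 y hy.2.2)
    | smul c x _ hx =>
      refine ⟨?_, D.odd.smul_mem _ hx.2.1, Submodule.smul_mem _ _ hx.2.2⟩
      rw [hD.sq_smul q hq c x hx.2.1]
      exact S.smul_mem _ hx.1
  exact key.1

/-- Adding even elements creates no new odd ones: the even component of an odd sum vanishes, which
leaves an odd element of `P`. -/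
theorem sq_mem_sup {q : V → V} {P P' S : Submodule K V}
    (hP : P' ≤ D.even) (hPg : D.IsGraded P)
    (h1 : ∀ a ∈ P, a ∈ D.odd → q a ∈ S) : ∀ f ∈ P ⊔ P', f ∈ D.odd → q f ∈ S := by
  intro f hf ho
  obtain ⟨a, ha, b, hb, rfl⟩ := Submodule.mem_sup.1 hf
  obtain ⟨u, hu, v, hv, rfl⟩ := Submodule.mem_sup.1 (hPg ha)
  have h0 : u + b = 0 := by
    refine hD.eq_zero_of_par (D.even.add_mem hu.2 (hP hb)) ?_
    have := D.odd.sub_mem ho hv.2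
    rwa [show u + v + b - v = u + b by abel] at this
  rw [show u + v + b = (u + b) + v by abel, h0, zero_add]
  exact h1 v hv.1 hv.2

end IsRegular

theorem isSubalgebra_adjoin (T : Set V) : D.IsSubalgebra (D.adjoin T) := by
  constructor
  · intro m hm a ha b hb
    rw [adjoin, Submodule.mem_sInf] at *
    intro S hS
    exact hS.1.1 m hm a (ha S hS) b (hb S hS)
  · intro q hq a ha ho
    rw [adjoin, Submodule.mem_sInf] at *
    intro S hS
    exact hS.1.2 q hq a (ha S hS) ho

theorem subset_adjoin (T : Set V) : T ⊆ D.adjoin T := by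
  intro x hx
  rw [SetLike.mem_coe, adjoin, Submodule.mem_sInf]
  intro S hS
  exact hS.2 hx

theorem adjoin_le {T : Set V} {S : Submodule K V} (hS : D.IsSubalgebra S) (hT : T ⊆ S) :
    D.adjoin T ≤ S :=
  sInf_le ⟨hS, hT⟩

theorem adjoin_mono {T T' : Set V} (h : T ⊆ T') : D.adjoin T ≤ D.adjoin T' :=
  adjoin_le (isSubalgebra_adjoin T') (h.trans (subset_adjoin T'))

/-! #### Descending filtrations -/

variable (D) in
/-- A descending filtration compatible with the operations that vanishes eventually. -/
structure IsNilFiltration (S : ℕ → Submodule K V) : Prop where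
  antitone : Antitone S
  op_mem : ∀ m ∈ D.ops, ∀ i j, ∀ a ∈ S i, ∀ b ∈ S j, m a b ∈ S (i + j)
  sq_mem : ∀ q ∈ D.sqs, ∀ i, ∀ a ∈ S i, a ∈ D.odd → q a ∈ S (2 * i)
  eventually_bot : ∃ N, S N = ⊥

/-- The first step is itself a subalgebra, so it contains everything generated by `T`, and a product
of `n` factors falls into step `n`. -/
theorem IsNilFiltration.isNilpotent {S : ℕ → Submodule K V} (hS : D.IsNilFiltration S) {T : Set V}
    (hT : T ⊆ S 1) : D.IsNilpotent (D.adjoin T) := by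
  have hsub : D.adjoin T ≤ S 1 := by
    refine adjoin_le ⟨?_, ?_⟩ hT
    · intro m hm a ha b hb
      exact hS.antitone (by norm_num) (hS.op_mem m hm 1 1 a ha b hb)
    · intro q hq a ha ho
      exact hS.antitone (by norm_num) (hS.sq_mem q hq 1 a ha ho)
  obtain ⟨N, hN⟩ := hS.eventually_bot
  refine ⟨N, fun n hn x hx => ?_⟩
  have key : x ∈ S n := by
    clear hn
    induction hx with
    | base x hx => exact hsub hx
    | op m i j x y hm _ _ hx hy => exact hS.op_mem m hm i j x hx y hy
    | sq q i x hq ho _ hx => exact hS.sq_mem q hq i x hx ho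
  have := hS.antitone hn key
  rw [hN] at this
  exact this

variable (D) in
/-- Every finite subset of `A` lies in the third step of a graded filtration as above. -/
def NilFiltered (A : Submodule K V) : Prop :=
  ∀ T : Finset V, (T : Set V) ⊆ A →
    ∃ S : ℕ → Submodule K V, D.IsNilFiltration S ∧ (∀ i, D.IsGraded (S i)) ∧ (T : Set V) ⊆ S 3

/-- Step one would suffice here; the third step leaves room for the index shifts in the Kantor
double. -/
theorem NilFiltered.isLocallyNilpotent {A : Submodule K V} (h : D.NilFiltered A) :
    D.IsLocallyNilpotent A := by
  intro T hT
  obtain ⟨S, hS, -, h3⟩ := h T hT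
  exact hS.isNilpotent (h3.trans (hS.antitone (by norm_num)))

/-! #### Spans of monomials of prescribed degrees -/

variable (D) in
/-- The span of the monomials whose multidegree belongs to `Γ`. -/
def part (g : Fin 3 → V) (Γ : Set (Fin 3 → ℕ)) : Submodule K V :=
  Submodule.span K {x | ∃ d ∈ Γ, D.IsMonomial g d x}

theorem part_mono {g : Fin 3 → V} {Γ Δ : Set (Fin 3 → ℕ)} (h : Γ ⊆ Δ) :
    D.part g Γ ≤ D.part g Δ :=
  Submodule.span_mono fun _ ⟨d, hd, hx⟩ => ⟨d, h hd, hx⟩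

theorem part_union {g : Fin 3 → V} (Γ Δ : Set (Fin 3 → ℕ)) :
    D.part g (Γ ∪ Δ) = D.part g Γ ⊔ D.part g Δ := by
  rw [part, part, part, ← Submodule.span_union]
  congr 1
  ext x
  simp only [Set.mem_ofPred_eq, Set.mem_union, or_and_right, exists_or]

theorem component_le_part {g : Fin 3 → V} {Γ : Set (Fin 3 → ℕ)} {d : Fin 3 → ℕ} (hd : d ∈ Γ) :
    D.component g d ≤ D.part g Γ :=
  Submodule.span_mono fun _ hx => ⟨d, hd, hx⟩

theorem half_eq_part (g : Fin 3 → V) (p : ℝ × ℝ) :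
    D.half g p = D.part g {d | 0 < planeForm p (fun i => (d i : ℤ))} := by
  refine le_antisymm (iSup₂_le fun d hd => component_le_part hd) ?_
  rw [part, Submodule.span_le]
  rintro x ⟨d, hd, hx⟩
  exact le_iSup₂ (f := fun (d : Fin 3 → ℕ) (_ : 0 < planeForm p (fun i => (d i : ℤ))) =>
    D.component g d) d hd (Submodule.subset_span hx)

theorem IsMonomial.parity (hD : D.IsRegular) {g : Fin 3 → V} (hg : ∀ i, g i ∈ D.odd)
    {d : Fin 3 → ℕ} {x : V} (hx : D.IsMonomial g d x) : ∃ i, x ∈ D.par i := by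
  induction hx with
  | gen i => exact ⟨true, hg i⟩
  | op m d e x y hm _ _ hx hy =>
    obtain ⟨i, hi⟩ := hx
    obtain ⟨j, hj⟩ := hy
    exact ⟨_, hD.op_parity m hm i j x hi y hj⟩
  | sq q d x hq ho _ _ => exact ⟨false, hD.sq_parity q hq x ho⟩

section Parts

variable (hD : D.IsRegular) {g : Fin 3 → V} (hg : ∀ i, g i ∈ D.odd)
include hD

theorem op_mem_part {m : V → V → V} (hm : m ∈ D.ops) {Γ Δ E : Set (Fin 3 → ℕ)}
    (h : ∀ d ∈ Γ, ∀ e ∈ Δ, d + e ∈ E) :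
    ∀ a ∈ D.part g Γ, ∀ b ∈ D.part g Δ, m a b ∈ D.part g E := by
  refine hD.op_mem_span hm ?_
  rintro a ⟨d, hd, ha⟩ b ⟨e, he, hb⟩
  exact Submodule.subset_span ⟨d + e, h d hd e he, IsMonomial.op m d e a b hm ha hb⟩

include hg

theorem sq_mem_part {q : V → V} (hq : q ∈ D.sqs) {Γ E : Set (Fin 3 → ℕ)}
    (h : ∀ d ∈ Γ, ∀ e ∈ Γ, d + e ∈ E) :
    ∀ a ∈ D.part g Γ, a ∈ D.odd → q a ∈ D.part g E := by
  refine hD.sq_mem_of_span hq ?_ ?_ ?_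
  · rintro a ⟨d, -, ha⟩
    obtain ⟨i, hi⟩ := ha.parity hD hg
    exact par_cases hi
  · rintro a ⟨d, hd, ha⟩ ho
    refine Submodule.subset_span ⟨2 • d, ?_, IsMonomial.sq q d a hq ho ha⟩
    rw [two_smul]
    exact h d hd d hd
  · rintro m hm a ⟨d, hd, ha⟩ b ⟨e, he, hb⟩
    exact Submodule.subset_span ⟨d + e, h d hd e he, IsMonomial.op m d e a b hm ha hb⟩

theorem isGraded_part (Γ : Set (Fin 3 → ℕ)) : D.IsGraded (D.part g Γ) := by
  refine isGraded_span ?_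
  rintro a ⟨d, -, ha⟩
  obtain ⟨i, hi⟩ := ha.parity hD hg
  exact par_cases hi

theorem isSubalgebra_part {Γ : Set (Fin 3 → ℕ)} (h : ∀ d ∈ Γ, ∀ e ∈ Γ, d + e ∈ Γ) :
    D.IsSubalgebra (D.part g Γ) :=
  ⟨fun _ hm => op_mem_part hD hm h, fun _ hq => sq_mem_part hD hg hq h⟩

/-- The zero degree is removed from the index set because it is the one lattice point that every
plane contains. -/
theorem adjoin_range_eq_part : D.adjoin (Set.range g) = D.part g {d | d ≠ 0} := by
  refine le_antisymm (adjoin_le (isSubalgebra_part hD hg ?_) ?_) ?_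
  · intro d hd e _ h
    refine hd (funext fun i => ?_)
    have := congrFun h i
    simp only [Pi.add_apply, Pi.zero_apply] at this ⊢
    omega
  · rintro _ ⟨i, rfl⟩
    refine Submodule.subset_span ⟨Pi.single i 1, ?_, IsMonomial.gen i⟩
    intro h
    simpa using congrFun h i
  · rw [part, Submodule.span_le]
    rintro x ⟨d, -, hx⟩
    induction hx with
    | gen i => exact subset_adjoin _ ⟨i, rfl⟩
    | op m d e x y hm _ _ hx hy => exact (isSubalgebra_adjoin _).1 m hm x hx y hy
    | sq q d x hq ho _ hx => exact (isSubalgebra_adjoin _).2 q hq x hx ho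

end Parts

theorem exists_finset_mem_part {g : Fin 3 → V} {Γ : Set (Fin 3 → ℕ)} {x : V}
    (hx : x ∈ D.part g Γ) :
    ∃ F : Finset (Fin 3 → ℕ), (F : Set (Fin 3 → ℕ)) ⊆ Γ ∧ x ∈ D.part g F := by
  classical
  induction hx using Submodule.span_induction with
  | mem x h =>
    obtain ⟨d, hd, hx⟩ := h
    exact ⟨{d}, by simpa using hd, Submodule.subset_span ⟨d, by simp, hx⟩⟩
  | zero => exact ⟨∅, by simp, Submodule.zero_mem _⟩
  | add x y _ _ hx hy =>
    obtain ⟨F, hF, hx⟩ := hx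
    obtain ⟨F', hF', hy⟩ := hy
    refine ⟨F ∪ F', by simp [hF, hF'], Submodule.add_mem _ ?_ ?_⟩
    · exact part_mono (by simp) hx
    · exact part_mono (by simp) hy
  | smul c x _ hx =>
    obtain ⟨F, hF, hx⟩ := hx
    exact ⟨F, hF, Submodule.smul_mem _ _ hx⟩

theorem exists_finset_subset_part {g : Fin 3 → V} {Γ : Set (Fin 3 → ℕ)} (T : Finset V)
    (hT : (T : Set V) ⊆ D.part g Γ) :
    ∃ F : Finset (Fin 3 → ℕ), (F : Set (Fin 3 → ℕ)) ⊆ Γ ∧ (T : Set V) ⊆ D.part g F := by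
  classical
  have h : ∀ t : V, ∃ F : Finset (Fin 3 → ℕ), (F : Set (Fin 3 → ℕ)) ⊆ Γ ∧
      (t ∈ T → t ∈ D.part g F) := by
    intro t
    by_cases ht : t ∈ T
    · obtain ⟨F, hF, h⟩ := exists_finset_mem_part (hT ht)
      exact ⟨F, hF, fun _ => h⟩
    · exact ⟨∅, by simp, fun h => absurd h ht⟩
  choose F hF hmem using h
  refine ⟨T.biUnion F, ?_, fun t ht => part_mono ?_ (hmem t ht)⟩
  · intro d hd
    obtain ⟨t, -, ht⟩ := Finset.mem_biUnion.1 (Finset.mem_coe.1 hd)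
    exact hF t ht
  · intro d hd
    exact Finset.mem_coe.2 (Finset.mem_biUnion.2 ⟨t, ht, hd⟩)

/-- If the linear form `ℓ` grows sublinearly in the total degree `τ` on the degrees of the nonzero
monomials, then the sum of the components with `ℓ > 0` is locally nilpotent. -/
theorem nilFiltered_part (hD : D.IsRegular) {g : Fin 3 → V} (hg : ∀ i, g i ∈ D.odd)
    (l τ : (Fin 3 → ℕ) →+ ℝ)
    (hb : ∀ δ > 0, ∃ C : ℝ, ∀ d x, D.IsMonomial g d x → x ≠ 0 → l d ≤ C + δ * τ d) :
    D.NilFiltered (D.part g {d | 0 < l d}) := by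
  intro T hT
  obtain ⟨F, hF, hTF⟩ := exists_finset_subset_part T hT
  -- Only finitely many degrees occur and `l` is positive on each, so one factor `k` dominates all
  -- the ratios; the `3` is the filtration step in which `T` has to lie.
  obtain ⟨c, hc⟩ : ∃ c : ℝ, ∀ d ∈ F, (3 + |τ d|) / l d ≤ c := by
    obtain ⟨c, hc⟩ := (F.image fun d => (3 + |τ d|) / l d).exists_le
    exact ⟨c, fun d hd => hc _ (Finset.mem_image_of_mem _ hd)⟩
  set k : ℝ := max c 1 with hk
  have hk1 : 1 ≤ k := le_max_right _ _
  have hF' : ∀ d ∈ F, 3 + |τ d| ≤ k * l d := by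
    intro d hd
    have hl : 0 < l d := hF hd
    have := (hc d hd).trans (le_max_left c 1)
    rwa [div_le_iff₀ hl] at this
  -- Both conditions are additive in the degree. The first counts factors; the second bounds the
  -- total degree by `l`, so that the sublinear estimate can be turned against `l` itself.
  let S : ℕ → Submodule K V := fun n => D.part g {d | (n : ℝ) ≤ k * l d ∧ τ d ≤ k * l d}
  have hadd : ∀ i j : ℕ, ∀ d ∈ {d : Fin 3 → ℕ | (i : ℝ) ≤ k * l d ∧ τ d ≤ k * l d},
      ∀ e ∈ {d : Fin 3 → ℕ | (j : ℝ) ≤ k * l d ∧ τ d ≤ k * l d},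
      d + e ∈ {d : Fin 3 → ℕ | ((i + j : ℕ) : ℝ) ≤ k * l d ∧ τ d ≤ k * l d} := by
    rintro i j d ⟨h1, h2⟩ e ⟨h3, h4⟩
    refine ⟨?_, ?_⟩
    · rw [map_add, mul_add]; push_cast; linarith
    · rw [map_add, map_add, mul_add]; linarith
  refine ⟨S, ⟨?_, ?_, ?_, ?_⟩, fun i => isGraded_part hD hg _, ?_⟩
  · intro i j hij
    refine part_mono ?_
    rintro d ⟨h1, h2⟩
    exact ⟨le_trans (by exact_mod_cast hij) h1, h2⟩
  · intro m hm i j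
    exact op_mem_part hD hm (hadd i j)
  · intro q hq i
    refine sq_mem_part hD hg hq ?_
    rw [two_mul]
    exact hadd i i
  -- With this `δ`, a nonzero monomial in step `N` has `l d ≤ C + l d / 2`, hence `N ≤ k * l d ≤
  -- 2kC`, against the choice of `N`.
  · obtain ⟨C, hC⟩ := hb (1 / (2 * k)) (by positivity)
    obtain ⟨N, hN⟩ := exists_nat_gt (k * (2 * C))
    refine ⟨N, ?_⟩
    rw [eq_bot_iff]
    refine Submodule.span_le.2 ?_
    rintro x ⟨d, ⟨h1, h2⟩, hx⟩
    by_contra hx0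
    have h3 := hC d x hx hx0
    have h4 : 1 / (2 * k) * τ d ≤ 1 / 2 * l d := by
      calc 1 / (2 * k) * τ d ≤ 1 / (2 * k) * (k * l d) := by gcongr
        _ = 1 / 2 * l d := by field_simp
    have h5 : k * l d ≤ k * (2 * C) := by gcongr; linarith
    linarith
  · refine hTF.trans (part_mono ?_)
    intro d hd
    have := hF' d hd
    have h0 := abs_nonneg (τ d)
    have h1 := le_abs_self (τ d)
    refine ⟨?_, by linarith⟩
    push_cast
    linarith

/-! #### Kantor doubles -/

section Kantor

variable (D) in
/-- The Kantor double as `SuperData`. -/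
def kantor (mul br : V → V → V) (sgn : V → V) : SuperData K (V × V) where
  even := D.even.prod D.odd
  odd := D.odd.prod D.even
  ops := {kantorMul mul br sgn}
  sqs := ∅

theorem IsGraded.map_mem {A : Submodule K V} (hA : D.IsGraded A) {sgn : V →ₗ[K] V}
    (h0 : ∀ a ∈ D.even, sgn a = a) (h1 : ∀ a ∈ D.odd, sgn a = -a) : ∀ a ∈ A, sgn a ∈ A := by
  intro a ha
  obtain ⟨u, hu, v, hv, rfl⟩ := Submodule.mem_sup.1 (hA ha)
  rw [map_add, h0 u hu.2, h1 v hv.2]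
  exact A.add_mem hu.1 (A.neg_mem hv.1)

theorem IsGraded.sup {A B : Submodule K V} (hA : D.IsGraded A) (hB : D.IsGraded B) :
    D.IsGraded (A ⊔ B) := by
  refine sup_le (hA.trans ?_) (hB.trans ?_)
  · exact sup_le_sup (inf_le_inf_right _ le_sup_left) (inf_le_inf_right _ le_sup_left)
  · exact sup_le_sup (inf_le_inf_right _ le_sup_right) (inf_le_inf_right _ le_sup_right)

theorem IsGraded.of_le_even {A : Submodule K V} (hA : A ≤ D.even) : D.IsGraded A :=
  (le_inf le_rfl hA).trans le_sup_left

theorem IsGraded.kantor {A B : Submodule K V} (hA : D.IsGraded A) (hB : D.IsGraded B)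
    (mul br : V → V → V) (sgn : V → V) : (D.kantor mul br sgn).IsGraded (A.prod B) := by
  rintro ⟨a, b⟩ ⟨ha, hb⟩
  obtain ⟨u, hu, v, hv, rfl⟩ := Submodule.mem_sup.1 (hA ha)
  obtain ⟨u', hu', v', hv', rfl⟩ := Submodule.mem_sup.1 (hB hb)
  have : (u + v, u' + v') = (u, v') + (v, u') := by simp [add_comm]
  rw [this]
  exact Submodule.add_mem_sup ⟨⟨hu.1, hv'.1⟩, ⟨hu.2, hv'.2⟩⟩ ⟨⟨hv.1, hu'.1⟩, ⟨hv.2, hu'.2⟩⟩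

variable (D) in
/-- The hypotheses on a unital algebra with bracket under which its Kantor double is considered. -/
structure IsKantorBase (mul br : V → V → V) (sgn : V →ₗ[K] V) (e : V) : Prop where
  regular : D.IsRegular
  mul_mem : mul ∈ D.ops
  br_mem : br ∈ D.ops
  sgn_even : ∀ a ∈ D.even, sgn a = a
  sgn_odd : ∀ a ∈ D.odd, sgn a = -a
  unit_even : e ∈ D.even
  unit_mul : ∀ a, mul e a = a
  mul_unit : ∀ a, mul a e = a
  unit_br : ∀ a, br e a = 0
  br_unit : ∀ a, br a e = 0

variable {mul br : V → V → V} {sgn : V →ₗ[K] V} {e : V} (hK : D.IsKantorBase mul br sgn e)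
include hK

/-- A common computation for subalgebras and for filtrations. The bracket kills `e`, so the barred
unit is invisible in the first coordinate. In the second it acts as the identity up to sign, which
costs the inclusions `W ≤ R'` and `U ≤ R'`, unless the corresponding multiple of `e` is absent. -/
theorem IsKantorBase.kantorMul_mem {U U' W W' R R' E E' : Submodule K V}
    (hE : E ≤ Submodule.span K {e}) (hE' : E' ≤ Submodule.span K {e})
    (h1 : ∀ a ∈ U, ∀ b ∈ W, mul a b ∈ R) (h2 : ∀ a ∈ U', ∀ b ∈ W', br a b ∈ R)
    (h3 : ∀ a ∈ U', ∀ b ∈ W, mul a b ∈ R') (h4 : ∀ a ∈ U, ∀ b ∈ W', mul a b ∈ R')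
    (h5 : E = ⊥ ∨ W ≤ R') (h6 : E' = ⊥ ∨ U ≤ R')
    (hW : ∀ a ∈ W, sgn a ∈ W) (hW' : ∀ a ∈ W', sgn a ∈ W') :
    ∀ a ∈ U.prod (U' ⊔ E), ∀ b ∈ W.prod (W' ⊔ E'), kantorMul mul br sgn a b ∈ R.prod R' := by
  have hD := hK.regular
  obtain ⟨Bm, hBm⟩ := hD.op_bilinear mul hK.mul_mem
  obtain ⟨Bb, hBb⟩ := hD.op_bilinear br hK.br_mem
  rintro ⟨a, a'⟩ ⟨ha, ha'⟩ ⟨b, b'⟩ ⟨hb, hb'⟩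
  obtain ⟨u, hu, z, hz, rfl⟩ := Submodule.mem_sup.1 ha'
  obtain ⟨w, hw, y, hy, rfl⟩ := Submodule.mem_sup.1 hb'
  obtain ⟨c, rfl⟩ := Submodule.mem_span_singleton.1 (hE hz)
  obtain ⟨c', rfl⟩ := Submodule.mem_span_singleton.1 (hE' hy)
  have e1 := fun x => (hBm e x).symm.trans (hK.unit_mul x)
  have e2 := fun x => (hBm x e).symm.trans (hK.mul_unit x)
  have e3 := fun x => (hBb e x).symm.trans (hK.unit_br x)
  have e4 := fun x => (hBb x e).symm.trans (hK.br_unit x)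
  have e5 := hK.sgn_even e hK.unit_even
  refine ⟨?_, ?_⟩
  · simp only [kantorMul]
    simp only [hBb, map_add, map_smul, e5, LinearMap.add_apply, LinearMap.smul_apply, e3, e4,
      smul_zero, add_zero]
    refine R.add_mem (h1 a ha b hb) ?_
    rw [← hBb]
    exact h2 u hu _ (hW' w hw)
  · simp only [kantorMul]
    rw [hBm, hBm, map_add, map_add, map_smul, map_smul, LinearMap.add_apply,
      LinearMap.smul_apply, e1, e2, ← hBm, ← hBm]
    refine R'.add_mem (R'.add_mem (h3 u hu _ (hW b hb)) ?_) (R'.add_mem (h4 a ha w hw) ?_)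
    · rcases h5 with h | h
      -- From `c • e = 0` either the coefficient vanishes, or `e = 0` and then the unit law makes
      -- the whole space zero.
      · rw [h, Submodule.mem_bot] at hz
        rcases smul_eq_zero.1 hz with h0 | h0
        · rw [h0, zero_smul]; exact R'.zero_mem
        · have : ∀ x, x = (0 : V) := fun x => by rw [← hK.unit_mul x, h0, hBm, map_zero]; rfl
          rw [this (c • _)]; exact R'.zero_mem
      · exact R'.smul_mem _ (h (hW b hb))
    · rcases h6 with h | h
      · rw [h, Submodule.mem_bot] at hy
        rcases smul_eq_zero.1 hy with h0 | h0
        · rw [h0, zero_smul]; exact R'.zero_mem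
        · have : ∀ x, x = (0 : V) := fun x => by rw [← hK.unit_mul x, h0, hBm, map_zero]; rfl
          rw [this (c' • _)]; exact R'.zero_mem
      · exact R'.smul_mem _ (h ha)

/-- Products already lie in `A × A`: the barred unit is never reproduced. Taking `E` trivial or the
full line covers both halves of a decomposition. -/
theorem IsKantorBase.isSubalgebra {A E : Submodule K V} (hE : E ≤ Submodule.span K {e})
    (hA : D.IsSubalgebra A) (hg : D.IsGraded A) :
    (D.kantor mul br sgn).IsSubalgebra (A.prod (A ⊔ E)) := by
  have hs := hg.map_mem hK.sgn_even hK.sgn_odd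
  refine ⟨?_, by rintro q ⟨⟩⟩
  rintro _ rfl a ha b hb
  have hm := hA.1 mul hK.mul_mem
  have := hK.kantorMul_mem (R := A) (R' := A) hE hE hm (hA.1 br hK.br_mem) hm hm (Or.inr le_rfl)
    (Or.inr le_rfl) hs hs a ha b hb
  exact ⟨this.1, le_sup_left (a := A) this.2⟩

/-- The shifts are forced by the product. The bracket of barred elements from `S (i+1)` and `S
(j+1)` lands in `S (i+j+2)`, the unbarred part of level `i + j`. Multiplication by the barred unit,
of degree one, carries `S (j+2)` into the barred part of level `j + 1`. -/
theorem IsKantorBase.isNilFiltration {S : ℕ → Submodule K V} (hS : D.IsNilFiltration S)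
    (hg : ∀ i, D.IsGraded (S i)) :
    (D.kantor mul br sgn).IsNilFiltration
      (fun n => (S (n + 2)).prod (S (n + 1) ⊔ if n ≤ 1 then Submodule.span K {e} else ⊥)) := by
  have hs := fun i => (hg i).map_mem hK.sgn_even hK.sgn_odd
  have hE : ∀ n : ℕ, (if n ≤ 1 then Submodule.span K {e} else ⊥) ≤ Submodule.span K {e} := by
    intro n
    split_ifs
    · exact le_rfl
    · exact bot_le
  refine ⟨?_, ?_, by rintro q ⟨⟩, ?_⟩
  · intro i j hij
    refine Submodule.prod_mono (hS.antitone (by omega)) (sup_le_sup (hS.antitone (by omega)) ?_)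
    split_ifs
    · exact le_rfl
    · omega
    · exact bot_le
    · exact le_rfl
  · rintro _ rfl i j a ha b hb
    have hm := hS.op_mem mul hK.mul_mem
    have := hK.kantorMul_mem (R := S (i + j + 2)) (R' := S (i + j + 1)) (hE i) (hE j)
      (fun a ha b hb => hS.antitone (by omega) (hm _ _ a ha b hb))
      (fun a ha b hb => hS.antitone (by omega) (hS.op_mem br hK.br_mem _ _ a ha b hb))
      (fun a ha b hb => hS.antitone (by omega) (hm _ _ a ha b hb))
      (fun a ha b hb => hS.antitone (by omega) (hm _ _ a ha b hb))
      (by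
        by_cases h : i ≤ 1
        · exact Or.inr (hS.antitone (by omega))
        · exact Or.inl (if_neg h))
      (by
        by_cases h : j ≤ 1
        · exact Or.inr (hS.antitone (by omega))
        · exact Or.inl (if_neg h))
      (hs _) (hs _) a ha b hb
    exact ⟨this.1, Submodule.mem_sup_left this.2⟩
  · obtain ⟨N, hN⟩ := hS.eventually_bot
    -- From level two on the line of the barred unit is gone; adding two ensures this even for `N =
    -- 0`.
    refine ⟨N + 2, ?_⟩
    have : ∀ n, N ≤ n → S n = ⊥ := fun n hn => by
      rw [eq_bot_iff, ← hN]; exact hS.antitone hn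
    rw [this (N + 2 + 2) (by omega), this (N + 2 + 1) (by omega), if_neg (by omega), bot_sup_eq,
      Submodule.prod_bot]

/-- Unbarred components and the `A`-parts of the barred ones are put into a filtration of the base.
Level one of the double is `S 3 × (S 2 ⊔ ⟨e⟩)`, which is why the third step is demanded of the base.
-/
theorem IsKantorBase.isLocallyNilpotent {A E : Submodule K V} (hE : E ≤ Submodule.span K {e})
    (hA : D.NilFiltered A) : (D.kantor mul br sgn).IsLocallyNilpotent (A.prod (A ⊔ E)) := by
  classical
  intro T hT
  have : ∀ t : V × V, ∃ a, t ∈ T → a ∈ A ∧ ∃ z ∈ E, a + z = t.2 := by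
    intro t
    by_cases ht : t ∈ T
    · obtain ⟨a, ha, z, hz, h⟩ := Submodule.mem_sup.1 (hT ht).2
      exact ⟨a, fun _ => ⟨ha, z, hz, h⟩⟩
    · exact ⟨0, fun h => absurd h ht⟩
  choose f hf using this
  obtain ⟨S, hS, hg, hT'⟩ := hA (T.image Prod.fst ∪ T.image f) (by
    intro x hx
    simp only [Finset.coe_union, Finset.coe_image, Set.mem_union, Set.mem_image,
      Finset.mem_coe] at hx
    rcases hx with ⟨t, ht, rfl⟩ | ⟨t, ht, rfl⟩
    · exact (hT ht).1
    · exact (hf t ht).1)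
  refine (hK.isNilFiltration hS hg).isNilpotent ?_
  intro t ht
  refine ⟨hT' ?_, ?_⟩
  · simp only [Finset.coe_union, Finset.coe_image]
    exact Or.inl ⟨t, ht, rfl⟩
  · obtain ⟨-, z, hz, h⟩ := hf t ht
    rw [← h, if_pos le_rfl]
    refine Submodule.add_mem_sup (hS.antitone (by norm_num) (hT' ?_)) (hE hz)
    simp only [Finset.coe_union, Finset.coe_image]
    exact Or.inr ⟨t, ht, rfl⟩

/-- The barred unit is given to the first half only; the last hypothesis keeps the sum direct in the
barred coordinate. -/
theorem IsKantorBase.isNilDecomposition {A B : Submodule K V} (hA : D.IsSubalgebra A)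
    (hB : D.IsSubalgebra B) (hAg : D.IsGraded A) (hBg : D.IsGraded B) (hAn : D.NilFiltered A)
    (hBn : D.NilFiltered B) (hAB : (A ⊔ Submodule.span K {e}) ⊓ B = ⊥) :
    (D.kantor mul br sgn).IsNilDecomposition
      ((A ⊔ B).prod (A ⊔ B ⊔ Submodule.span K {e}))
      (A.prod (A ⊔ Submodule.span K {e})) (B.prod B) := by
  have he : D.IsGraded (Submodule.span K {e}) := IsGraded.of_le_even (by
    rw [Submodule.span_le, Set.singleton_subset_iff]; exact hK.unit_even)
  have hBB : B.prod B = B.prod (B ⊔ ⊥) := by rw [sup_bot_eq]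
  refine ⟨hK.isSubalgebra le_rfl hA hAg, ?_, hAg.kantor (hAg.sup he) _ _ _, hBg.kantor hBg _ _ _,
    hK.isLocallyNilpotent le_rfl hAn, ?_, ?_, ?_⟩
  · rw [hBB]; exact hK.isSubalgebra bot_le hB hBg
  · rw [hBB]; exact hK.isLocallyNilpotent bot_le hBn
  · rw [Submodule.prod_inf_prod, hAB]
    have : A ⊓ B = ⊥ := by
      rw [eq_bot_iff, ← hAB]; exact inf_le_inf_right _ le_sup_left
    rw [this, Submodule.prod_bot]
  · rw [Submodule.prod_sup_prod, sup_right_comm]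

end Kantor

end SuperData

/-! ### The number `mu`, the planes, and sublinear growth -/

/-- The multidegree of the pivot element with number `n`. -/
def pivotDegree : ℕ → Fin 3 → ℕ
  | 0 => Pi.single 0 1
  | 1 => Pi.single 1 1
  | 2 => Pi.single 2 1
  | n + 3 => pivotDegree (n + 1) + 2 • pivotDegree n

/-- A multidegree as a lattice point. -/
def latticePoint : (Fin 3 → ℕ) →+ (Fin 3 → ℤ) where
  toFun d i := d i
  map_zero' := by ext; simp
  map_add' d e := by ext; simp

/-- The weight of the pivot element with number `n`. -/
def pivotWeight (n : ℕ) : Fin 3 → ℤ := latticePoint (pivotDegree n)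

theorem pivotWeight_add_three (n : ℕ) :
    pivotWeight (n + 3) = pivotWeight (n + 1) + 2 • pivotWeight n := by
  simp only [pivotWeight, pivotDegree, map_add, map_nsmul]

/-- Cardano: with `x, y` the two real cube roots, `a = x + y` and `b = x - y`. From `xy = 1/3` and
`x³ + y³ = 2` the sum `a` is the real root of `t³ - t - 2`, and `b² = a² - 4xy`. -/
theorem exists_mu_coords : ∃ a b : ℝ, mu.re = -a / 2 ∧ mu.im = Real.sqrt 3 / 2 * b ∧ 0 < b ∧
    a ^ 3 = a + 2 ∧ b ^ 2 = a ^ 2 - 4 / 3 := by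
  set s : ℝ := Real.sqrt (26 / 27) with hs
  have hs0 : 0 < s := Real.sqrt_pos.2 (by norm_num)
  have hs2 : s ^ 2 = 26 / 27 := Real.sq_sqrt (by norm_num)
  have hs1 : s < 1 := by nlinarith
  set x : ℝ := (1 + s) ^ (1 / 3 : ℝ) with hx
  set y : ℝ := (1 - s) ^ (1 / 3 : ℝ) with hy
  have cube : ∀ t : ℝ, 0 ≤ t → (t ^ (1 / 3 : ℝ)) ^ 3 = t := by
    intro t ht
    rw [← Real.rpow_natCast, ← Real.rpow_mul ht]
    norm_num
  have hx3 : x ^ 3 = 1 + s := cube _ (by linarith)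
  have hy3 : y ^ 3 = 1 - s := cube _ (by linarith)
  have hx0 : 0 < x := Real.rpow_pos_of_pos (by linarith) _
  have hy0 : 0 < y := Real.rpow_pos_of_pos (by linarith) _
  -- The cube of `xy` is `(1 + s)(1 - s) = 1 - 26/27 = 1/27`.
  have hxy : x * y = 1 / 3 := by
    have h : (x * y) ^ 3 = (1 / 3) ^ 3 := by
      rw [mul_pow, hx3, hy3]; nlinarith
    exact (pow_left_inj₀ (by positivity) (by norm_num) (by norm_num)).1 h
  have hlt : y < x := Real.rpow_lt_rpow (by linarith) (by linarith) (by norm_num)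
  have hmu : mu = (-1 + (Real.sqrt 3 : ℝ) * Complex.I) / 2 * (x : ℂ) +
      ((-1 + (Real.sqrt 3 : ℝ) * Complex.I) / 2) ^ 2 * (y : ℂ) := rfl
  have h3 : Real.sqrt 3 ^ 2 = 3 := Real.sq_sqrt (by norm_num)
  have hmu' : mu = ((-(x + y) / 2 : ℝ) : ℂ) + ((Real.sqrt 3 / 2 * (x - y) : ℝ) : ℂ) * Complex.I := by
    have h3' : ((Real.sqrt 3 : ℝ) : ℂ) ^ 2 = 3 := by exact_mod_cast h3
    rw [hmu]
    push_cast
    linear_combination ((y : ℂ) / 4 * Complex.I ^ 2) * h3' + (3 * (y : ℂ) / 4) * Complex.I_sq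
  refine ⟨x + y, x - y, ?_, ?_, by linarith, ?_, ?_⟩
  · rw [hmu']; simp
  · rw [hmu']; simp
  · linear_combination hx3 + hy3 + 3 * (x + y) * hxy
  · linear_combination -4 * hxy

theorem mu_cube : mu ^ 3 = mu + 2 := by
  obtain ⟨a, b, hre, him, -, ha, hb⟩ := exists_mu_coords
  have h3 : Real.sqrt 3 ^ 2 = 3 := Real.sq_sqrt (by norm_num)
  have e : mu = ((-a / 2 : ℝ) : ℂ) + ((Real.sqrt 3 / 2 * b : ℝ) : ℂ) * Complex.I := by
    apply Complex.ext <;> simp [hre, him]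
  apply Complex.ext
  · have : (mu ^ 3).re = mu.re ^ 3 - 3 * mu.re * mu.im ^ 2 := by
      simp [pow_succ]; ring
    rw [this, Complex.add_re, hre, him]
    simp only [Complex.re_ofNat]
    linear_combination ha + 3 * a * b ^ 2 / 8 * h3 + 9 * a / 8 * hb
  · have : (mu ^ 3).im = 3 * mu.re ^ 2 * mu.im - mu.im ^ 3 := by
      simp [pow_succ]; ring
    rw [this, Complex.add_im, hre, him]
    simp only [Complex.im_ofNat]
    linear_combination (-Real.sqrt 3 * b ^ 3 / 8) * h3 - 3 * Real.sqrt 3 * b / 8 * hb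

/-- A rational root of a monic integral polynomial is an integer, and the equation confines it
strictly between `1` and `2`. -/
theorem irrational_of_cube {a : ℝ} (ha : a ^ 3 = a + 2) : Irrational a := by
  rintro ⟨r, rfl⟩
  have hr : r ^ 3 = r + 2 := by exact_mod_cast ha
  have hint : IsIntegral ℤ r := by
    refine ⟨Polynomial.X ^ 3 - (Polynomial.X + 2), by monicity!, ?_⟩
    simp [hr]
  obtain ⟨z, rfl⟩ := IsIntegrallyClosed.isIntegral_iff.1 hint
  have hz : z ^ 3 = z + 2 := by
    have : ((z ^ 3 : ℤ) : ℚ) = ((z + 2 : ℤ) : ℚ) := by push_cast; simpa using hr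
    exact_mod_cast this
  have h1 : 1 < z := by nlinarith [sq_nonneg (z + 1), sq_nonneg (z - 1), sq_nonneg z]
  have h2 : z < 2 := by nlinarith [sq_nonneg (z + 1), sq_nonneg (z - 1), sq_nonneg z]
  omega

/-- In terms of the real root `a` one has `|mu|² = a² - 1`, and `a ≤ 39/25` already gives the bound.
All that matters later is that `6/5` lies below the growth rate `3/2` of the total degree. -/
theorem norm_mu_le : ‖mu‖ ≤ 6 / 5 := by
  obtain ⟨a, b, hre, him, -, ha, hb⟩ := exists_mu_coords
  have h3 : Real.sqrt 3 ^ 2 = 3 := Real.sq_sqrt (by norm_num)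
  have h : ‖mu‖ ^ 2 = a ^ 2 - 1 := by
    rw [Complex.sq_norm, Complex.normSq_apply, hre, him]
    linear_combination b ^ 2 / 4 * h3 + 3 / 4 * hb
  have ha2 : a ≤ 39 / 25 := by
    by_contra! h
    nlinarith [mul_pos (sub_pos.2 h) (sub_pos.2 h)]
  have ha3 : -39 / 25 ≤ a := by
    by_contra! h
    nlinarith [mul_pos (sub_pos.2 h) (sub_pos.2 h)]
  have : ‖mu‖ ^ 2 ≤ (6 / 5) ^ 2 := by rw [h]; nlinarith
  exact (pow_le_pow_iff_left₀ (norm_nonneg _) (by norm_num) (by norm_num)).1 this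

/-- Since `mu² ` has imaginary part `-a · im mu`, the imaginary part is `im mu · (d₁ - a d₂)`;
irrationality of `a` separates the two coordinates. -/
theorem twisted_im_eq_zero {d : Fin 3 → ℤ} (h : (twisted d).im = 0) : d 1 = 0 ∧ d 2 = 0 := by
  obtain ⟨a, b, hre, him, hb0, ha, hb⟩ := exists_mu_coords
  have him0 : mu.im ≠ 0 := by
    rw [him]; positivity
  have h1 : (twisted d).im = mu.im * (d 1 - d 2 * a) := by
    have : (twisted d).im = d 1 * mu.im + d 2 * (2 * mu.re * mu.im) := by
      simp only [twisted, pow_two, Complex.add_im, Complex.mul_im, Complex.intCast_im,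
        Complex.intCast_re]
      ring
    rw [this, hre]; ring
  have h2 : (d 1 : ℝ) - d 2 * a = 0 := by
    rw [h1] at h
    exact (mul_eq_zero.1 h).resolve_left him0
  have h3 : d 2 = 0 := by
    by_contra h0
    have : a = ((d 1 / d 2 : ℚ) : ℝ) := by
      push_cast
      rw [eq_div_iff (by exact_mod_cast h0)]
      linarith
    exact (irrational_of_cube ha) ⟨_, this.symm⟩
  refine ⟨?_, h3⟩
  rw [h3] at h2
  simpa using h2

theorem twisted_add (d e : Fin 3 → ℤ) : twisted (d + e) = twisted d + twisted e := by
  simp [twisted]; ring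

theorem twisted_sum {ι : Type*} (s : Finset ι) (f : ι → Fin 3 → ℤ) :
    twisted (∑ i ∈ s, f i) = ∑ i ∈ s, twisted (f i) :=
  map_sum (AddMonoidHom.mk' twisted twisted_add) f s

theorem twisted_nsmul (n : ℕ) (d : Fin 3 → ℤ) : twisted (n • d) = n * twisted d := by
  rw [← nsmul_eq_mul]
  exact map_nsmul (AddMonoidHom.mk' twisted twisted_add) n d

/-- The recursion of the weights is the equation `mu³ = mu + 2` multiplied by `mu ^ n`. -/
theorem twisted_pivotWeight (n : ℕ) : twisted (pivotWeight n) = mu ^ n := by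
  induction n using Nat.strong_induction_on with
  | _ n ih =>
    match n with
    | 0 => simp [twisted, pivotWeight, pivotDegree, latticePoint]
    | 1 => simp [twisted, pivotWeight, pivotDegree, latticePoint]
    | 2 => simp [twisted, pivotWeight, pivotDegree, latticePoint]
    | n + 3 =>
      rw [pivotWeight_add_three, twisted_add, twisted_nsmul, ih _ (by omega), ih _ (by omega)]
      push_cast
      linear_combination -mu ^ n * mu_cube

theorem planeForm_add (p : ℝ × ℝ) (d e : Fin 3 → ℤ) :
    planeForm p (d + e) = planeForm p d + planeForm p e := by
  simp [planeForm, twisted_add]; ring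

theorem planeForm_neg (p : ℝ × ℝ) (d : Fin 3 → ℤ) : planeForm (-p) d = -planeForm p d := by
  simp [planeForm]; ring

theorem abs_planeForm_le (p : ℝ × ℝ) (d : Fin 3 → ℤ) :
    |planeForm p d| ≤ (|p.1| + |p.2|) * ‖twisted d‖ := by
  have h1 := Complex.abs_re_le_norm (twisted d)
  have h2 := Complex.abs_im_le_norm (twisted d)
  calc |planeForm p d| ≤ |p.1 * (twisted d).re| + |p.2 * (twisted d).im| := abs_add_le _ _
    _ = |p.1| * |(twisted d).re| + |p.2| * |(twisted d).im| := by rw [abs_mul, abs_mul]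
    _ ≤ |p.1| * ‖twisted d‖ + |p.2| * ‖twisted d‖ := by gcongr
    _ = _ := by ring

/-- The form `planeForm p` on multidegrees. -/
noncomputable def planeHom (p : ℝ × ℝ) : (Fin 3 → ℕ) →+ ℝ :=
  (AddMonoidHom.mk' (planeForm p) (planeForm_add p)).comp latticePoint

/-- The total degree of a lattice point. -/
noncomputable def totalDegree : (Fin 3 → ℤ) →+ ℝ where
  toFun d := ∑ i, (d i : ℝ)
  map_zero' := by simp
  map_add' d e := by simp [Finset.sum_add_distrib]

/-- The rate `3/2` is admissible because `3/2 + 2 ≥ (3/2)³`; the factor `4/9 = (3/2)⁻²` makes the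
estimate hold for the three generators. -/
theorem totalDegree_pivotWeight (n : ℕ) :
    4 / 9 * (3 / 2) ^ n ≤ totalDegree (pivotWeight n) := by
  induction n using Nat.strong_induction_on with
  | _ n ih =>
    match n with
    | 0 =>
      have : ∑ j : Fin 3, (((Pi.single 0 1 : Fin 3 → ℕ) j : ℤ) : ℝ) = 1 := by
        rw [Finset.sum_eq_single 0] <;> simp +contextual
      refine le_of_le_of_eq ?_ this.symm
      norm_num
    | 1 =>
      have : ∑ j : Fin 3, (((Pi.single 1 1 : Fin 3 → ℕ) j : ℤ) : ℝ) = 1 := by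
        rw [Finset.sum_eq_single 1] <;> simp +contextual
      refine le_of_le_of_eq ?_ this.symm
      norm_num
    | 2 =>
      have : ∑ j : Fin 3, (((Pi.single 2 1 : Fin 3 → ℕ) j : ℤ) : ℝ) = 1 := by
        rw [Finset.sum_eq_single 2] <;> simp +contextual
      refine le_of_le_of_eq ?_ this.symm
      norm_num
    | n + 3 =>
      rw [pivotWeight_add_three, map_add, map_nsmul]
      have h1 := ih n (by omega)
      have h2 := ih (n + 1) (by omega)
      have h3 : (0 : ℝ) < (3 / 2) ^ n := by positivity
      rw [pow_add] at h2 ⊢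
      rw [nsmul_eq_mul]
      push_cast
      linarith

/-- A set of degrees which, for each `n`, are sums of weights of the pivot elements with numbers
`n`, `n + 1`, `n + 2`, up to finitely many corrections. -/
def SelfSimilar (Γ : Set (Fin 3 → ℕ)) : Prop :=
  ∀ n : ℕ, ∃ F : Set (Fin 3 → ℤ), F.Finite ∧ ∀ d ∈ Γ, ∃ f ∈ F, ∃ e : Fin 3 → ℕ,
    latticePoint d = f + ∑ i : Fin 3, e i • pivotWeight (n + i)

/-- If `N` pivot weights with numbers `n`, `n+1`, `n+2` are added, the twisted coordinate is at most
`N (6/5)^(n+2)` and the total degree at least `N · 4/9 · (3/2)^n`. The quotient of these bounds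
tends to zero with growing `n`, and the finitely many corrections only affect the constant. -/
theorem SelfSimilar.twisted_le {Γ : Set (Fin 3 → ℕ)} (h : SelfSimilar Γ) :
    ∀ δ > 0, ∃ C : ℝ, ∀ d ∈ Γ,
      ‖twisted (latticePoint d)‖ ≤ C + δ * totalDegree (latticePoint d) := by
  intro δ hδ
  -- The quotient of the two bounds is `(36/25)(9/4)(4/5)^n = (81/25)(4/5)^n`.
  obtain ⟨n, hn⟩ : ∃ n : ℕ, (4 / 5 : ℝ) ^ n < δ / (81 / 25) :=
    exists_pow_lt_of_lt_one (by positivity) (by norm_num)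
  obtain ⟨F, hF, hd⟩ := h n
  obtain ⟨C₁, hC₁⟩ := (hF.image fun f => ‖twisted f‖).bddAbove
  obtain ⟨C₂, hC₂⟩ := (hF.image fun f => -totalDegree f).bddAbove
  refine ⟨C₁ + δ * C₂, fun d hdΓ => ?_⟩
  obtain ⟨f, hf, e, he⟩ := hd d hdΓ
  have h1 : ‖twisted f‖ ≤ C₁ := hC₁ ⟨f, hf, rfl⟩
  have h2 : -totalDegree f ≤ C₂ := hC₂ ⟨f, hf, rfl⟩
  set N : ℝ := ∑ i, (e i : ℝ) with hN
  have hN0 : 0 ≤ N := Finset.sum_nonneg fun i _ => Nat.cast_nonneg _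
  have h3 : N * (4 / 9 * (3 / 2) ^ n) ≤ ∑ i : Fin 3, totalDegree (e i • pivotWeight (n + i)) := by
    rw [hN, Finset.sum_mul]
    refine Finset.sum_le_sum fun i _ => ?_
    rw [map_nsmul, nsmul_eq_mul]
    refine mul_le_mul_of_nonneg_left ?_ (Nat.cast_nonneg _)
    refine le_trans ?_ (totalDegree_pivotWeight _)
    gcongr
    · norm_num
    · omega
  have h4 : ‖∑ i : Fin 3, twisted (e i • pivotWeight (n + i))‖ ≤ N * (6 / 5) ^ (n + 2) := by
    rw [hN, Finset.sum_mul]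
    refine (norm_sum_le _ _).trans (Finset.sum_le_sum fun i _ => ?_)
    rw [twisted_nsmul, norm_mul, Complex.norm_natCast, twisted_pivotWeight, norm_pow]
    refine mul_le_mul_of_nonneg_left ?_ (Nat.cast_nonneg _)
    calc ‖mu‖ ^ (n + (i : ℕ)) ≤ (6 / 5) ^ (n + (i : ℕ)) := by
          gcongr; exact norm_mu_le
      _ ≤ (6 / 5) ^ (n + 2) := by
          gcongr
          · norm_num
          · omega
  have h5 : N * (6 / 5) ^ (n + 2) ≤ δ * (N * (4 / 9 * (3 / 2) ^ n)) := by
    have e1 : (6 / 5 : ℝ) ^ (n + 2) = (81 / 25 * (4 / 5) ^ n) * (4 / 9 * (3 / 2) ^ n) := by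
      have : (6 / 5 : ℝ) ^ n = (4 / 5) ^ n * (3 / 2) ^ n := by rw [← mul_pow]; norm_num
      rw [pow_add, this]; ring
    have e2 : 81 / 25 * (4 / 5 : ℝ) ^ n ≤ δ := by
      rw [lt_div_iff₀ (by norm_num)] at hn; linarith
    rw [e1]
    calc N * ((81 / 25 * (4 / 5) ^ n) * (4 / 9 * (3 / 2) ^ n))
        ≤ N * (δ * (4 / 9 * (3 / 2) ^ n)) := by gcongr
      _ = _ := by ring
  rw [he, twisted_add, twisted_sum, map_add, map_sum]
  refine (norm_add_le _ _).trans ?_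
  have h6 : δ * (N * (4 / 9 * (3 / 2) ^ n)) ≤
      δ * ∑ i : Fin 3, totalDegree (e i • pivotWeight (n + i)) := by gcongr
  have h7 : δ * (-totalDegree f) ≤ δ * C₂ := by gcongr
  linarith

theorem pivotDegree_pos {n : ℕ} (hn : 1 ≤ n) : 0 < pivotDegree n 1 + pivotDegree n 2 := by
  induction n using Nat.strong_induction_on with
  | _ n ih =>
    match n with
    | 1 => simp [pivotDegree]
    | 2 => simp [pivotDegree]
    | n + 3 =>
      have := ih (n + 1) (by omega) (by omega)
      simp only [pivotDegree, Pi.add_apply]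
      omega

/-- A real power would force the degrees of `v_n` in `v₁` and `v₂` to vanish, but these never vanish
together for `n ≥ 1`. -/
theorem mu_pow_im_ne_zero {n : ℕ} (hn : 1 ≤ n) : (mu ^ n).im ≠ 0 := by
  rw [← twisted_pivotWeight]
  intro h
  obtain ⟨h1, h2⟩ := twisted_im_eq_zero h
  have := pivotDegree_pos hn
  simp only [pivotWeight, latticePoint, AddMonoidHom.coe_mk, ZeroHom.coe_mk] at h1 h2
  omega

/-- The argument of `mu` has infinite order in the circle, since an `n`-th multiple equal to zero
would make `mu ^ n` real. The multiples of an element of infinite order are dense. -/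
theorem dense_arg_mu : DenseRange fun n : ℕ => n • (mu.arg : Real.Angle) := by
  have : Fact (0 < 2 * Real.pi) := ⟨Real.two_pi_pos⟩
  have : CompactSpace Real.Angle := inferInstanceAs (CompactSpace (AddCircle (2 * Real.pi)))
  have key : addOrderOf (mu.arg : Real.Angle) = 0 := by
    rw [addOrderOf_eq_zero_iff']
    intro n hn h
    apply mu_pow_im_ne_zero hn
    have h1 : ((mu ^ n).arg : Real.Angle) = 0 := by
      rw [Complex.arg_pow_coe_angle]; exact h
    rw [← Complex.norm_mul_sin_arg, ← Real.Angle.sin_coe, h1, Real.Angle.sin_zero, mul_zero]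
  exact denseRange_zsmul_iff_nsmul.1 ((AddCircle.denseRange_zsmul_iff (p := 2 * Real.pi)).2 key)

theorem planeForm_pivotWeight (p : ℝ × ℝ) (n : ℕ) : planeForm p (pivotWeight n) =
    ‖mu ^ n‖ * (p.1 * (n • (mu.arg : Real.Angle)).cos + p.2 * (n • (mu.arg : Real.Angle)).sin) := by
  rw [planeForm, twisted_pivotWeight, ← Complex.norm_mul_cos_arg, ← Complex.norm_mul_sin_arg,
    ← Complex.arg_pow_coe_angle, Real.Angle.cos_coe, Real.Angle.sin_coe]
  ring

/-- Nonproportional forms are linearly independent, so they take opposite signs in some direction,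
hence on a nonempty open set of angles; density of the arguments of `mu ^ n` finishes. -/
theorem exists_pivotWeight_between {p q : ℝ × ℝ} (hp : p ≠ 0) (hq : q ≠ 0)
    (h : ¬ SamePlane p q) :
    ∃ n, 0 < planeForm p (pivotWeight n) ∧ planeForm q (pivotWeight n) < 0 := by
  have hdet : p.1 * q.2 - p.2 * q.1 ≠ 0 := by
    intro h0
    apply h
    by_cases hp1 : p.1 = 0
    · have hp2 : p.2 ≠ 0 := fun h2 => hp (Prod.ext hp1 h2)
      have hq1 : q.1 = 0 := by
        rw [hp1] at h0
        simpa [hp2] using h0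
      have hq2 : q.2 ≠ 0 := fun h2 => hq (Prod.ext hq1 h2)
      refine ⟨q.2 / p.2, div_ne_zero hq2 hp2, Prod.ext ?_ ?_⟩
      · simp [hp1, hq1]
      · simp [hp2]
    · have hq1 : q.1 ≠ 0 := by
        intro h1
        rw [h1] at h0
        have : q.2 = 0 := by simpa [hp1] using h0
        exact hq (Prod.ext h1 this)
      refine ⟨q.1 / p.1, div_ne_zero hq1 hp1, Prod.ext ?_ ?_⟩
      · simp [hp1]
      · simp only [Prod.smul_snd, smul_eq_mul]
        field_simp
        linarith
  set D := p.1 * q.2 - p.2 * q.1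
  -- Cramer's rule for the system in which the form `p` has value `1` and the form `q` has value
  -- `-1`.
  let z : ℂ := ⟨(q.2 + p.2) / D, -(p.1 + q.1) / D⟩
  have hz1 : p.1 * z.re + p.2 * z.im = 1 := by
    simp only [z]; field_simp; simp only [D]; ring
  have hz2 : q.1 * z.re + q.2 * z.im = -1 := by
    simp only [z]; field_simp; simp only [D]; ring
  have hz0 : z ≠ 0 := by
    intro h0
    rw [h0] at hz1
    simp at hz1
  have hzn : 0 < ‖z‖ := norm_pos_iff.2 hz0
  let U : Set Real.Angle :=
    {θ | 0 < p.1 * θ.cos + p.2 * θ.sin ∧ q.1 * θ.cos + q.2 * θ.sin < 0}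
  have hU : IsOpen U := by
    refine IsOpen.inter ?_ ?_
    · exact isOpen_lt continuous_const ((continuous_const.mul Real.Angle.continuous_cos).add
        (continuous_const.mul Real.Angle.continuous_sin))
    · exact isOpen_lt ((continuous_const.mul Real.Angle.continuous_cos).add
        (continuous_const.mul Real.Angle.continuous_sin)) continuous_const
  have hne : (z.arg : Real.Angle) ∈ U := by
    rw [← Complex.norm_mul_cos_arg, ← Complex.norm_mul_sin_arg] at hz1 hz2
    refine ⟨?_, ?_⟩
    · rw [Real.Angle.cos_coe, Real.Angle.sin_coe]
      by_contra! hneg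
      nlinarith
    · rw [Real.Angle.cos_coe, Real.Angle.sin_coe]
      by_contra! hneg
      nlinarith
  obtain ⟨n, hn⟩ := dense_arg_mu.exists_mem_open hU ⟨_, hne⟩
  have hmu : 0 < ‖mu ^ n‖ := by
    have h1 := mu_pow_im_ne_zero (n := 1) le_rfl
    refine norm_pos_iff.2 (pow_ne_zero _ fun h0 => h1 ?_)
    rw [h0]; simp
  refine ⟨n, ?_, ?_⟩
  · rw [planeForm_pivotWeight]
    exact mul_pos hmu hn.1
  · rw [planeForm_pivotWeight]
    exact mul_neg_of_pos_of_neg hmu hn.2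

theorem ne_zero_of_mem_genericPlanes {p : ℝ × ℝ} (hp : p ∈ genericPlanes) : p ≠ 0 := by
  rintro rfl
  refine hp (Pi.single 0 1) (by simp) ?_
  simp [planeForm]

theorem not_samePlane_neg {p q : ℝ × ℝ} (h : ¬ SamePlane p q) : ¬ SamePlane p (-q) := by
  rintro ⟨c, hc, h'⟩
  refine h ⟨-c, neg_ne_zero.2 hc, ?_⟩
  rw [neg_smul, ← h', neg_neg]

theorem neg_mem_genericPlanes {p : ℝ × ℝ} (hp : p ∈ genericPlanes) : -p ∈ genericPlanes := by
  intro d hd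
  rw [planeForm_neg]
  exact neg_ne_zero.2 (hp d hd)

/-- A nonzero lattice point excludes at most one slope: if its twisted coordinate is not real, the
equation in `t` has one root; if it is real, the point lies on the first coordinate axis and no `t`
is a root. So only countably many slopes are lost. -/
theorem mk_generic_slopes : #{t : ℝ | ((1 : ℝ), t) ∈ genericPlanes} = 𝔠 := by
  have hc : ({t : ℝ | ((1 : ℝ), t) ∈ genericPlanes}ᶜ).Countable := by
    have : {t : ℝ | ((1 : ℝ), t) ∈ genericPlanes}ᶜ ⊆
        ⋃ d : Fin 3 → ℤ, {t : ℝ | d ≠ 0 ∧ planeForm (1, t) d = 0} := by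
      intro t ht
      simp only [genericPlanes, Set.mem_compl_iff, Set.mem_ofPred_eq, not_forall,
        not_not] at ht
      obtain ⟨d, hd, h⟩ := ht
      exact Set.mem_iUnion.2 ⟨d, hd, h⟩
    refine Set.Countable.mono this (Set.countable_iUnion fun d => Set.Subsingleton.countable ?_)
    rintro t ⟨hd, ht⟩ t' ⟨-, ht'⟩
    simp only [planeForm, one_mul] at ht ht'
    by_cases him : (twisted d).im = 0
    · obtain ⟨h1, h2⟩ := twisted_im_eq_zero him
      exfalso
      apply hd
      rw [him, mul_zero, add_zero] at ht
      simp only [twisted, h1, h2] at ht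
      funext i
      fin_cases i
      · simpa using ht
      · exact h1
      · exact h2
    · have : (t - t') * (twisted d).im = 0 := by linarith
      exact sub_eq_zero.1 ((mul_eq_zero.1 this).resolve_right him)
  have := Cardinal.mk_compl_of_infinite _ (hc.le_aleph0.trans_lt
    (by rw [Cardinal.mk_real]; exact Cardinal.aleph0_lt_continuum))
  rwa [compl_compl, Cardinal.mk_real] at this

/-! ### From a grading by multidegrees to decompositions by planes -/

namespace SuperData

variable {K V : Type u} [Field K] [AddCommGroup V] [Module K V] {D : SuperData K V}

/-- The cardinality statements are formal: `ℝ × ℝ` bounds the number of decompositions from above,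
and the generic planes `(1, t)`, pairwise nonproportional, bound it from below. -/
theorem splitsByPlanes_of {X : Submodule K V} {F : ℝ × ℝ → Submodule K V × Submodule K V}
    (hdec : ∀ p ∈ genericPlanes, D.IsNilDecomposition X (F p).1 (F p).2)
    (hinj : ∀ p ∈ genericPlanes, ∀ q ∈ genericPlanes, ¬ SamePlane p q →
      s((F p).1, (F p).2) ≠ s((F q).1, (F q).2)) : D.SplitsByPlanes X F := by
  have hcard : #((fun p => s((F p).1, (F p).2)) '' genericPlanes) = 𝔠 := by
    apply le_antisymm
    · have h1 := Cardinal.mk_image_le_lift (f := fun p => s((F p).1, (F p).2))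
        (s := genericPlanes)
      have h2 : #genericPlanes ≤ 𝔠 := by
        refine (Cardinal.mk_set_le _).trans ?_
        rw [Cardinal.mk_prod, Cardinal.lift_id, Cardinal.mk_real, Cardinal.continuum_mul_self]
      have h3 := h1.trans (Cardinal.lift_le.2 h2)
      rw [Cardinal.lift_continuum] at h3
      simpa using h3
    · let φ : {t : ℝ | ((1 : ℝ), t) ∈ genericPlanes} →
          ((fun p => s((F p).1, (F p).2)) '' genericPlanes) :=
        fun t => ⟨_, ⟨(1, t.1), t.2, rfl⟩⟩
      have hφ : Function.Injective φ := by
        intro t t' h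
        by_contra hne
        refine hinj _ t.2 _ t'.2 ?_ (congrArg Subtype.val h)
        rintro ⟨c, -, hc⟩
        have h1 : (1 : ℝ) = c := by simpa using congrArg Prod.fst hc
        have h2 : t'.1 = c * t.1 := by simpa using congrArg Prod.snd hc
        exact hne (Subtype.ext (by rw [h2, ← h1, one_mul]))
      have h1 := Cardinal.lift_mk_le_lift_mk_of_injective hφ
      rw [mk_generic_slopes, Cardinal.lift_continuum] at h1
      simpa using h1
  obtain ⟨t, ht⟩ : ∃ t : ℝ, ((1 : ℝ), t) ∈ genericPlanes := by
    have h : #{t : ℝ | ((1 : ℝ), t) ∈ genericPlanes} ≠ 0 := by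
      rw [mk_generic_slopes]; exact Cardinal.continuum_ne_zero
    obtain ⟨t⟩ := Cardinal.mk_ne_zero_iff.1 h
    exact ⟨t.1, t.2⟩
  refine ⟨⟨_, _, hdec _ ht⟩, ?_, hdec, hinj, hcard⟩
  rw [← hcard]
  refine Cardinal.mk_le_mk_of_subset ?_
  rintro _ ⟨p, hp, rfl⟩
  exact ⟨_, _, rfl, hdec p hp⟩

variable (D) in
/-- The conditions on a superalgebra with three odd generators under which the planes cut it into
locally nilpotent parts. -/
structure IsPlaneGraded (g : Fin 3 → V) : Prop where
  regular : D.IsRegular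
  gen_odd : ∀ i, g i ∈ D.odd
  disjoint : ∀ Γ Δ : Set (Fin 3 → ℕ), Disjoint Γ Δ → D.part g Γ ⊓ D.part g Δ = ⊥
  selfSimilar : SelfSimilar {d | ∃ x, D.IsMonomial g d x ∧ x ≠ 0}
  pivot : ∀ n, ∃ x ∈ D.component g (pivotDegree n), x ≠ 0

namespace IsPlaneGraded

variable {g : Fin 3 → V} (h : D.IsPlaneGraded g)
include h

theorem half_nilFiltered (p : ℝ × ℝ) : D.NilFiltered (D.half g p) := by
  rw [half_eq_part]
  refine nilFiltered_part h.regular h.gen_odd (planeHom p) (totalDegree.comp latticePoint) ?_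
  intro δ hδ
  -- The summand `1` keeps the divisor positive even when `p = 0`.
  have hc : 0 < |p.1| + |p.2| + 1 := by positivity
  obtain ⟨C, hC⟩ := h.selfSimilar.twisted_le (δ / (|p.1| + |p.2| + 1)) (by positivity)
  refine ⟨(|p.1| + |p.2| + 1) * C, fun d x hx hx0 => ?_⟩
  have h1 := hC d ⟨x, hx, hx0⟩
  calc planeForm p (latticePoint d) ≤ (|p.1| + |p.2|) * ‖twisted (latticePoint d)‖ :=
        (le_abs_self _).trans (abs_planeForm_le p _)
    _ ≤ (|p.1| + |p.2| + 1) * ‖twisted (latticePoint d)‖ :=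
        mul_le_mul_of_nonneg_right (by linarith) (norm_nonneg _)
    _ ≤ (|p.1| + |p.2| + 1) *
        (C + δ / (|p.1| + |p.2| + 1) * totalDegree (latticePoint d)) := by gcongr
    _ = (|p.1| + |p.2| + 1) * C + δ * totalDegree (latticePoint d) := by
        field_simp

theorem half_isSubalgebra (p : ℝ × ℝ) : D.IsSubalgebra (D.half g p) := by
  rw [half_eq_part]
  refine isSubalgebra_part h.regular h.gen_odd ?_
  intro d hd e he
  have h1 : 0 < planeForm p (latticePoint d) + planeForm p (latticePoint e) := add_pos hd he
  rw [← planeForm_add, ← map_add] at h1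
  exact h1

theorem half_isGraded (p : ℝ × ℝ) : D.IsGraded (D.half g p) := by
  rw [half_eq_part]
  exact isGraded_part h.regular h.gen_odd _

theorem half_inf_half_neg (p : ℝ × ℝ) : D.half g p ⊓ D.half g (-p) = ⊥ := by
  rw [half_eq_part, half_eq_part]
  refine h.disjoint _ _ (Set.disjoint_left.2 fun d hd hd' => ?_)
  simp only [Set.mem_ofPred_eq, planeForm_neg] at hd hd'
  linarith

/-- Genericity enters here: no nonzero multidegree lies on the plane itself. -/
theorem half_sup_half_neg {p : ℝ × ℝ} (hp : p ∈ genericPlanes) :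
    D.half g p ⊔ D.half g (-p) = D.adjoin (Set.range g) := by
  rw [half_eq_part, half_eq_part, adjoin_range_eq_part h.regular h.gen_odd, ← part_union]
  congr 1
  ext d
  simp only [Set.mem_union, Set.mem_ofPred_eq, planeForm_neg]
  constructor
  · rintro (hd | hd) rfl
    · simp [planeForm, twisted] at hd
    · simp [planeForm, twisted] at hd
  · intro hd
    have hd' : (fun i => (d i : ℤ)) ≠ 0 := by
      intro h0
      exact hd (funext fun i => by simpa using congrFun h0 i)
    rcases lt_or_gt_of_ne (hp _ hd') with h1 | h1
    · right; linarith
    · left; exact h1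

theorem isNilDecomposition {p : ℝ × ℝ} (hp : p ∈ genericPlanes) :
    D.IsNilDecomposition (D.adjoin (Set.range g)) (D.half g p) (D.half g (-p)) where
  left_subalgebra := h.half_isSubalgebra p
  right_subalgebra := h.half_isSubalgebra (-p)
  left_graded := h.half_isGraded p
  right_graded := h.half_isGraded (-p)
  left_nil := (h.half_nilFiltered p).isLocallyNilpotent
  right_nil := (h.half_nilFiltered (-p)).isLocallyNilpotent
  disjoint := h.half_inf_half_neg p
  sum := h.half_sup_half_neg hp

/-- A pivot component between the planes lies in the half of `p` and in the half of `-q`; if the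
halves of `p` and `q` agreed, it would lie on both sides of the plane `q`. -/
theorem half_ne {p q : ℝ × ℝ} (hp : p ∈ genericPlanes) (hq : q ∈ genericPlanes)
    (hpq : ¬ SamePlane p q) : D.half g p ≠ D.half g q := by
  intro heq
  obtain ⟨n, h1, h2⟩ := exists_pivotWeight_between (ne_zero_of_mem_genericPlanes hp)
    (ne_zero_of_mem_genericPlanes hq) hpq
  obtain ⟨x, hx, hx0⟩ := h.pivot n
  have hxp : x ∈ D.half g p := by
    rw [half_eq_part]
    exact component_le_part (Γ := {d | 0 < planeForm p (fun i => (d i : ℤ))}) h1 hx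
  have hxq : x ∈ D.half g (-q) := by
    rw [half_eq_part]
    refine component_le_part (Γ := {d | 0 < planeForm (-q) (fun i => (d i : ℤ))}) ?_ hx
    have : 0 < planeForm (-q) (pivotWeight n) := by rw [planeForm_neg]; linarith
    exact this
  have : x ∈ D.half g q ⊓ D.half g (-q) := ⟨heq ▸ hxp, hxq⟩
  rw [h.half_inf_half_neg q] at this
  exact hx0 this

/-- Pairs are unordered, so equality may interchange the halves; this amounts to replacing `q` by
`-q`, which describes the same plane. -/
theorem plane_injective {p q : ℝ × ℝ} (hp : p ∈ genericPlanes) (hq : q ∈ genericPlanes)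
    (hpq : ¬ SamePlane p q) :
    s(D.half g p, D.half g (-p)) ≠ s(D.half g q, D.half g (-q)) := by
  intro heq
  rcases Sym2.eq_iff.1 heq with ⟨h1, -⟩ | ⟨h1, -⟩
  · exact h.half_ne hp hq hpq h1
  · exact h.half_ne hp (neg_mem_genericPlanes hq) (not_samePlane_neg hpq) h1

theorem splitsByPlanes :
    D.SplitsByPlanes (D.adjoin (Set.range g)) (fun p => (D.half g p, D.half g (-p))) :=
  splitsByPlanes_of (fun _ => h.isNilDecomposition) fun _ hp _ hq => h.plane_injective hp hq

end IsPlaneGraded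

end SuperData

/-! ### Operators on the Grassmann algebra -/

section EndGr

variable {K : Type u} [Field K]

noncomputable instance endGrRing : Ring (EndGr K) :=
  { (inferInstance : Semiring (EndGr K)), (inferInstance : AddCommGroup (EndGr K)) with
    intCast := fun z => z • (1 : EndGr K)
    intCast_ofNat := fun n => by
      rw [natCast_zsmul]
      exact LinearMap.ext fun x => rfl
    intCast_negSucc := fun n => by
      rw [negSucc_zsmul]
      exact LinearMap.ext fun x => rfl }

theorem endGr_ext {a b : EndGr K}
    (h : ∀ S : Finset ℕ, a (Finsupp.single S 1) = b (Finsupp.single S 1)) : a = b := by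
  apply Finsupp.lhom_ext'
  intro S
  apply LinearMap.ext_ring
  exact h S

variable (K) in
/-- The sign `(-1)^t`, where `t` is the number of elements of `S` smaller than `i`. -/
def lowerSign (i : ℕ) (S : Finset ℕ) : K := (-1 : K) ^ (S.filter (· < i)).card

/-- The source of the anticommutation rules: of two distinct indices exactly one is smaller, so
interchanging two letters flips exactly one sign. -/
theorem lowerSign_insert {i j : ℕ} {S : Finset ℕ} (h : j ∉ S) :
    lowerSign K i (insert j S) = if j < i then -lowerSign K i S else lowerSign K i S := by
  unfold lowerSign
  rw [Finset.filter_insert]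
  split_ifs with hj
  · rw [Finset.card_insert_of_notMem (by simp [h]), pow_succ]; ring
  · rfl

theorem lowerSign_erase {i j : ℕ} {S : Finset ℕ} (h : j ∈ S) :
    lowerSign K i (S.erase j) = if j < i then -lowerSign K i S else lowerSign K i S := by
  have := lowerSign_insert (K := K) (i := i) (Finset.notMem_erase j S)
  rw [Finset.insert_erase h] at this
  rw [this]
  split_ifs <;> simp

theorem lowerSign_mul_self (i : ℕ) (S : Finset ℕ) : lowerSign K i S * lowerSign K i S = 1 := by
  unfold lowerSign
  rw [← pow_add, ← two_mul, pow_mul]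
  simp

theorem opX_single (i : ℕ) (S : Finset ℕ) (c : K) : opX K i (Finsupp.single S c) =
    if i ∈ S then 0 else Finsupp.single (insert i S) (c * lowerSign K i S) := by
  rw [opX, Finsupp.linearCombination_single]
  split_ifs
  · simp
  · simp [lowerSign]

theorem opD_single (i : ℕ) (S : Finset ℕ) (c : K) : opD K i (Finsupp.single S c) =
    if i ∈ S then Finsupp.single (S.erase i) (c * lowerSign K i S) else 0 := by
  rw [opD, Finsupp.linearCombination_single]
  split_ifs
  · simp [lowerSign]
  · simp

theorem opX_mul_self (i : ℕ) : opX K i * opX K i = 0 := by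
  refine endGr_ext fun S => ?_
  rw [Module.End.mul_apply, opX_single]
  split_ifs with h
  · simp
  · rw [opX_single, if_pos (Finset.mem_insert_self _ _)]; rfl

theorem opD_mul_self (i : ℕ) : opD K i * opD K i = 0 := by
  refine endGr_ext fun S => ?_
  rw [Module.End.mul_apply, opD_single]
  split_ifs with h
  · rw [opD_single, if_neg (Finset.notMem_erase _ _)]; rfl
  · simp

theorem opX_mul_opX (i j : ℕ) : opX K i * opX K j = -(opX K j * opX K i) := by
  rcases eq_or_ne i j with rfl | hij
  · rw [opX_mul_self, neg_zero]
  refine endGr_ext fun S => ?_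
  rw [LinearMap.neg_apply, Module.End.mul_apply, Module.End.mul_apply, opX_single, opX_single]
  by_cases hi : i ∈ S <;> by_cases hj : j ∈ S <;>
    simp only [hi, hj, if_true, if_false, map_zero, opX_single, Finset.mem_insert, hij, hij.symm,
      or_true, or_false, neg_zero, lowerSign_insert, not_false_iff]
  rw [Finset.insert_comm, ← Finsupp.single_neg]
  congr 1
  rcases lt_or_gt_of_ne hij with h | h
  · rw [if_neg h.not_gt, if_pos h]; ring
  · rw [if_pos h, if_neg h.not_gt]; ring

theorem opD_mul_opD (i j : ℕ) : opD K i * opD K j = -(opD K j * opD K i) := by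
  rcases eq_or_ne i j with rfl | hij
  · rw [opD_mul_self, neg_zero]
  refine endGr_ext fun S => ?_
  rw [LinearMap.neg_apply, Module.End.mul_apply, Module.End.mul_apply, opD_single, opD_single]
  by_cases hi : i ∈ S <;> by_cases hj : j ∈ S <;>
    simp only [hi, hj, if_true, if_false, map_zero, opD_single, Finset.mem_erase, hij, hij.symm,
      ne_eq, not_false_iff, and_true, and_false, neg_zero, lowerSign_erase]
  rw [Finset.erase_right_comm, ← Finsupp.single_neg]
  congr 1
  rcases lt_or_gt_of_ne hij with h | h
  · rw [if_neg h.not_gt, if_pos h]; ring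
  · rw [if_pos h, if_neg h.not_gt]; ring

theorem opD_mul_opX_of_ne {i j : ℕ} (hij : i ≠ j) :
    opD K i * opX K j = -(opX K j * opD K i) := by
  refine endGr_ext fun S => ?_
  rw [LinearMap.neg_apply, Module.End.mul_apply, Module.End.mul_apply, opX_single, opD_single]
  by_cases hi : i ∈ S <;> by_cases hj : j ∈ S <;>
    simp only [hi, hj, if_true, if_false, map_zero, opD_single, opX_single, Finset.mem_erase,
      Finset.mem_insert, hij, hij.symm, or_true, or_false,
      ne_eq, not_false_iff, and_true, and_false, neg_zero, lowerSign_erase, lowerSign_insert]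
  rw [Finset.erase_insert_of_ne hij.symm, ← Finsupp.single_neg]
  congr 1
  rcases lt_or_gt_of_ne hij with h | h
  · rw [if_neg h.not_gt, if_pos h]; ring
  · rw [if_pos h, if_neg h.not_gt]; ring

theorem opD_mul_opX_self (i : ℕ) : opD K i * opX K i = 1 - opX K i * opD K i := by
  refine endGr_ext fun S => ?_
  rw [LinearMap.sub_apply, Module.End.mul_apply, Module.End.mul_apply, opX_single, opD_single]
  by_cases hi : i ∈ S
  · simp [hi, opX_single, lowerSign_erase, lowerSign_mul_self]
  · simp [hi, opD_single, lowerSign_insert, lowerSign_mul_self]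

/-! #### The pivot elements -/

variable (K) in
/-- The span of the monomials in `x_0, …, x_{L-1}`. -/
def grLevel (L : ℕ) : Submodule K (Gr K) :=
  Finsupp.supported K K {S | S ⊆ Finset.range L}

theorem single_mem_grLevel (S : Finset ℕ) {L : ℕ} (h : S.sup id < L) :
    Finsupp.single S (1 : K) ∈ grLevel K L := by
  refine Finsupp.single_mem_supported K _ fun i hi => ?_
  exact Finset.mem_range.2 (lt_of_le_of_lt (Finset.le_sup (f := id) hi) h)

theorem grLevel_induction {L : ℕ} {a : Gr K} (ha : a ∈ grLevel K L) {P : Submodule K (Gr K)}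
    (h : ∀ S ⊆ Finset.range L, Finsupp.single S 1 ∈ P) : a ∈ P := by
  rw [grLevel, Finsupp.supported_eq_span_single] at ha
  refine Submodule.span_le.2 ?_ ha
  rintro _ ⟨S, hS, rfl⟩
  exact h S hS

theorem opX_mem_grLevel {L i : ℕ} (hi : i < L) {a : Gr K} (ha : a ∈ grLevel K L) :
    opX K i a ∈ grLevel K L := by
  refine grLevel_induction ha (P := (grLevel K L).comap (opX K i)) fun S hS => ?_
  rw [Submodule.mem_comap, opX_single]
  split_ifs
  · exact Submodule.zero_mem _
  · exact Finsupp.single_mem_supported K _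
      (Finset.insert_subset (Finset.mem_range.2 hi) hS)

theorem opD_mem_grLevel {L i : ℕ} {a : Gr K} (ha : a ∈ grLevel K L) :
    opD K i a ∈ grLevel K L := by
  refine grLevel_induction ha (P := (grLevel K L).comap (opD K i)) fun S hS => ?_
  rw [Submodule.mem_comap, opD_single]
  split_ifs
  · exact Finsupp.single_mem_supported K _ ((Finset.erase_subset _ _).trans hS)
  · exact Submodule.zero_mem _

theorem parityProj_single (r : ℕ) (S : Finset ℕ) (c : K) :
    parityProj K r (Finsupp.single S c) = if S.card % 2 = r then Finsupp.single S c else 0 := by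
  rw [parityProj, Finsupp.linearCombination_single]
  split_ifs <;> simp

theorem parityProj_mem_grLevel {L r : ℕ} {a : Gr K} (ha : a ∈ grLevel K L) :
    parityProj K r a ∈ grLevel K L := by
  refine grLevel_induction ha (P := (grLevel K L).comap (parityProj K r)) fun S hS => ?_
  rw [Submodule.mem_comap, parityProj_single]
  split_ifs
  · exact Finsupp.single_mem_supported K _ hS
  · exact Submodule.zero_mem _

/-- The pivot elements are infinite sums, but on each finite level they coincide with finite sums;
identities are therefore tested level by level. -/
theorem endGr_ext_level {a b : EndGr K} (L₀ : ℕ)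
    (h : ∀ L, L₀ ≤ L → ∀ x ∈ grLevel K L, a x = b x) : a = b := by
  refine endGr_ext fun S => ?_
  exact h (max L₀ (S.sup id + 1)) (le_max_left _ _) _ (single_mem_grLevel S (by
    exact lt_of_lt_of_le (Nat.lt_succ_self _) (le_max_right _ _)))

variable (K) in
/-- The sum of the first `L` terms of the pivot element. -/
noncomputable def pivotTrunc (n L : ℕ) : EndGr K :=
  ∑ l ∈ Finset.range L, opTail K n l * opD K (n + 3 * l)

theorem pivot_apply {n L M : ℕ} (h : L ≤ M) {a : Gr K} (ha : a ∈ grLevel K L) :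
    pivot K n a = pivotTrunc K n M a := by
  refine sub_eq_zero.1 (grLevel_induction ha
    (P := LinearMap.ker (pivot K n - pivotTrunc K n M)) fun S hS => ?_)
  rw [LinearMap.mem_ker, LinearMap.sub_apply, sub_eq_zero, pivot,
    Finsupp.linearCombination_single, one_smul, pivotTrunc, LinearMap.sum_apply]
  have hz : ∀ l, n + 3 * l ∉ S →
      opTail K n l (opD K (n + 3 * l) (Finsupp.single S 1)) = 0 := by
    intro l hl
    rw [opD_single, if_neg hl, map_zero]
  -- Both ranges contain every `l` whose derivative acts nontrivially, so both sums equal the sum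
  -- over a common larger range.
  have h1 : ∀ N, (∀ l, n + 3 * l ∈ S → l < N) →
      ∑ l ∈ Finset.range N, opTail K n l (opD K (n + 3 * l) (Finsupp.single S 1)) =
      ∑ l ∈ Finset.range (max (S.sup id + 1) M),
        opTail K n l (opD K (n + 3 * l) (Finsupp.single S 1)) := by
    intro N hN
    rcases le_total N (max (S.sup id + 1) M) with hle | hle
    · refine Finset.sum_subset (Finset.range_mono hle) fun l _ hl => hz l fun hm => hl ?_
      exact Finset.mem_range.2 (hN l hm)
    · refine (Finset.sum_subset (Finset.range_mono hle) fun l _ hl => hz l fun hm => hl ?_).symm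
      have h2 : id (n + 3 * l) ≤ S.sup id := Finset.le_sup hm
      rw [id] at h2
      exact Finset.mem_range.2 (lt_of_lt_of_le (by omega) (le_max_left _ _))
  rw [h1 _ fun l hm => ?_, ← h1 M fun l hm => ?_]
  · rfl
  · have := Finset.mem_range.1 (hS hm)
    omega
  · have h2 : id (n + 3 * l) ≤ S.sup id := Finset.le_sup hm
    rw [id] at h2
    omega

/-- The definition appends a pair of letters on the right; splitting off the first pair instead
yields the recursion of the pivot elements. -/
theorem opTail_succ' (n l : ℕ) :
    opTail K n (l + 1) = opX K n * opX K (n + 1) * opTail K (n + 3) l := by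
  induction l with
  | zero => simp [opTail]
  | succ l ih =>
    rw [opTail, ih, opTail, mul_assoc]
    rw [show n + 3 + 3 * l = n + 3 * (l + 1) by ring]

theorem pivot_eq (n : ℕ) :
    pivot K n = opD K n + opX K n * opX K (n + 1) * pivot K (n + 3) := by
  refine endGr_ext_level 0 fun L _ x hx => ?_
  rw [pivot_apply (Nat.le_succ L) hx, LinearMap.add_apply, Module.End.mul_apply,
    pivot_apply le_rfl hx, ← Module.End.mul_apply, ← LinearMap.add_apply]
  congr 1
  rw [pivotTrunc, Finset.sum_range_succ', pivotTrunc, Finset.mul_sum, add_comm]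
  refine congrArg₂ _ (by simp [opTail]) (Finset.sum_congr rfl fun l _ => ?_)
  rw [opTail_succ', show n + 3 * (l + 1) = n + 3 + 3 * l by ring, mul_assoc _ (opTail K _ _)]

/-- If `a` anticommutes with all letters `x_j`, `∂_j` with `j ≥ m`, then it anticommutes with
`v_m`. -/
theorem pivot_anticomm {m L₀ : ℕ} {a b : EndGr K} (hX : ∀ j, m ≤ j → opX K j * a = -(b * opX K j))
    (hX' : ∀ j, m ≤ j → opX K j * b = -(a * opX K j))
    (hD : ∀ j, m ≤ j → opD K j * a = -(b * opD K j))
    (ha : ∀ L, L₀ ≤ L → ∀ x ∈ grLevel K L, a x ∈ grLevel K L) :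
    pivot K m * a = -(b * pivot K m) := by
  -- A tail consists of pairs of letters, so the signs cancel. Moving past both letters of a pair
  -- interchanges `a` and `b` twice.
  have htail : ∀ l, opTail K m l * b = b * opTail K m l := by
    intro l
    induction l with
    | zero => simp [opTail]
    | succ l ih =>
      have : opX K (m + 3 * l) * opX K (m + 3 * l + 1) * b =
          b * (opX K (m + 3 * l) * opX K (m + 3 * l + 1)) := by
        rw [mul_assoc, hX' _ (by omega), mul_neg, ← mul_assoc, hX _ (by omega), neg_mul, neg_neg,
          mul_assoc]
      rw [opTail, mul_assoc, this, ← mul_assoc, ih, mul_assoc]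
  -- Since `a` preserves the level, one truncation of the pivot element serves both sides.
  refine endGr_ext_level L₀ fun L hL x hx => ?_
  rw [Module.End.mul_apply, pivot_apply le_rfl (ha L hL x hx), LinearMap.neg_apply,
    Module.End.mul_apply, pivot_apply le_rfl hx, ← Module.End.mul_apply, ← Module.End.mul_apply,
    ← LinearMap.neg_apply]
  congr 1
  rw [pivotTrunc, Finset.sum_mul, Finset.mul_sum, ← Finset.sum_neg_distrib]
  refine Finset.sum_congr rfl fun l _ => ?_
  rw [mul_assoc, hD _ (by omega), mul_neg, ← mul_assoc, htail, mul_assoc]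

theorem pivot_mul_opX {m i : ℕ} (h : i < m) :
    pivot K m * opX K i = -(opX K i * pivot K m) :=
  pivot_anticomm (L₀ := i + 1) (fun j _ => opX_mul_opX j i) (fun j _ => opX_mul_opX j i)
    (fun j hj => opD_mul_opX_of_ne (by omega)) (fun _ hL _ hx => opX_mem_grLevel (by omega) hx)

theorem pivot_mul_opD {m i : ℕ} (h : i < m) :
    pivot K m * opD K i = -(opD K i * pivot K m) :=
  pivot_anticomm (L₀ := 0)
    (fun j hj => by rw [opD_mul_opX_of_ne (by omega), neg_neg])
    (fun j hj => by rw [opD_mul_opX_of_ne (by omega), neg_neg])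
    (fun j _ => opD_mul_opD j i) (fun _ _ _ hx => opD_mem_grLevel hx)

/-- The tail of `v_m` begins with `x_m` and dies on multiplication by `x_m` from either side, so
against `x_m` the pivot element behaves like `∂_m`. -/
theorem pivot_mul_opX_self (m : ℕ) : pivot K m * opX K m = 1 - opX K m * pivot K m := by
  rw [pivot_eq, add_mul, mul_add, opD_mul_opX_self, mul_assoc _ (pivot K _),
    pivot_mul_opX (by omega), ← mul_assoc, ← mul_assoc, opX_mul_self, mul_neg, zero_mul, zero_mul,
    add_zero, mul_assoc (opX K m), ← mul_assoc (opX K (m + 1)), opX_mul_opX (m + 1) m, neg_mul,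
    mul_neg, neg_neg, ← mul_assoc, ← mul_assoc, opX_mul_self, zero_mul, zero_mul, add_zero]

theorem opX_mul_pivot (m : ℕ) : opX K m * pivot K m = opX K m * opD K m := by
  rw [pivot_eq, mul_add, ← mul_assoc, ← mul_assoc, opX_mul_self, zero_mul, zero_mul, add_zero]

/-- Put `u = x_{n+1} v_{n+3}`, which commutes with `x_n` and `∂_n`. In `(∂_n + x_n u)²` both squares
vanish and the mixed terms give `(∂_n x_n + x_n ∂_n) u = u`. -/
theorem pivot_mul_pivot (n : ℕ) : pivot K n * pivot K n = opX K (n + 1) * pivot K (n + 3) := by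
  have h1 : pivot K n * opD K n = opX K n * opX K (n + 1) * pivot K (n + 3) * opD K n := by
    rw [pivot_eq n, add_mul, opD_mul_self, zero_add]
  have h2 : pivot K n * (opX K n * opX K (n + 1) * pivot K (n + 3)) =
      opX K (n + 1) * pivot K (n + 3) - opX K n * opD K n * (opX K (n + 1) * pivot K (n + 3)) := by
    rw [mul_assoc (opX K n), ← mul_assoc, pivot_mul_opX_self, sub_mul, one_mul, opX_mul_pivot]
  have h3 : opX K n * opD K n * (opX K (n + 1) * pivot K (n + 3)) =
      opX K n * opX K (n + 1) * pivot K (n + 3) * opD K n := by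
    rw [mul_assoc, ← mul_assoc (opD K n), opD_mul_opX_of_ne (by omega), neg_mul,
      mul_assoc (opX K (n + 1)) (opD K n), ← neg_eq_iff_eq_neg.2 (pivot_mul_opD (by omega)),
      mul_neg]
    simp only [mul_neg, neg_neg, mul_assoc]
  calc pivot K n * pivot K n
      = pivot K n * (opD K n + opX K n * opX K (n + 1) * pivot K (n + 3)) := by rw [← pivot_eq n]
    _ = opX K (n + 1) * pivot K (n + 3) := by
      rw [mul_add, h1, h2, h3, add_sub_cancel]

/-- Commuting `v_{n+1}` with `v_n² = x_{n+1} v_{n+3}` strips off the letter. Thus all pivot elements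
are generated by the first three, with multidegrees obeying the recursion; using the square as an
operation keeps this valid in characteristic two. -/
theorem pivot_add_three (n : ℕ) : pivot K (n + 3) =
    pivot K (n + 1) * (pivot K n * pivot K n) - pivot K n * pivot K n * pivot K (n + 1) := by
  have h1 : opX K (n + 1) * (pivot K (n + 3) * pivot K (n + 1)) =
      -(opX K (n + 1) * pivot K (n + 1) * pivot K (n + 3)) := by
    rw [opX_mul_pivot, pivot_eq (n + 1), mul_add, mul_add, pivot_mul_opD (by omega),
      ← mul_assoc (pivot K (n + 3)), ← mul_assoc (pivot K (n + 3)), pivot_mul_opX (by omega)]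
    have hz : ∀ c, opX K (n + 1) * (opX K (n + 1) * c) = 0 := fun c => by
      rw [← mul_assoc, opX_mul_self, zero_mul]
    simp only [neg_mul, mul_neg, mul_assoc, hz, neg_zero, add_zero]
  rw [pivot_mul_pivot, ← mul_assoc, pivot_mul_opX_self, sub_mul, one_mul, mul_assoc (opX K (n + 1))
    (pivot K (n + 3)), h1]
  abel

theorem pivot_ne_zero (n : ℕ) : pivot K n ≠ 0 := by
  intro h
  have := pivot_mul_opX_self (K := K) n
  rw [h, zero_mul, mul_zero, sub_zero] at this
  have h1 := LinearMap.congr_fun this (Finsupp.single ∅ 1)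
  rw [Module.End.one_apply, LinearMap.zero_apply] at h1
  exact one_ne_zero (Finsupp.single_eq_zero.1 h1.symm)

end EndGr

section EndGr

variable {K : Type u} [Field K]

/-! #### Parity of endomorphisms -/

theorem parityProj_mul_self (r : ℕ) : parityProj K r * parityProj K r = parityProj K r := by
  refine endGr_ext fun S => ?_
  rw [Module.End.mul_apply, parityProj_single]
  split_ifs with h
  · rw [parityProj_single, if_pos h]
  · rw [map_zero]

theorem parityProj_mul_of_ne {r s : ℕ} (hrs : r ≠ s) : parityProj K r * parityProj K s = 0 := by
  refine endGr_ext fun S => ?_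
  rw [Module.End.mul_apply, parityProj_single]
  split_ifs with h
  · rw [parityProj_single, if_neg (by omega)]; rfl
  · rw [map_zero]; rfl

theorem parityProj_add : parityProj K 0 + parityProj K 1 = 1 := by
  refine endGr_ext fun S => ?_
  rw [LinearMap.add_apply, parityProj_single, parityProj_single, Module.End.one_apply]
  rcases Nat.mod_two_eq_zero_or_one S.card with h | h
  · simp [h]
  · simp [h]

theorem parityProj_one : parityProj K 1 = 1 - parityProj K 0 :=
  eq_sub_of_add_eq' parityProj_add

/-- The vanishing of two blocks is turned into commutation with a projection, a form that multiplies
well. -/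
theorem mem_endEven {a : EndGr K} :
    a ∈ endEven K ↔ parityProj K 0 * a = a * parityProj K 0 := by
  constructor
  · rintro ⟨h1, h2⟩
    rw [parityProj_one, mul_sub, mul_one, sub_eq_zero] at h1
    rw [parityProj_one, sub_mul, sub_mul, one_mul, sub_eq_zero] at h2
    rw [h1, h2]
  · intro h
    refine ⟨?_, ?_⟩
    · rw [h, mul_assoc, parityProj_mul_of_ne (by norm_num), mul_zero]
    · rw [mul_assoc, ← h, ← mul_assoc, parityProj_mul_of_ne (by norm_num), zero_mul]

theorem mem_endOdd {a : EndGr K} :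
    a ∈ endOdd K ↔ parityProj K 0 * a = a * parityProj K 1 := by
  constructor
  · rintro ⟨h1, h2⟩
    have h3 : parityProj K 0 * a = parityProj K 0 * a * parityProj K 1 := by
      rw [parityProj_one, mul_sub, h1, mul_one, sub_zero]
    have h4 : a * parityProj K 1 = parityProj K 0 * a * parityProj K 1 := by
      rw [parityProj_one (K := K), sub_mul, sub_mul, one_mul, sub_eq_zero,
        ← parityProj_one] at h2
      exact h2
    rw [h3, h4]
  · intro h
    refine ⟨?_, ?_⟩
    · rw [h, mul_assoc, parityProj_mul_of_ne (by norm_num), mul_zero]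
    · rw [mul_assoc, ← h, ← mul_assoc, parityProj_mul_of_ne (by norm_num), zero_mul]

theorem mem_endOdd' {a : EndGr K} :
    a ∈ endOdd K ↔ parityProj K 1 * a = a * parityProj K 0 := by
  rw [mem_endOdd, parityProj_one, sub_mul, mul_sub, one_mul, mul_one]
  constructor
  · intro h; rw [h]; abel
  · intro h; rw [← h]; abel

theorem mem_endEven' {a : EndGr K} :
    a ∈ endEven K ↔ parityProj K 1 * a = a * parityProj K 1 := by
  rw [mem_endEven, parityProj_one, sub_mul, mul_sub, one_mul, mul_one, sub_right_inj]

theorem evenPart_of_even {a : EndGr K} (h : a ∈ endEven K) : evenPart a = a := by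
  rw [evenPart, mem_endEven.1 h, mem_endEven'.1 h, mul_assoc, mul_assoc, parityProj_mul_self,
    parityProj_mul_self, ← mul_add, parityProj_add, mul_one]

theorem oddPart_of_even {a : EndGr K} (h : a ∈ endEven K) : oddPart a = 0 := by
  rw [oddPart, h.1, h.2, add_zero]

theorem evenPart_of_odd {a : EndGr K} (h : a ∈ endOdd K) : evenPart a = 0 := by
  rw [evenPart, h.1, h.2, add_zero]

theorem oddPart_of_odd {a : EndGr K} (h : a ∈ endOdd K) : oddPart a = a := by
  rw [oddPart, mem_endOdd.1 h, mem_endOdd'.1 h, mul_assoc, mul_assoc, parityProj_mul_self,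
    parityProj_mul_self, ← mul_add, add_comm, parityProj_add, mul_one]

theorem superComm_of_even_left {a b : EndGr K} (ha : a ∈ endEven K) :
    superComm a b = a * b - b * a := by
  have hb : evenPart b + oddPart b = b := by
    have : b = (parityProj K 0 + parityProj K 1) * b * (parityProj K 0 + parityProj K 1) := by
      rw [parityProj_add, one_mul, mul_one]
    conv_rhs => rw [this]
    simp only [evenPart, oddPart, add_mul, mul_add]
    abel
  rw [superComm, evenPart_of_even ha, oddPart_of_even ha, mul_zero, sub_zero, ← add_mul, hb]

theorem superComm_of_even_right {a b : EndGr K} (hb : b ∈ endEven K) :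
    superComm a b = a * b - b * a := by
  rw [superComm, evenPart_of_even hb, oddPart_of_even hb, zero_mul, zero_mul, add_zero, sub_zero]

theorem superComm_of_odd {a b : EndGr K} (ha : a ∈ endOdd K) (hb : b ∈ endOdd K) :
    superComm a b = a * b + b * a := by
  rw [superComm, evenPart_of_odd ha, evenPart_of_odd hb, oddPart_of_odd ha, oddPart_of_odd hb,
    zero_mul, mul_zero, add_zero, zero_sub, sub_neg_eq_add]

theorem mul_mem_endEven {a b : EndGr K} (ha : a ∈ endEven K) (hb : b ∈ endEven K) :
    a * b ∈ endEven K := by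
  rw [mem_endEven] at *
  rw [← mul_assoc, ha, mul_assoc, hb, mul_assoc]

theorem mul_mem_endEven_of_odd {a b : EndGr K} (ha : a ∈ endOdd K) (hb : b ∈ endOdd K) :
    a * b ∈ endEven K := by
  rw [mem_endEven, ← mul_assoc, mem_endOdd.1 ha, mul_assoc, mem_endOdd'.1 hb, mul_assoc]

theorem mul_mem_endOdd_left {a b : EndGr K} (ha : a ∈ endOdd K) (hb : b ∈ endEven K) :
    a * b ∈ endOdd K := by
  rw [mem_endOdd, ← mul_assoc, mem_endOdd.1 ha, mul_assoc, mem_endEven'.1 hb, mul_assoc]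

theorem mul_mem_endOdd_right {a b : EndGr K} (ha : a ∈ endEven K) (hb : b ∈ endOdd K) :
    a * b ∈ endOdd K := by
  rw [mem_endOdd, ← mul_assoc, mem_endEven.1 ha, mul_assoc, mem_endOdd.1 hb, mul_assoc]

theorem endEven_inf_endOdd : endEven K ⊓ endOdd K = ⊥ := by
  rw [eq_bot_iff]
  rintro a ⟨h0, h1⟩
  have := evenPart_of_even h0
  rw [evenPart_of_odd h1] at this
  exact this.symm

theorem evenPart_add (a b : EndGr K) : evenPart (a + b) = evenPart a + evenPart b := by
  simp only [evenPart, mul_add, add_mul]; abel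

theorem oddPart_add (a b : EndGr K) : oddPart (a + b) = oddPart a + oddPart b := by
  simp only [oddPart, mul_add, add_mul]; abel

theorem evenPart_smul (c : K) (a : EndGr K) : evenPart (c • a) = c • evenPart a := by
  simp only [evenPart, mul_smul_comm, smul_mul_assoc, smul_add]

theorem oddPart_smul (c : K) (a : EndGr K) : oddPart (c • a) = c • oddPart a := by
  simp only [oddPart, mul_smul_comm, smul_mul_assoc, smul_add]

theorem assocData_isRegular : (assocData K).IsRegular where
  op_bilinear := by
    rintro _ rfl
    exact ⟨LinearMap.mul K (EndGr K), fun _ _ => rfl⟩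
  op_parity := by
    rintro _ rfl i j a ha b hb
    cases i <;> cases j
    · exact mul_mem_endEven ha hb
    · exact mul_mem_endOdd_right ha hb
    · exact mul_mem_endOdd_left ha hb
    · exact mul_mem_endEven_of_odd ha hb
  sq_parity := by rintro _ ⟨⟩
  sq_smul := by rintro _ ⟨⟩
  sq_add := by rintro _ ⟨⟩
  parity_disjoint := endEven_inf_endOdd

/-- The supercommutator as a bilinear map. -/
noncomputable def superCommLin : EndGr K →ₗ[K] EndGr K →ₗ[K] EndGr K :=
  LinearMap.mk₂ K superComm
    (by
      intro a a' b
      simp only [superComm, evenPart_add, oddPart_add, mul_add, add_mul]; abel)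
    (by
      intro c a b
      simp only [superComm, evenPart_smul, oddPart_smul, mul_smul_comm, smul_mul_assoc, smul_sub,
        smul_add])
    (by
      intro a b b'
      simp only [superComm, evenPart_add, oddPart_add, mul_add, add_mul]; abel)
    (by
      intro c a b
      simp only [superComm, evenPart_smul, oddPart_smul, mul_smul_comm, smul_mul_assoc, smul_sub,
        smul_add])

theorem superComm_parity {i j : Bool} {a b : EndGr K} (ha : a ∈ (lieData K).par i)
    (hb : b ∈ (lieData K).par j) : superComm a b ∈ (lieData K).par (xor i j) := by
  cases i <;> cases j
  · rw [superComm_of_even_left ha]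
    exact Submodule.sub_mem (endEven K) (mul_mem_endEven ha hb) (mul_mem_endEven hb ha)
  · rw [superComm_of_even_left ha]
    exact Submodule.sub_mem (endOdd K) (mul_mem_endOdd_right ha hb) (mul_mem_endOdd_left hb ha)
  · rw [superComm_of_even_right hb]
    exact Submodule.sub_mem (endOdd K) (mul_mem_endOdd_left ha hb) (mul_mem_endOdd_right hb ha)
  · rw [superComm_of_odd ha hb]
    exact Submodule.add_mem (endEven K) (mul_mem_endEven_of_odd ha hb)
      (mul_mem_endEven_of_odd hb ha)

theorem lieData_isRegular : (lieData K).IsRegular where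
  op_bilinear := by
    rintro _ rfl
    exact ⟨superCommLin, fun _ _ => rfl⟩
  op_parity := by
    rintro _ rfl i j a ha b hb
    exact superComm_parity ha hb
  sq_parity := by
    rintro _ rfl a ha
    exact mul_mem_endEven_of_odd ha ha
  sq_smul := by
    rintro _ rfl c a ha
    simp only [mul_smul_comm, smul_mul_assoc, smul_smul, pow_two]
  sq_add := by
    rintro _ rfl
    refine ⟨superComm, rfl, fun a ha b hb => ?_⟩
    rw [superComm_of_odd ha hb]
    simp only [mul_add, add_mul]
    abel
  parity_disjoint := endEven_inf_endOdd

theorem parityProj_mul_opX {r s : ℕ} (hr : r < 2) (hs : s < 2) (hrs : r ≠ s) (i : ℕ) :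
    parityProj K r * opX K i = opX K i * parityProj K s := by
  refine endGr_ext fun S => ?_
  rw [Module.End.mul_apply, Module.End.mul_apply, opX_single, parityProj_single]
  by_cases hi : i ∈ S
  · rw [if_pos hi, map_zero]
    split_ifs
    · rw [opX_single, if_pos hi]
    · rw [map_zero]
  · rw [if_neg hi, parityProj_single, Finset.card_insert_of_notMem hi]
    by_cases h : S.card % 2 = s
    · rw [if_pos h, if_pos (by omega), opX_single, if_neg hi]
    · rw [if_neg h, if_neg (by omega), map_zero]

theorem parityProj_mul_opD {r s : ℕ} (hr : r < 2) (hs : s < 2) (hrs : r ≠ s) (i : ℕ) :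
    parityProj K r * opD K i = opD K i * parityProj K s := by
  refine endGr_ext fun S => ?_
  rw [Module.End.mul_apply, Module.End.mul_apply, opD_single, parityProj_single]
  by_cases hi : i ∈ S
  · have := Finset.card_erase_add_one hi
    rw [if_pos hi, parityProj_single]
    by_cases h : S.card % 2 = s
    · rw [if_pos h, if_pos (by omega), opD_single, if_pos hi]
    · rw [if_neg h, if_neg (by omega), map_zero]
  · rw [if_neg hi, map_zero]
    split_ifs
    · rw [opD_single, if_neg hi]
    · rw [map_zero]

theorem parityProj_mul_opTail (n l : ℕ) :
    parityProj K 0 * opTail K n l = opTail K n l * parityProj K 0 := by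
  induction l with
  | zero => rw [opTail, mul_one, one_mul]
  | succ l ih =>
    rw [opTail, ← mul_assoc, ih, mul_assoc, ← mul_assoc (parityProj K 0),
      parityProj_mul_opX (s := 1) (by norm_num) (by norm_num) (by norm_num), mul_assoc (opX K _),
      parityProj_mul_opX (s := 0) (by norm_num) (by norm_num) (by norm_num)]
    simp only [mul_assoc]

theorem pivot_mem_endOdd (n : ℕ) : pivot K n ∈ endOdd K := by
  rw [mem_endOdd]
  refine endGr_ext_level 0 fun L _ x hx => ?_
  rw [Module.End.mul_apply, Module.End.mul_apply, pivot_apply le_rfl hx,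
    pivot_apply le_rfl (parityProj_mem_grLevel hx), ← Module.End.mul_apply,
    ← Module.End.mul_apply]
  congr 1
  rw [pivotTrunc, Finset.mul_sum, Finset.sum_mul]
  refine Finset.sum_congr rfl fun l _ => ?_
  rw [← mul_assoc, parityProj_mul_opTail, mul_assoc,
    parityProj_mul_opD (s := 1) (by norm_num) (by norm_num) (by norm_num), mul_assoc]

/-! #### Weights of endomorphisms -/

/-- The weight of the monomial `x^S`, where `x_i` has the weight opposite to `v_i`. -/
def xWeight (S : Finset ℕ) : Fin 3 → ℤ := -∑ i ∈ S, pivotWeight i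

theorem xWeight_insert {i : ℕ} {S : Finset ℕ} (h : i ∉ S) :
    xWeight (insert i S) = xWeight S - pivotWeight i := by
  rw [xWeight, Finset.sum_insert h, xWeight]; abel

theorem xWeight_erase {i : ℕ} {S : Finset ℕ} (h : i ∈ S) :
    xWeight (S.erase i) = xWeight S + pivotWeight i := by
  have := xWeight_insert (Finset.notMem_erase i S)
  rw [Finset.insert_erase h] at this
  rw [this]; abel

variable (K) in
/-- The endomorphisms whose matrix entries vanish outside of the relation `ρ`. -/
def endSupported (ρ : Finset ℕ → Finset ℕ → Prop) : Submodule K (EndGr K) where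
  carrier := {a | ∀ S T, a (Finsupp.single S 1) T ≠ 0 → ρ S T}
  add_mem' := by
    intro a b ha hb S T h
    by_cases h0 : a (Finsupp.single S 1) T = 0
    · refine hb S T fun h1 => h ?_
      rw [LinearMap.add_apply, Finsupp.add_apply, h0, h1, add_zero]
    · exact ha S T h0
  zero_mem' := by intro S T h; exact absurd rfl h
  smul_mem' := by
    intro c a ha S T h
    refine ha S T fun h1 => h ?_
    rw [LinearMap.smul_apply, Finsupp.smul_apply, h1, smul_zero]

/-- A nonzero matrix entry of a product passes through some intermediate basis monomial at which
both factors have nonzero entries. -/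
theorem mul_mem_endSupported {ρ σ τ : Finset ℕ → Finset ℕ → Prop} {a b : EndGr K}
    (ha : a ∈ endSupported K ρ) (hb : b ∈ endSupported K σ)
    (h : ∀ S T U, σ S T → ρ T U → τ S U) : a * b ∈ endSupported K τ := by
  intro S U hne
  rw [Module.End.mul_apply] at hne
  set c := b (Finsupp.single S 1) with hc
  have h1 : (a c) U = ∑ T ∈ c.support, c T * a (Finsupp.single T 1) U := by
    conv_lhs => rw [← c.sum_single, Finsupp.sum, map_sum]
    rw [Finsupp.finsetSum_apply]
    refine Finset.sum_congr rfl fun T _ => ?_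
    rw [← mul_one (c T), ← smul_eq_mul, ← Finsupp.smul_single, map_smul, Finsupp.smul_apply,
      smul_eq_mul, smul_eq_mul, mul_one]
  rw [h1] at hne
  obtain ⟨T, -, hT⟩ := Finset.exists_ne_zero_of_sum_ne_zero hne
  exact h S T U (hb S T (left_ne_zero_of_mul hT)) (ha T U (right_ne_zero_of_mul hT))

theorem one_mem_endSupported {ρ : Finset ℕ → Finset ℕ → Prop} (h : ∀ S, ρ S S) :
    (1 : EndGr K) ∈ endSupported K ρ := by
  intro S T hne
  rw [Module.End.one_apply] at hne
  have : S = T := by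
    by_contra h0
    exact hne (Finsupp.single_eq_of_ne (Ne.symm h0))
  exact this ▸ h S

theorem opX_mem_endSupported {ρ : Finset ℕ → Finset ℕ → Prop} {i : ℕ}
    (h : ∀ S, i ∉ S → ρ S (insert i S)) : opX K i ∈ endSupported K ρ := by
  intro S T hne
  rw [opX_single] at hne
  split_ifs at hne with hi
  · exact absurd rfl hne
  · have : insert i S = T := by
      by_contra h0
      exact hne (Finsupp.single_eq_of_ne (Ne.symm h0))
    exact this ▸ h S hi

theorem opD_mem_endSupported {ρ : Finset ℕ → Finset ℕ → Prop} {i : ℕ}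
    (h : ∀ S, i ∈ S → ρ S (S.erase i)) : opD K i ∈ endSupported K ρ := by
  intro S T hne
  rw [opD_single] at hne
  split_ifs at hne with hi
  · have : S.erase i = T := by
      by_contra h0
      exact hne (Finsupp.single_eq_of_ne (Ne.symm h0))
    exact this ▸ h S hi
  · exact absurd rfl hne

theorem endSupported_inf {ρ σ : Finset ℕ → Finset ℕ → Prop} (h : ∀ S T, ρ S T → ¬ σ S T) :
    endSupported K ρ ⊓ endSupported K σ = ⊥ := by
  rw [eq_bot_iff]
  rintro a ⟨h1, h2⟩
  refine endGr_ext fun S => Finsupp.ext fun T => ?_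
  by_contra hne
  exact h S T (h1 S T hne) (h2 S T hne)

theorem endSupported_mono {ρ σ : Finset ℕ → Finset ℕ → Prop} (h : ∀ S T, ρ S T → σ S T) :
    endSupported K ρ ≤ endSupported K σ :=
  fun _ ha S T hne => h S T (ha S T hne)

variable (K) in
/-- The endomorphisms of weight `d`. -/
def endWeight (d : Fin 3 → ℤ) : Submodule K (EndGr K) :=
  endSupported K fun S T => xWeight T = xWeight S + d

theorem mul_mem_endWeight {a b : EndGr K} {d e : Fin 3 → ℤ} (ha : a ∈ endWeight K d)
    (hb : b ∈ endWeight K e) : a * b ∈ endWeight K (d + e) :=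
  mul_mem_endSupported ha hb fun S T U h1 h2 => by rw [h2, h1]; abel

theorem opX_mem_endWeight (i : ℕ) : opX K i ∈ endWeight K (-pivotWeight i) :=
  opX_mem_endSupported fun S h => by rw [xWeight_insert h, sub_eq_add_neg]

theorem opD_mem_endWeight (i : ℕ) : opD K i ∈ endWeight K (pivotWeight i) :=
  opD_mem_endSupported fun _ h => xWeight_erase h

/-- The pair with number `k = n + 3l` has weight `-w(k) - w(k+1) = w(k) - w(k+3)`, so the sum
telescopes. Consequently all terms of a pivot element have the same weight. -/
theorem opTail_mem_endWeight (n l : ℕ) :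
    opTail K n l ∈ endWeight K (pivotWeight n - pivotWeight (n + 3 * l)) := by
  induction l with
  | zero =>
    refine one_mem_endSupported fun _ => ?_
    simp
  | succ l ih =>
    have := mul_mem_endWeight ih (mul_mem_endWeight (opX_mem_endWeight (K := K) (n + 3 * l))
      (opX_mem_endWeight (n + 3 * l + 1)))
    have e : pivotWeight n - pivotWeight (n + 3 * (l + 1)) = pivotWeight n -
        pivotWeight (n + 3 * l) + (-pivotWeight (n + 3 * l) + -pivotWeight (n + 3 * l + 1)) := by
      rw [show n + 3 * (l + 1) = n + 3 * l + 3 by ring, pivotWeight_add_three]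
      abel
    rw [e]
    exact this

theorem pivot_mem_endWeight (n : ℕ) : pivot K n ∈ endWeight K (pivotWeight n) := by
  intro S T hne
  have hS := single_mem_grLevel (K := K) S (Nat.lt_succ_self _)
  rw [pivot_apply le_rfl hS] at hne
  have : pivotTrunc K n (S.sup id + 1) ∈ endWeight K (pivotWeight n) := by
    refine Submodule.sum_mem _ fun l _ => ?_
    have := mul_mem_endWeight (opTail_mem_endWeight (K := K) n l) (opD_mem_endWeight (n + 3 * l))
    rwa [sub_add_cancel] at this
  exact this S T hne

theorem latticePoint_single (i : Fin 3) : latticePoint (Pi.single i 1) = pivotWeight i := by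
  fin_cases i <;> rfl

theorem latticePoint_injective : Function.Injective latticePoint := by
  intro d e h
  funext i
  have := congrFun h i
  simpa [latticePoint] using this

theorem assoc_monomial_mem_endWeight {d : Fin 3 → ℕ} {x : EndGr K}
    (hx : (assocData K).IsMonomial (pivots K) d x) : x ∈ endWeight K (latticePoint d) := by
  induction hx with
  | gen i =>
    rw [latticePoint_single]
    exact pivot_mem_endWeight _
  | op m d e x y hm _ _ hx hy =>
    obtain rfl := hm
    rw [map_add]
    exact mul_mem_endWeight hx hy
  | sq q d x hq _ _ _ => exact hq.elim

/-- The position of a nonzero matrix entry determines the weight, and the weight determines the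
multidegree; disjoint sets of degrees thus have disjoint supports. -/
theorem assoc_part_inf {Γ Δ : Set (Fin 3 → ℕ)} (h : Disjoint Γ Δ) :
    (assocData K).part (pivots K) Γ ⊓ (assocData K).part (pivots K) Δ = ⊥ := by
  have key : ∀ Γ : Set (Fin 3 → ℕ), (assocData K).part (pivots K) Γ ≤
      endSupported K fun S T => ∃ d ∈ Γ, xWeight T = xWeight S + latticePoint d := by
    intro Γ
    rw [SuperData.part, Submodule.span_le]
    rintro x ⟨d, hd, hx⟩
    exact endSupported_mono (fun S T h => ⟨d, hd, h⟩) (assoc_monomial_mem_endWeight hx)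
  rw [eq_bot_iff]
  refine (inf_le_inf (key Γ) (key Δ)).trans (endSupported_inf ?_).le
  rintro S T ⟨d, hd, h1⟩ ⟨e, he, h2⟩
  rw [h1] at h2
  have := latticePoint_injective (add_left_cancel h2)
  exact Set.disjoint_left.1 h hd (this ▸ he)

/-! #### Normal forms of words in the pivot elements -/

/-- The words in `v_n, v_{n+1}, v_{n+2}`. -/
inductive PivotWord (n : ℕ) : (Fin 3 → ℕ) → EndGr K → Prop
  | one : PivotWord n 0 1
  | mul (i : Fin 3) (e : Fin 3 → ℕ) (w : EndGr K) : PivotWord n e w →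
      PivotWord n (e + Pi.single i 1) (pivot K (n + i) * w)

/-- The words in `v_n, v_{n+1}, v_{n+2}` multiplied from the left by letters `x_i` with `i ≤ n` and
`∂_i` with `i < n`, together with their weights. -/
inductive LetterWord (n : ℕ) : (Fin 3 → ℤ) → EndGr K → Prop
  | word (e : Fin 3 → ℕ) (w : EndGr K) : PivotWord n e w →
      LetterWord n (∑ i : Fin 3, e i • pivotWeight (n + i)) w
  | x (i : ℕ) (d : Fin 3 → ℤ) (a : EndGr K) : i ≤ n → LetterWord n d a →
      LetterWord n (d - pivotWeight i) (opX K i * a)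
  | del (i : ℕ) (d : Fin 3 → ℤ) (a : EndGr K) : i < n → LetterWord n d a →
      LetterWord n (d + pivotWeight i) (opD K i * a)

variable (K) in
/-- The span of the words of weight `d` as above. -/
noncomputable def letterSpan (n : ℕ) (d : Fin 3 → ℤ) : Submodule K (EndGr K) :=
  Submodule.span K {a | LetterWord n d a}

theorem mul_mem_letterSpan {n : ℕ} {d e : Fin 3 → ℤ} {b : EndGr K}
    (h : ∀ a, LetterWord n d a → b * a ∈ letterSpan K n e) :
    ∀ a ∈ letterSpan K n d, b * a ∈ letterSpan K n e :=
  fun _ ha => Submodule.span_le (p := (letterSpan K n e).comap (LinearMap.mulLeft K b)).2 h ha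

theorem opX_mul_mem_letterSpan {n i : ℕ} (hi : i ≤ n) {d : Fin 3 → ℤ} :
    ∀ a ∈ letterSpan K n d, opX K i * a ∈ letterSpan K n (d - pivotWeight i) :=
  mul_mem_letterSpan fun a ha => Submodule.subset_span (LetterWord.x i d a hi ha)

theorem opD_mul_mem_letterSpan {n i : ℕ} (hi : i < n) {d : Fin 3 → ℤ} :
    ∀ a ∈ letterSpan K n d, opD K i * a ∈ letterSpan K n (d + pivotWeight i) :=
  mul_mem_letterSpan fun a ha => Submodule.subset_span (LetterWord.del i d a hi ha)

theorem sum_single_smul_pivotWeight (n : ℕ) (e : Fin 3 → ℕ) (i : Fin 3) :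
    ∑ j : Fin 3, (e + Pi.single i 1 : Fin 3 → ℕ) j • pivotWeight (n + j) =
      ∑ j : Fin 3, e j • pivotWeight (n + j) + pivotWeight (n + i) := by
  simp only [Pi.add_apply, add_smul, Finset.sum_add_distrib]
  congr 1
  rw [Finset.sum_eq_single i]
  · simp
  · intro j _ hj
    simp [hj]
  · simp

/-- Moving `v_{n+i}` to the right past low letters costs only signs, except at `x_n` when `i = 0`,
where a term without both factors appears; its weight is still the right one. -/
theorem pivot_add_mul_mem_letterSpan {n : ℕ} (i : Fin 3) {d : Fin 3 → ℤ} :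
    ∀ a ∈ letterSpan K n d, pivot K (n + i) * a ∈ letterSpan K n (d + pivotWeight (n + i)) := by
  refine mul_mem_letterSpan fun a ha => ?_
  induction ha with
  | word e w hw =>
    rw [← sum_single_smul_pivotWeight]
    exact Submodule.subset_span (LetterWord.word _ _ (PivotWord.mul i e w hw))
  | x j d a hj ha ih =>
    by_cases hji : j = n + i
    · rw [← mul_assoc, hji, pivot_mul_opX_self, sub_mul, one_mul, mul_assoc, sub_add_cancel]
      refine Submodule.sub_mem _ (Submodule.subset_span ha) ?_
      have := opX_mul_mem_letterSpan (i := n + i) (by omega) _ ih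
      rwa [add_sub_cancel_right] at this
    · rw [← mul_assoc, pivot_mul_opX (by omega), neg_mul, mul_assoc]
      have := opX_mul_mem_letterSpan hj _ ih
      rw [add_sub_right_comm] at this
      exact Submodule.neg_mem _ this
  | del j d a hj ha ih =>
    rw [← mul_assoc, pivot_mul_opD (by omega), neg_mul, mul_assoc]
    have := opD_mul_mem_letterSpan hj _ ih
    rw [add_right_comm] at this
    exact Submodule.neg_mem _ this

/-- A pivot element below `n` is unfolded as `∂_k + x_k x_{k+1} v_{k+3}` until its number reaches
the window. For `k = n - 1` this produces the letter `x_n`, which is why `x_n` is admitted among the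
low letters while `∂_n` is not. -/
theorem pivot_mul_mem_letterSpan {n : ℕ} (k : ℕ) (hk : k ≤ n + 2) {d : Fin 3 → ℤ} :
    ∀ a ∈ letterSpan K n d, pivot K k * a ∈ letterSpan K n (d + pivotWeight k) := by
  induction hm : n + 2 - k using Nat.strong_induction_on generalizing k d with
  | _ m ih =>
    intro a ha
    rcases le_or_gt n k with h | h
    · have := pivot_add_mul_mem_letterSpan (n := n) ⟨k - n, by omega⟩ a ha
      simpa only [Nat.add_sub_cancel' h] using this
    · rw [pivot_eq, add_mul, mul_assoc, mul_assoc]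
      refine Submodule.add_mem _ (opD_mul_mem_letterSpan h a ha) ?_
      have h1 := ih (n + 2 - (k + 3)) (by omega) (k + 3) (by omega) rfl a ha
      have h2 := opX_mul_mem_letterSpan (i := k) (by omega) _
        (opX_mul_mem_letterSpan (i := k + 1) (by omega) _ h1)
      convert h2 using 2
      rw [pivotWeight_add_three]
      abel

theorem assoc_monomial_mem_letterSpan (n : ℕ) {d : Fin 3 → ℕ} {x : EndGr K}
    (hx : (assocData K).IsMonomial (pivots K) d x) : x ∈ letterSpan K n (latticePoint d) := by
  -- It is easier to show that left multiplication by a monomial preserves the normal forms; applied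
  -- to `1` this gives the claim.
  have key : ∀ e, ∀ a ∈ letterSpan K n e, x * a ∈ letterSpan K n (e + latticePoint d) := by
    induction hx with
    | gen i =>
      intro e
      rw [latticePoint_single]
      exact pivot_mul_mem_letterSpan _ (by omega)
    | op m d e x y hm _ _ hx hy =>
      obtain rfl := hm
      intro f a ha
      have := hx _ _ (hy f a ha)
      rw [mul_assoc, map_add, add_comm (latticePoint d), ← add_assoc]
      exact this
    | sq q d x hq _ _ _ => exact hq.elim
  have h1 : (1 : EndGr K) ∈ letterSpan K n 0 := by
    have := LetterWord.word (K := K) (n := n) 0 1 PivotWord.one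
    simp only [Pi.zero_apply, zero_smul, Finset.sum_const_zero] at this
    exact Submodule.subset_span this
  have := key 0 1 h1
  rwa [mul_one, zero_add] at this

variable (K) in
/-- The endomorphisms of weight `d` that do not touch the letters with numbers above `n`. -/
def lowEnd (n : ℕ) (d : Fin 3 → ℤ) : Submodule K (EndGr K) :=
  endSupported K fun S T => xWeight T = xWeight S + d ∧ ∀ j, n < j → (j ∈ S ↔ j ∈ T)

theorem LetterWord.exists_factorization {n : ℕ} {d : Fin 3 → ℤ} {a : EndGr K}
    (ha : LetterWord n d a) : ∃ r w, ∃ f : Fin 3 → ℤ, ∃ e : Fin 3 → ℕ, a = r * w ∧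
      r ∈ lowEnd K n f ∧ d = f + ∑ i : Fin 3, e i • pivotWeight (n + i) := by
  have hmul : ∀ {l r : EndGr K} {f g : Fin 3 → ℤ}, l ∈ lowEnd K n f → r ∈ lowEnd K n g →
      l * r ∈ lowEnd K n (g + f) := fun hl hr => mul_mem_endSupported hl hr
    fun S T U h1 h2 => ⟨by rw [h2.1, h1.1, add_assoc], fun j hj => (h1.2 j hj).trans (h2.2 j hj)⟩
  induction ha with
  | word e w _ =>
    exact ⟨1, w, 0, e, (one_mul w).symm, one_mem_endSupported fun S =>
      ⟨(add_zero _).symm, fun _ _ => Iff.rfl⟩, (zero_add _).symm⟩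
  | x i d a hi _ ih =>
    obtain ⟨r, w, f, e, rfl, hr, rfl⟩ := ih
    have : opX K i ∈ lowEnd K n (-pivotWeight i) := opX_mem_endSupported fun S h =>
      ⟨by rw [xWeight_insert h, sub_eq_add_neg], fun j hj => by
        rw [Finset.mem_insert, or_iff_right (by omega)]⟩
    exact ⟨_, w, _, e, (mul_assoc _ _ _).symm, hmul this hr, by abel⟩
  | del i d a hi _ ih =>
    obtain ⟨r, w, f, e, rfl, hr, rfl⟩ := ih
    have : opD K i ∈ lowEnd K n (pivotWeight i) := opD_mem_endSupported fun S h =>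
      ⟨xWeight_erase h, fun j hj => by
        rw [Finset.mem_erase, and_iff_right (by omega)]⟩
    exact ⟨_, w, _, e, (mul_assoc _ _ _).symm, hmul this hr, by abel⟩

/-- A nonzero entry of such an operator joins two sets that agree above `n`, so its weight is read
off from their intersections with `{0, …, n}`. -/
theorem exists_weights_of_lowEnd (n : ℕ) : ∃ F : Set (Fin 3 → ℤ), F.Finite ∧
    ∀ f, ∀ r ∈ lowEnd K n f, r ≠ 0 → f ∈ F := by
  let P := (Finset.range (n + 1)).powerset
  refine ⟨_, ((P ×ˢ P).image fun z => xWeight z.2 - xWeight z.1).finite_toSet, ?_⟩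
  intro f r hr hne
  obtain ⟨S, T, hST⟩ : ∃ S T, r (Finsupp.single S 1) T ≠ 0 := by
    by_contra! h
    exact hne (endGr_ext fun S => Finsupp.ext fun T => h S T)
  obtain ⟨h1, h2⟩ := hr S T hST
  refine Finset.mem_coe.2 (Finset.mem_image.2
    ⟨(S.filter (· < n + 1), T.filter (· < n + 1)), ?_, ?_⟩)
  · simp only [P, Finset.mem_product, Finset.mem_powerset]
    exact ⟨fun j hj => Finset.mem_range.2 (Finset.mem_filter.1 hj).2,
      fun j hj => Finset.mem_range.2 (Finset.mem_filter.1 hj).2⟩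
  · have hsplit : ∀ U : Finset ℕ, xWeight U =
        xWeight (U.filter (· < n + 1)) + xWeight (U.filter (¬ · < n + 1)) := by
      intro U
      rw [xWeight, xWeight, xWeight, ← Finset.sum_filter_add_sum_filter_not U (· < n + 1)]
      abel
    have heq : S.filter (¬ · < n + 1) = T.filter (¬ · < n + 1) := by
      ext j
      simp only [Finset.mem_filter]
      constructor
      · rintro ⟨h, hj⟩; exact ⟨(h2 j (by omega)).1 h, hj⟩
      · rintro ⟨h, hj⟩; exact ⟨(h2 j (by omega)).2 h, hj⟩
    rw [hsplit S, hsplit T, heq] at h1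
    have h3 : xWeight (T.filter (· < n + 1)) = xWeight (S.filter (· < n + 1)) + f := by
      refine add_right_cancel (b := xWeight (T.filter (¬ · < n + 1))) ?_
      rw [h1]; abel
    simp only [h3, add_sub_cancel_left]

/-- A nonzero monomial forces a nonzero normal form of the same weight; the low factor of that form
is nonzero, so its weight belongs to a finite set. -/
theorem assoc_selfSimilar :
    SelfSimilar {d | ∃ x, (assocData K).IsMonomial (pivots K) d x ∧ x ≠ 0} := by
  intro n
  obtain ⟨F, hF, h⟩ := exists_weights_of_lowEnd (K := K) n
  refine ⟨F, hF, ?_⟩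
  rintro d ⟨x, hx, hx0⟩
  have hmem := assoc_monomial_mem_letterSpan n hx
  obtain ⟨a, ha, ha0⟩ : ∃ a, LetterWord (K := K) n (latticePoint d) a ∧ a ≠ 0 := by
    by_contra! hz
    have : letterSpan K n (latticePoint d) = ⊥ := by
      rw [letterSpan, Submodule.span_eq_bot]
      exact hz
    rw [this] at hmem
    exact hx0 hmem
  obtain ⟨r, w, f, e, rfl, hr, he⟩ := ha.exists_factorization
  exact ⟨f, h f r hr (left_ne_zero_of_mul ha0), e, he⟩

/-! #### The Lie superalgebra inside of its associative hull -/

/-- For homogeneous elements the supercommutator is `xy ± yx`, of the same associative multidegree;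
parity is carried along to justify this formula. -/
theorem lie_monomial_mem_assoc {d : Fin 3 → ℕ} {x : EndGr K}
    (hx : (lieData K).IsMonomial (pivots K) d x) :
    x ∈ (assocData K).component (pivots K) d ∧ ∃ i, x ∈ (lieData K).par i := by
  have hmul : ∀ {d e : Fin 3 → ℕ}, ∀ x ∈ (assocData K).component (pivots K) d,
      ∀ y ∈ (assocData K).component (pivots K) e,
      x * y ∈ (assocData K).component (pivots K) (d + e) := by
    intro d e
    refine assocData_isRegular.op_mem_span rfl fun x hx y hy => ?_
    exact Submodule.subset_span (SuperData.IsMonomial.op _ d e x y rfl hx hy)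
  induction hx with
  | gen i => exact ⟨Submodule.subset_span (SuperData.IsMonomial.gen i), true, pivot_mem_endOdd _⟩
  | op m d e x y hm _ _ hx hy =>
    obtain rfl := hm
    obtain ⟨hx, i, hi⟩ := hx
    obtain ⟨hy, j, hj⟩ := hy
    refine ⟨?_, _, superComm_parity hi hj⟩
    have h1 := hmul x hx y hy
    have h2 := hmul y hy x hx
    rw [add_comm e d] at h2
    cases i
    · rw [superComm_of_even_left hi]
      exact Submodule.sub_mem _ h1 h2
    · cases j
      · rw [superComm_of_even_right hj]
        exact Submodule.sub_mem _ h1 h2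
      · rw [superComm_of_odd hi hj]
        exact Submodule.add_mem _ h1 h2
  | sq q d x hq ho _ hx =>
    obtain rfl := hq
    obtain ⟨hx, -⟩ := hx
    refine ⟨?_, false, mul_mem_endEven_of_odd ho ho⟩
    rw [two_smul]
    exact hmul x hx x hx

theorem lie_part_le_assoc_part (Γ : Set (Fin 3 → ℕ)) :
    (lieData K).part (pivots K) Γ ≤ (assocData K).part (pivots K) Γ := by
  rw [SuperData.part, Submodule.span_le]
  rintro x ⟨d, hd, hx⟩
  exact SuperData.component_le_part hd (lie_monomial_mem_assoc hx).1

theorem lie_monomial_pivot (n : ℕ) :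
    (lieData K).IsMonomial (pivots K) (pivotDegree n) (pivot K n) := by
  induction n using Nat.strong_induction_on with
  | _ n ih =>
    match n with
    | 0 => exact SuperData.IsMonomial.gen 0
    | 1 => exact SuperData.IsMonomial.gen 1
    | 2 => exact SuperData.IsMonomial.gen 2
    | n + 3 =>
      have h1 := SuperData.IsMonomial.sq (D := lieData K) (fun a => a * a) _ _ rfl
        (pivot_mem_endOdd n) (ih n (by omega))
      have h2 := SuperData.IsMonomial.op (D := lieData K) superComm _ _ _ _ rfl
        (ih (n + 1) (by omega)) h1
      rw [superComm_of_even_right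
        (mul_mem_endEven_of_odd (pivot_mem_endOdd n) (pivot_mem_endOdd n)),
        ← pivot_add_three] at h2
      exact h2

/-- Disjointness and the restriction on degrees pass to subspaces: a nonzero Lie monomial of degree
`d` requires a nonzero associative one of that degree. -/
theorem lieData_isPlaneGraded : (lieData K).IsPlaneGraded (pivots K) where
  regular := lieData_isRegular
  gen_odd _ := pivot_mem_endOdd _
  disjoint Γ Δ h := by
    rw [eq_bot_iff, ← assoc_part_inf h]
    exact inf_le_inf (lie_part_le_assoc_part Γ) (lie_part_le_assoc_part Δ)
  selfSimilar := by
    intro n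
    obtain ⟨F, hF, h⟩ := assoc_selfSimilar (K := K) n
    refine ⟨F, hF, ?_⟩
    rintro d ⟨x, hx, hx0⟩
    refine h d ?_
    by_contra hd
    have hmem := (lie_monomial_mem_assoc hx).1
    have : (assocData K).component (pivots K) d = ⊥ := by
      rw [SuperData.component, Submodule.span_eq_bot]
      intro y hy
      by_contra hy0
      exact hd ⟨y, hy, hy0⟩
    rw [this] at hmem
    exact hx0 hmem
  pivot n := ⟨_, Submodule.subset_span (lie_monomial_pivot n), pivot_ne_zero n⟩

theorem assocData_isPlaneGraded : (assocData K).IsPlaneGraded (pivots K) where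
  regular := assocData_isRegular
  gen_odd _ := pivot_mem_endOdd _
  disjoint _ _ := assoc_part_inf
  selfSimilar := assoc_selfSimilar
  pivot n := ⟨_, (lie_monomial_mem_assoc (lie_monomial_pivot n)).1, pivot_ne_zero n⟩

end EndGr

/-! ### The algebra of formal sums of Grassmann monomials -/

section Series

variable {K : Type u} [Field K]

local infixl:70 " ⋆ " => gmul

/-! #### Signs -/

/-- The sign of the product of the monomials with letters `T` and `U`. -/
def crossSign (K : Type u) [Field K] (T U : Finset Letter) : K :=
  (-1 : K) ^ ((T ×ˢ U).filter fun z => z.2 < z.1).card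

/-- The sign that occurs when the letter `a` is moved to its place in front of `S`. -/
def letterSign (K : Type u) [Field K] (a : Letter) (S : Finset Letter) : K :=
  (-1 : K) ^ (S.filter (· < a)).card

/-- The sign `(-1)^{|S|}`. -/
def cardSign (K : Type u) [Field K] (S : Finset Letter) : K := (-1 : K) ^ S.card

theorem crossSign_union_left {T T' U : Finset Letter} (h : Disjoint T T') :
    crossSign K (T ∪ T') U = crossSign K T U * crossSign K T' U := by
  unfold crossSign
  rw [← pow_add, Finset.union_product, Finset.filter_union, Finset.card_union_of_disjoint]
  exact Finset.disjoint_filter_filter (Finset.disjoint_product.2 (Or.inl h))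

theorem crossSign_union_right {T U U' : Finset Letter} (h : Disjoint U U') :
    crossSign K T (U ∪ U') = crossSign K T U * crossSign K T U' := by
  unfold crossSign
  rw [← pow_add, Finset.product_union, Finset.filter_union, Finset.card_union_of_disjoint]
  exact Finset.disjoint_filter_filter (Finset.disjoint_product.2 (Or.inr h))

theorem crossSign_singleton_left (a : Letter) (U : Finset Letter) :
    crossSign K {a} U = letterSign K a U := by
  unfold crossSign letterSign
  congr 1
  rw [Finset.singleton_product, Finset.filter_map, Finset.card_map]
  rfl

/-- The inversions are the elements of `T` above `a`: all of them, less those below. -/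
theorem crossSign_singleton_right (a : Letter) {T : Finset Letter} (h : a ∉ T) :
    crossSign K T {a} = cardSign K T * letterSign K a T := by
  unfold crossSign letterSign cardSign
  rw [Finset.product_singleton, Finset.filter_map, Finset.card_map, ← pow_add,
    ← Finset.card_filter_add_card_filter_not (s := T) (· < a)]
  have : T.filter ((fun z : Letter × Letter => z.2 < z.1) ∘
      ((⟨fun b => (b, a), Prod.mk_left_injective a⟩ : Letter ↪ Letter × Letter))) =
      T.filter (¬ · < a) := by
    refine Finset.filter_congr fun b hb => ?_
    simp only [Function.comp_apply, Function.Embedding.coeFn_mk, not_lt]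
    exact ⟨le_of_lt, fun hle => lt_of_le_of_ne hle fun he => h (he ▸ hb)⟩
  rw [this]
  generalize (T.filter (· < a)).card = m
  rw [show m + (T.filter (¬ · < a)).card + m = 2 * m + (T.filter (¬ · < a)).card by ring, pow_add,
    pow_mul]
  simp

/-- Each pair of letters is an inversion in exactly one of the two orders, so together there are
`|T| · |U|` of them. -/
theorem crossSign_mul_swap {T U : Finset Letter} (h : Disjoint T U) :
    crossSign K T U * crossSign K U T = (-1) ^ (T.card * U.card) := by
  unfold crossSign
  rw [← pow_add, ← Finset.card_product,
    ← Finset.card_filter_add_card_filter_not (s := T ×ˢ U) fun z => z.2 < z.1]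
  congr 2
  refine Finset.card_bij (fun z _ => (z.2, z.1)) ?_ ?_ ?_
  · rintro ⟨u, t⟩ hz
    simp only [Finset.mem_filter, Finset.mem_product, not_lt] at hz ⊢
    exact ⟨⟨hz.1.2, hz.1.1⟩, hz.2.le⟩
  · rintro ⟨u, t⟩ _ ⟨u', t'⟩ _ he
    simp only [Prod.mk.injEq] at he ⊢
    exact ⟨he.2, he.1⟩
  · rintro ⟨t, u⟩ hz
    simp only [Finset.mem_filter, Finset.mem_product, not_lt] at hz
    refine ⟨(u, t), ?_, rfl⟩
    simp only [Finset.mem_filter, Finset.mem_product]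
    exact ⟨⟨hz.1.2, hz.1.1⟩, lt_of_le_of_ne hz.2 fun he =>
      Finset.disjoint_left.1 h hz.1.1 (he ▸ hz.1.2)⟩

theorem neg_one_pow_mul_self (n : ℕ) : (-1 : K) ^ n * (-1) ^ n = 1 := by
  rw [← pow_add, ← two_mul, pow_mul]; simp

theorem crossSign_mul_self (T U : Finset Letter) : crossSign K T U * crossSign K T U = 1 :=
  neg_one_pow_mul_self _

theorem letterSign_mul_self (a : Letter) (U : Finset Letter) :
    letterSign K a U * letterSign K a U = 1 :=
  neg_one_pow_mul_self _

theorem cardSign_mul_self (U : Finset Letter) : cardSign K U * cardSign K U = 1 :=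
  neg_one_pow_mul_self _

theorem cardSign_union {T U : Finset Letter} (h : Disjoint T U) :
    cardSign K (T ∪ U) = cardSign K T * cardSign K U := by
  unfold cardSign
  rw [Finset.card_union_of_disjoint h, pow_add]

theorem cardSign_insert {a : Letter} {U : Finset Letter} (h : a ∉ U) :
    cardSign K (insert a U) = -cardSign K U := by
  unfold cardSign
  rw [Finset.card_insert_of_notMem h, pow_succ]; ring

theorem letterSign_union (a : Letter) {T U : Finset Letter} (h : Disjoint T U) :
    letterSign K a (T ∪ U) = letterSign K a T * letterSign K a U := by
  rw [← crossSign_singleton_left, crossSign_union_right h, crossSign_singleton_left,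
    crossSign_singleton_left]

theorem letterSign_insert (a : Letter) {b : Letter} {U : Finset Letter} (h : b ∉ U) :
    letterSign K a (insert b U) = if b < a then -letterSign K a U else letterSign K a U := by
  unfold letterSign
  rw [Finset.filter_insert]
  split_ifs
  · rw [Finset.card_insert_of_notMem (by simp [h]), pow_succ]; ring
  · rfl

theorem crossSign_insert_left {a : Letter} {T U : Finset Letter} (h : a ∉ T) :
    crossSign K (insert a T) U = letterSign K a U * crossSign K T U := by
  rw [Finset.insert_eq, crossSign_union_left (Finset.disjoint_singleton_left.2 h),
    crossSign_singleton_left]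

theorem crossSign_insert_right {a : Letter} {T U : Finset Letter} (hU : a ∉ U) (hT : a ∉ T) :
    crossSign K T (insert a U) = cardSign K T * letterSign K a T * crossSign K T U := by
  rw [Finset.insert_eq, crossSign_union_right (Finset.disjoint_singleton_left.2 hU),
    crossSign_singleton_right a hT]

/-! #### Bilinearity -/

theorem gmul_apply (f g : Series K) (S : Finset Letter) :
    (f ⋆ g) S = ∑ T ∈ S.powerset, crossSign K T (S \ T) * (f T * g (S \ T)) := rfl

theorem pderivG_of_mem {a : Letter} {S : Finset Letter} (h : a ∈ S) (f : Series K) :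
    pderivG a f S = 0 := if_pos h

theorem pderivG_of_notMem {a : Letter} {S : Finset Letter} (h : a ∉ S) (f : Series K) :
    pderivG a f S = letterSign K a S * f (insert a S) := if_neg h

theorem signG_apply (f : Series K) (S : Finset Letter) : signG f S = cardSign K S * f S := rfl

/-- The product as a bilinear map. -/
def gmulLin : Series K →ₗ[K] Series K →ₗ[K] Series K :=
  LinearMap.mk₂ K gmul
    (by
      intro f f' g
      funext S
      simp only [gmul_apply, Pi.add_apply, add_mul, mul_add, Finset.sum_add_distrib])
    (by
      intro c f g
      funext S
      simp only [gmul_apply, Pi.smul_apply, smul_eq_mul, Finset.mul_sum]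
      exact Finset.sum_congr rfl fun _ _ => by ring)
    (by
      intro f g g'
      funext S
      simp only [gmul_apply, Pi.add_apply, mul_add, Finset.sum_add_distrib])
    (by
      intro c f g
      funext S
      simp only [gmul_apply, Pi.smul_apply, smul_eq_mul, Finset.mul_sum]
      exact Finset.sum_congr rfl fun _ _ => by ring)

/-- The partial derivative as a linear map. -/
def pderivLin (a : Letter) : Series K →ₗ[K] Series K where
  toFun := pderivG a
  map_add' f g := by
    funext S
    by_cases h : a ∈ S
    · simp only [Pi.add_apply, pderivG_of_mem h, add_zero]
    · simp only [Pi.add_apply, pderivG_of_notMem h, mul_add]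
  map_smul' c f := by
    funext S
    by_cases h : a ∈ S
    · simp only [Pi.smul_apply, pderivG_of_mem h, smul_zero]
    · simp only [Pi.smul_apply, pderivG_of_notMem h, smul_eq_mul, RingHom.id_apply]; ring

/-- The parity automorphism as a linear map. -/
def signLin : Series K →ₗ[K] Series K where
  toFun := signG
  map_add' f g := by
    funext S
    simp only [Pi.add_apply, signG_apply, mul_add]
  map_smul' c f := by
    funext S
    simp only [Pi.smul_apply, signG_apply, smul_eq_mul, RingHom.id_apply]; ring

theorem gmul_add (f g h : Series K) : f ⋆ (g + h) = f ⋆ g + f ⋆ h := (gmulLin f).map_add g h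

theorem add_gmul (f g h : Series K) : (f + g) ⋆ h = f ⋆ h + g ⋆ h := gmulLin.map_add₂ f g h

theorem gmul_neg (f g : Series K) : f ⋆ (-g) = -(f ⋆ g) := (gmulLin f).map_neg g

theorem neg_gmul (f g : Series K) : (-f) ⋆ g = -(f ⋆ g) := gmulLin.map_neg₂ f g

theorem gmul_sub (f g h : Series K) : f ⋆ (g - h) = f ⋆ g - f ⋆ h := (gmulLin f).map_sub g h

theorem sub_gmul (f g h : Series K) : (f - g) ⋆ h = f ⋆ h - g ⋆ h := gmulLin.map_sub₂ f g h

theorem gmul_zero (f : Series K) : f ⋆ 0 = 0 := (gmulLin f).map_zero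

theorem zero_gmul (f : Series K) : 0 ⋆ f = 0 := gmulLin.map_zero₂ f

theorem gmul_smul (c : K) (f g : Series K) : f ⋆ (c • g) = c • (f ⋆ g) := (gmulLin f).map_smul c g

theorem smul_gmul (c : K) (f g : Series K) : (c • f) ⋆ g = c • (f ⋆ g) := gmulLin.map_smul₂ c f g

theorem gmul_sum {ι : Type*} (s : Finset ι) (f : Series K) (g : ι → Series K) :
    f ⋆ (∑ i ∈ s, g i) = ∑ i ∈ s, f ⋆ g i := map_sum (gmulLin f) g s

theorem pderivG_add (a : Letter) (f g : Series K) :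
    pderivG a (f + g) = pderivG a f + pderivG a g := (pderivLin a).map_add f g

theorem pderivG_neg (a : Letter) (f : Series K) : pderivG a (-f) = -pderivG a f :=
  (pderivLin a).map_neg f

theorem pderivG_smul (a : Letter) (c : K) (f : Series K) :
    pderivG a (c • f) = c • pderivG a f := (pderivLin a).map_smul c f

theorem pderivG_sum {ι : Type*} (s : Finset ι) (a : Letter) (g : ι → Series K) :
    pderivG a (∑ i ∈ s, g i) = ∑ i ∈ s, pderivG a (g i) := map_sum (pderivLin a) g s

theorem signG_neg (f : Series K) : signG (-f) = -signG f := signLin.map_neg f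

theorem signG_signG (f : Series K) : signG (signG f) = f := by
  funext S
  rw [signG_apply, signG_apply, ← mul_assoc, cardSign_mul_self, one_mul]

/-! #### Associativity, unit and derivations -/

theorem gmul_assoc (f g h : Series K) : f ⋆ g ⋆ h = f ⋆ (g ⋆ h) := by
  funext S
  simp only [gmul_apply, Finset.mul_sum, Finset.sum_mul]
  rw [Finset.sum_sigma', Finset.sum_sigma']
  -- Both sides run over the ordered partitions of `S` into three blocks, encoded by nested subsets
  -- on the left and by successive complements on the right; multiplicativity of `crossSign` matches
  -- the signs.
  refine Finset.sum_bij' (fun z _ => ⟨z.2, z.1 \ z.2⟩) (fun z _ => ⟨z.1 ∪ z.2, z.1⟩) ?_ ?_ ?_ ?_ ?_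
  · rintro ⟨T, U⟩ hz
    simp only [Finset.mem_sigma, Finset.mem_powerset] at hz ⊢
    exact ⟨hz.2.trans hz.1, Finset.sdiff_subset_sdiff hz.1 le_rfl⟩
  · rintro ⟨A, B⟩ hz
    simp only [Finset.mem_sigma, Finset.mem_powerset] at hz ⊢
    exact ⟨Finset.union_subset hz.1 (hz.2.trans Finset.sdiff_subset), Finset.subset_union_left⟩
  · rintro ⟨T, U⟩ hz
    simp only [Finset.mem_sigma, Finset.mem_powerset] at hz
    simp only [Finset.union_sdiff_of_subset hz.2]
  · rintro ⟨A, B⟩ hz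
    simp only [Finset.mem_sigma, Finset.mem_powerset] at hz
    have hd : Disjoint A B := (Finset.disjoint_sdiff (s := A) (t := S)).mono_right hz.2
    simp only [Finset.union_sdiff_cancel_left hd]
  · rintro ⟨T, U⟩ hz
    simp only [Finset.mem_sigma, Finset.mem_powerset] at hz
    obtain ⟨hT, hU⟩ := hz
    have e1 : S \ U = (T \ U) ∪ (S \ T) := by
      rw [Finset.union_comm, Finset.sdiff_union_sdiff_cancel hT hU]
    have e2 : (S \ U) \ (T \ U) = S \ T := by
      ext b
      simp only [Finset.mem_sdiff]
      constructor
      · rintro ⟨⟨h1, h2⟩, h3⟩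
        exact ⟨h1, fun h4 => h3 ⟨h4, h2⟩⟩
      · rintro ⟨h1, h2⟩
        exact ⟨⟨h1, fun h3 => h2 (hU h3)⟩, fun h3 => h2 h3.1⟩
    have hd : Disjoint (T \ U) (S \ T) :=
      (Finset.disjoint_sdiff (s := T) (t := S)).mono_left Finset.sdiff_subset
    have e3 : crossSign K T (S \ T) = crossSign K U (S \ T) * crossSign K (T \ U) (S \ T) := by
      rw [← crossSign_union_left Finset.disjoint_sdiff, Finset.union_sdiff_of_subset hU]
    have e4 : crossSign K U (S \ U) = crossSign K U (T \ U) * crossSign K U (S \ T) := by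
      rw [e1, crossSign_union_right hd]
    dsimp only
    rw [e2, e3, e4]
    ring

theorem signG_gmul (f g : Series K) : signG (f ⋆ g) = signG f ⋆ signG g := by
  funext S
  rw [signG_apply, gmul_apply, gmul_apply, Finset.mul_sum]
  refine Finset.sum_congr rfl fun T hT => ?_
  have e : cardSign K S = cardSign K T * cardSign K (S \ T) := by
    rw [← cardSign_union Finset.disjoint_sdiff,
      Finset.union_sdiff_of_subset (Finset.mem_powerset.1 hT)]
  rw [signG_apply, signG_apply, e]
  ring

theorem pderivG_signG (a : Letter) (f : Series K) :
    pderivG a (signG f) = -signG (pderivG a f) := by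
  funext S
  rw [Pi.neg_apply, signG_apply]
  by_cases h : a ∈ S
  · rw [pderivG_of_mem h, pderivG_of_mem h, mul_zero, neg_zero]
  · rw [pderivG_of_notMem h, pderivG_of_notMem h, signG_apply, cardSign_insert h]
    ring

theorem pderivG_pderivG (a b : Letter) (f : Series K) :
    pderivG a (pderivG b f) = -pderivG b (pderivG a f) := by
  funext S
  rw [Pi.neg_apply]
  rcases eq_or_ne a b with rfl | hab
  · by_cases h : a ∈ S
    · rw [pderivG_of_mem h, neg_zero]
    · rw [pderivG_of_notMem h, pderivG_of_mem (Finset.mem_insert_self _ _), mul_zero, neg_zero]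
  · by_cases ha : a ∈ S
    · rw [pderivG_of_mem ha]
      by_cases hb : b ∈ S
      · rw [pderivG_of_mem hb, neg_zero]
      · rw [pderivG_of_notMem hb, pderivG_of_mem (Finset.mem_insert_of_mem ha), mul_zero, neg_zero]
    · rw [pderivG_of_notMem ha]
      by_cases hb : b ∈ S
      · rw [pderivG_of_mem (Finset.mem_insert_of_mem hb), pderivG_of_mem hb, mul_zero, neg_zero]
      · rw [pderivG_of_notMem (by simp [hab.symm, hb]), pderivG_of_notMem hb,
          pderivG_of_notMem (by simp [hab, ha]), letterSign_insert b ha, letterSign_insert a hb,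
          Finset.insert_comm a b]
        rcases lt_or_gt_of_ne hab with h | h
        · rw [if_pos h, if_neg h.not_gt]; ring
        · rw [if_neg h.not_gt, if_pos h]; ring

theorem insert_sdiff_insert_of_notMem {a : Letter} {S T : Finset Letter} (h : a ∉ S) :
    insert a S \ insert a T = S \ T := by
  ext b
  simp only [Finset.mem_sdiff, Finset.mem_insert]
  constructor
  · rintro ⟨rfl | h1, h2⟩
    · exact absurd (Or.inl rfl) h2
    · exact ⟨h1, fun h3 => h2 (Or.inr h3)⟩
  · rintro ⟨h1, h2⟩
    refine ⟨Or.inr h1, ?_⟩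
    rintro (rfl | h3)
    · exact h h1
    · exact h2 h3

theorem pderivG_gmul (a : Letter) (f g : Series K) :
    pderivG a (f ⋆ g) = pderivG a f ⋆ g + signG f ⋆ pderivG a g := by
  funext S
  rw [Pi.add_apply]
  by_cases h : a ∈ S
  -- The coefficient on the left is zero. On the right `a` would have to be shared by both factors,
  -- and the terms for `T` and `insert a T` cancel.
  · rw [pderivG_of_mem h]
    obtain ⟨R, hR, rfl⟩ : ∃ R, a ∉ R ∧ S = insert a R :=
      ⟨S.erase a, Finset.notMem_erase _ _, (Finset.insert_erase h).symm⟩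
    rw [gmul_apply, gmul_apply, Finset.sum_powerset_insert hR, Finset.sum_powerset_insert hR,
      ← Finset.sum_add_distrib, ← Finset.sum_add_distrib, ← Finset.sum_add_distrib]
    refine (Finset.sum_eq_zero fun T hT => ?_).symm
    have haT : a ∉ T := fun h => hR (Finset.mem_powerset.1 hT h)
    have haU : a ∉ R \ T := fun h => hR (Finset.sdiff_subset h)
    rw [Finset.insert_sdiff_of_notMem _ haT, insert_sdiff_insert_of_notMem hR,
      pderivG_of_mem (Finset.mem_insert_self a T), pderivG_of_notMem haT,
      pderivG_of_mem (Finset.mem_insert_self a _), pderivG_of_notMem haU,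
      crossSign_insert_left haT, crossSign_insert_right haU haT, signG_apply,
      signG_apply, cardSign_insert haT]
    have h1 := letterSign_mul_self (K := K) a T
    have h2 := letterSign_mul_self (K := K) a (R \ T)
    linear_combination (crossSign K T (R \ T) * cardSign K T * f (insert a T) *
      g (insert a (R \ T))) * (h1 - h2)
  · rw [pderivG_of_notMem h, gmul_apply, gmul_apply, gmul_apply, Finset.sum_powerset_insert h,
      ← Finset.sum_add_distrib, ← Finset.sum_add_distrib, Finset.mul_sum]
    refine Finset.sum_congr rfl fun T hT => ?_
    have haT : a ∉ T := fun h' => h (Finset.mem_powerset.1 hT h')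
    have haU : a ∉ S \ T := fun h' => h (Finset.sdiff_subset h')
    rw [Finset.insert_sdiff_of_notMem _ haT, insert_sdiff_insert_of_notMem h,
      pderivG_of_notMem haT, pderivG_of_notMem haU, crossSign_insert_left haT,
      crossSign_insert_right haU haT, signG_apply]
    have h1 := letterSign_mul_self (K := K) a T
    have h2 := letterSign_mul_self (K := K) a (S \ T)
    have h3 : letterSign K a S = letterSign K a T * letterSign K a (S \ T) := by
      rw [← letterSign_union a Finset.disjoint_sdiff,
        Finset.union_sdiff_of_subset (Finset.mem_powerset.1 hT)]
    rw [h3]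
    linear_combination (cardSign K T * crossSign K T (S \ T) * f T * letterSign K a (S \ T) *
      g (insert a (S \ T))) * h1 + (letterSign K a T * crossSign K T (S \ T) *
      f (insert a T) * g (S \ T)) * h2

theorem unit_gmul (f : Series K) : unitG K ⋆ f = f := by
  funext S
  rw [gmul_apply, Finset.sum_eq_single ∅]
  · simp [crossSign, unitG]
  · intro T _ hT
    simp [unitG, hT]
  · simp

theorem gmul_unit (f : Series K) : f ⋆ unitG K = f := by
  funext S
  rw [gmul_apply, Finset.sum_eq_single S]
  · simp [crossSign, unitG]
  · intro T hT hne
    have : S \ T ≠ ∅ := fun h =>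
      hne (Finset.Subset.antisymm (Finset.mem_powerset.1 hT) (Finset.sdiff_eq_empty_iff_subset.1 h))
    simp [unitG, this]
  · simp

theorem signG_unit : signG (unitG K) = unitG K := by
  funext S
  rw [signG_apply]
  by_cases h : S = ∅
  · simp [h, cardSign]
  · simp [unitG, h]

theorem pderivG_unit (a : Letter) : pderivG a (unitG K) = 0 := by
  funext S
  by_cases h : a ∈ S
  · rw [pderivG_of_mem h]; rfl
  · rw [pderivG_of_notMem h]
    simp [unitG]

/-! #### Supports and parity -/

variable (K) in
/-- The formal sums of monomials whose sets of letters satisfy `P`. -/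
def seriesSupported (P : Finset Letter → Prop) : Submodule K (Series K) where
  carrier := {f | ∀ S, f S ≠ 0 → P S}
  add_mem' := by
    intro f g hf hg S h
    by_cases h0 : f S = 0
    · refine hg S fun h1 => h ?_
      rw [Pi.add_apply, h0, h1, add_zero]
    · exact hf S h0
  zero_mem' := by intro S h; exact absurd rfl h
  smul_mem' := by
    intro c f hf S h
    refine hf S fun h1 => h ?_
    rw [Pi.smul_apply, h1, smul_zero]

theorem seriesSupported_mono {P Q : Finset Letter → Prop} (h : ∀ S, P S → Q S) :
    seriesSupported K P ≤ seriesSupported K Q :=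
  fun _ hf S hS => h S (hf S hS)

theorem seriesSupported_inf {P Q : Finset Letter → Prop} (h : ∀ S, P S → ¬ Q S) :
    seriesSupported K P ⊓ seriesSupported K Q = ⊥ := by
  rw [eq_bot_iff]
  rintro f ⟨h1, h2⟩
  funext S
  by_contra hne
  exact h S (h1 S hne) (h2 S hne)

theorem gmul_mem_seriesSupported {P Q R : Finset Letter → Prop} {f g : Series K}
    (hf : f ∈ seriesSupported K P) (hg : g ∈ seriesSupported K Q)
    (h : ∀ T U, Disjoint T U → P T → Q U → R (T ∪ U)) : f ⋆ g ∈ seriesSupported K R := by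
  intro S hne
  obtain ⟨T, hT, h1, h2⟩ := exists_of_gmul_ne_zero hne
  have := h T (S \ T) Finset.disjoint_sdiff (hf T h1) (hg _ h2)
  rwa [Finset.union_sdiff_of_subset hT] at this

theorem pderivG_mem_seriesSupported {P R : Finset Letter → Prop} {a : Letter} {f : Series K}
    (hf : f ∈ seriesSupported K P) (h : ∀ S, a ∉ S → P (insert a S) → R S) :
    pderivG a f ∈ seriesSupported K R := by
  intro S hne
  obtain ⟨h1, h2⟩ := of_pderivG_ne_zero hne
  exact h S h1 (hf _ h2)

theorem signG_mem_seriesSupported {P : Finset Letter → Prop} {f : Series K}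
    (hf : f ∈ seriesSupported K P) : signG f ∈ seriesSupported K P := by
  intro S hne
  exact hf S fun h0 => hne (by rw [signG_apply, h0, mul_zero])

theorem seriesParity_eq (r : ℕ) :
    seriesParity K r = seriesSupported K fun S => S.card % 2 = r := by
  ext f
  constructor
  · intro hf S hS
    by_contra h
    exact hS (hf S h)
  · intro hf S hS
    by_contra h
    exact hS (hf S h)

theorem gmul_mem_seriesParity {r s t : ℕ} {f g : Series K} (hf : f ∈ seriesParity K r)
    (hg : g ∈ seriesParity K s) (h : (r + s) % 2 = t) : f ⋆ g ∈ seriesParity K t := by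
  rw [seriesParity_eq] at *
  refine gmul_mem_seriesSupported hf hg fun T U hd hT hU => ?_
  rw [Finset.card_union_of_disjoint hd, Nat.add_mod, hT, hU, ← h]

theorem pderivG_mem_seriesParity {r t : ℕ} {a : Letter} {f : Series K}
    (hf : f ∈ seriesParity K r) (ht : t < 2) (h : (t + 1) % 2 = r) :
    pderivG a f ∈ seriesParity K t := by
  rw [seriesParity_eq] at *
  refine pderivG_mem_seriesSupported hf fun S ha hS => ?_
  rw [Finset.card_insert_of_notMem ha] at hS
  omega

theorem signG_mem_seriesParity {r : ℕ} {f : Series K} (hf : f ∈ seriesParity K r) :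
    signG f ∈ seriesParity K r := by
  rw [seriesParity_eq] at *
  exact signG_mem_seriesSupported hf

theorem signG_of_even {f : Series K} (hf : f ∈ seriesParity K 0) : signG f = f := by
  funext S
  rw [signG_apply]
  by_cases h : S.card % 2 = 0
  · rw [cardSign, (Nat.even_iff.2 h).neg_one_pow, one_mul]
  · rw [hf S h, mul_zero]

theorem signG_of_odd {f : Series K} (hf : f ∈ seriesParity K 1) : signG f = -f := by
  funext S
  rw [signG_apply, Pi.neg_apply]
  by_cases h : S.card % 2 = 1
  · rw [cardSign, (Nat.odd_iff.2 h).neg_one_pow, neg_one_mul]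
  · rw [hf S h, mul_zero, neg_zero]

theorem seriesParity_inf : seriesParity K 0 ⊓ seriesParity K 1 = ⊥ := by
  rw [seriesParity_eq, seriesParity_eq]
  exact seriesSupported_inf fun S h0 h1 => by omega

/-- Exchange `T` with its complement; the resulting sign `(-1)^{|T||S \ T|}` is trivial for even
`T`. -/
theorem gmul_comm_of_even {f : Series K} (hf : f ∈ seriesParity K 0) (g : Series K) :
    f ⋆ g = g ⋆ f := by
  funext S
  rw [gmul_apply, gmul_apply]
  refine Finset.sum_bij' (fun T _ => S \ T) (fun T _ => S \ T) ?_ ?_ ?_ ?_ ?_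
  · intro T _
    exact Finset.mem_powerset.2 Finset.sdiff_subset
  · intro T _
    exact Finset.mem_powerset.2 Finset.sdiff_subset
  · intro T hT
    exact Finset.sdiff_sdiff_eq_self (Finset.mem_powerset.1 hT)
  · intro T hT
    exact Finset.sdiff_sdiff_eq_self (Finset.mem_powerset.1 hT)
  · intro T hT
    rw [Finset.sdiff_sdiff_eq_self (Finset.mem_powerset.1 hT)]
    by_cases h : T.card % 2 = 0
    · have h1 := crossSign_mul_swap (K := K) (Finset.disjoint_sdiff (s := T) (t := S))
      rw [((Nat.even_iff.2 h).mul_right _).neg_one_pow] at h1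
      have h2 := crossSign_mul_self (K := K) (S \ T) T
      have h3 : crossSign K T (S \ T) = crossSign K (S \ T) T := by
        linear_combination crossSign K (S \ T) T * h1 - crossSign K T (S \ T) * h2
      rw [h3]; ring
    · rw [hf T h]; ring

/-! #### Letters -/

/-- A letter as a formal sum. -/
def letterG (K : Type u) [Field K] (a : Letter) : Series K := Pi.single {a} 1

theorem letterG_mem_seriesParity (a : Letter) : letterG K a ∈ seriesParity K 1 := by
  intro S hS
  refine Pi.single_eq_of_ne ?_ _
  rintro rfl
  simp at hS

theorem letter_gmul_apply (a : Letter) (f : Series K) (S : Finset Letter) :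
    (letterG K a ⋆ f) S = if a ∈ S then letterSign K a (S.erase a) * f (S.erase a) else 0 := by
  rw [gmul_apply]
  split_ifs with h
  · rw [Finset.sum_eq_single {a}]
    · rw [letterG, Pi.single_eq_same, one_mul, crossSign_singleton_left,
        Finset.sdiff_singleton_eq_erase]
    · intro T _ hT
      rw [letterG, Pi.single_eq_of_ne hT, zero_mul, mul_zero]
    · intro h'
      exact absurd (Finset.mem_powerset.2 (Finset.singleton_subset_iff.2 h)) h'
  · refine Finset.sum_eq_zero fun T hT => ?_
    have : T ≠ {a} := by
      rintro rfl
      exact h (Finset.singleton_subset_iff.1 (Finset.mem_powerset.1 hT))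
    rw [letterG, Pi.single_eq_of_ne this, zero_mul, mul_zero]

theorem gmul_letter (f : Series K) (a : Letter) : f ⋆ letterG K a = letterG K a ⋆ signG f := by
  funext S
  rw [letter_gmul_apply, gmul_apply]
  split_ifs with h
  · rw [Finset.sum_eq_single (S.erase a)]
    · have : S \ S.erase a = {a} := by
        rw [Finset.sdiff_erase_self h]
      rw [this, letterG, Pi.single_eq_same, mul_one,
        crossSign_singleton_right a (Finset.notMem_erase a S), signG_apply]
      ring
    · intro T hT hne
      have : S \ T ≠ {a} := by
        intro he
        apply hne
        rw [← Finset.sdiff_sdiff_eq_self (Finset.mem_powerset.1 hT), he,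
          Finset.sdiff_singleton_eq_erase]
      rw [letterG, Pi.single_eq_of_ne this, mul_zero, mul_zero]
    · intro h'
      exact absurd (Finset.mem_powerset.2 (Finset.erase_subset _ _)) h'
  · refine Finset.sum_eq_zero fun T hT => ?_
    have : S \ T ≠ {a} := by
      intro he
      exact h (Finset.sdiff_subset (he ▸ Finset.mem_singleton_self a : a ∈ S \ T))
    rw [letterG, Pi.single_eq_of_ne this, mul_zero, mul_zero]

theorem letter_gmul_letter_gmul (a : Letter) (f : Series K) :
    letterG K a ⋆ (letterG K a ⋆ f) = 0 := by
  funext S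
  rw [letter_gmul_apply]
  split_ifs
  · rw [letter_gmul_apply, if_neg (Finset.notMem_erase a S), mul_zero]; rfl
  · rfl

theorem pderivG_letter (a b : Letter) :
    pderivG b (letterG K a) = if b = a then unitG K else 0 := by
  funext S
  by_cases h : b ∈ S
  · rw [pderivG_of_mem h]
    split_ifs
    · have : S ≠ ∅ := Finset.ne_empty_of_mem h
      simp [unitG, this]
    · rfl
  · rw [pderivG_of_notMem h, letterG]
    by_cases hS : insert b S = {a}
    · have hb : b = a := by
        have := Finset.mem_insert_self b S
        rwa [hS, Finset.mem_singleton] at this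
      subst hb
      have hS' : S = ∅ := by
        rw [← Finset.erase_insert h, hS, Finset.erase_singleton]
      rw [hS, if_pos rfl, hS']
      simp [unitG, letterSign]
    · rw [Pi.single_eq_of_ne hS, mul_zero]
      split_ifs with hb
      · have : S ≠ ∅ := by
          rintro rfl
          exact hS (by rw [hb]; rfl)
        simp [unitG, this]
      · rfl

theorem signG_letter (a : Letter) : signG (letterG K a) = -letterG K a :=
  signG_of_odd (letterG_mem_seriesParity a)

theorem pderivG_letter_gmul (a b : Letter) (f : Series K) :
    pderivG b (letterG K a ⋆ f) = (if b = a then f else 0) - letterG K a ⋆ pderivG b f := by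
  rw [pderivG_gmul, pderivG_letter, signG_letter, neg_gmul, ← sub_eq_add_neg]
  congr 1
  split_ifs
  · rw [unit_gmul]
  · rw [zero_gmul]

end Series

section Poisson

variable {K : Type u} [Field K]

local infixl:70 " ⋆ " => gmul

/-! #### Brackets with finitely many terms -/

/-- The `i`-th term of the bracket as a bilinear map. -/
def bracketTermLin (i : ℕ) : Series K →ₗ[K] Series K →ₗ[K] Series K :=
  -(gmulLin.compl₁₂ ((pderivLin (lx i)).comp signLin) (pderivLin (ly i)) +
    gmulLin.compl₁₂ ((pderivLin (ly i)).comp signLin) (pderivLin (lx i)))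

theorem bracketTermLin_apply (i : ℕ) (f g : Series K) :
    bracketTermLin i f g = bracketTerm f g i := rfl

/-- The bracket with respect to the letters `x_i`, `y_i` with `i < M`. -/
def truncBracket (M : ℕ) (f g : Series K) : Series K := ∑ i ∈ Finset.range M, bracketTerm f g i

/-- The `i`-th term of the formal square. -/
def squareTerm (f : Series K) (i : ℕ) : Series K := pderivG (lx i) f ⋆ pderivG (ly i) f

/-- The formal square with respect to the letters `x_i`, `y_i` with `i < M`. -/
def truncSquare (M : ℕ) (f : Series K) : Series K := ∑ i ∈ Finset.range M, squareTerm f i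

variable (K) in
/-- The Poisson superalgebra of formal sums with the bracket of the letters with numbers below
`M`. -/
def truncData (M : ℕ) : SuperData K (Series K) where
  even := seriesParity K 0
  odd := seriesParity K 1
  ops := {gmul, truncBracket M}
  sqs := {truncSquare M}

theorem bracketTerm_mem_seriesSupported {P Q R : Finset Letter → Prop} {f g : Series K} {i : ℕ}
    (hf : f ∈ seriesSupported K P) (hg : g ∈ seriesSupported K Q)
    (h : ∀ T U, Disjoint T U → lx i ∉ T → ly i ∉ U → P (insert (lx i) T) →
      Q (insert (ly i) U) → R (T ∪ U))
    (h' : ∀ T U, Disjoint T U → ly i ∉ T → lx i ∉ U → P (insert (ly i) T) →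
      Q (insert (lx i) U) → R (T ∪ U)) :
    bracketTerm f g i ∈ seriesSupported K R := by
  have hp : ∀ (a : Letter) (P : Finset Letter → Prop), ∀ f ∈ seriesSupported K P,
      pderivG a f ∈ seriesSupported K fun S => a ∉ S ∧ P (insert a S) := fun a P f hf =>
    pderivG_mem_seriesSupported hf fun S h1 h2 => ⟨h1, h2⟩
  have hs := signG_mem_seriesSupported hf
  refine Submodule.neg_mem _ (Submodule.add_mem _ ?_ ?_)
  · exact gmul_mem_seriesSupported (hp _ _ _ hs) (hp _ _ _ hg)
      fun T U hd hT hU => h T U hd hT.1 hU.1 hT.2 hU.2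
  · exact gmul_mem_seriesSupported (hp _ _ _ hs) (hp _ _ _ hg)
      fun T U hd hT hU => h' T U hd hT.1 hU.1 hT.2 hU.2

theorem squareTerm_mem_seriesSupported {P R : Finset Letter → Prop} {f : Series K} {i : ℕ}
    (hf : f ∈ seriesSupported K P)
    (h : ∀ T U, Disjoint T U → lx i ∉ T → ly i ∉ U → P (insert (lx i) T) →
      P (insert (ly i) U) → R (T ∪ U)) :
    squareTerm f i ∈ seriesSupported K R := by
  have hp : ∀ a : Letter,
      pderivG a f ∈ seriesSupported K fun S => a ∉ S ∧ P (insert a S) := fun a =>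
    pderivG_mem_seriesSupported hf fun S h1 h2 => ⟨h1, h2⟩
  exact gmul_mem_seriesSupported (hp _) (hp _)
      fun T U hd hT hU => h T U hd hT.1 hU.1 hT.2 hU.2

/-- The number of summands may depend on the coefficient, since supports are controlled term by
term. -/
theorem mem_seriesSupported_of_terms {R : Finset Letter → Prop} {t : ℕ → Series K}
    (h : ∀ i, t i ∈ seriesSupported K R) (N : Finset Letter → ℕ) :
    (fun S => ∑ i ∈ Finset.range (N S), t i S) ∈ seriesSupported K R := by
  intro S hne
  obtain ⟨i, -, hi⟩ := Finset.exists_ne_zero_of_sum_ne_zero hne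
  exact h i S hi

theorem pbracket_mem_seriesSupported {R : Finset Letter → Prop} {f g : Series K}
    (h : ∀ i, bracketTerm f g i ∈ seriesSupported K R) : pbracket f g ∈ seriesSupported K R :=
  mem_seriesSupported_of_terms h _

theorem psquare_mem_seriesSupported {R : Finset Letter → Prop} {f : Series K}
    (h : ∀ i, squareTerm f i ∈ seriesSupported K R) : psquare f ∈ seriesSupported K R :=
  mem_seriesSupported_of_terms h _

theorem bracketTerm_mem_seriesParity {r s : ℕ} (hr : r < 2) (hs : s < 2) {f g : Series K}
    (hf : f ∈ seriesParity K r) (hg : g ∈ seriesParity K s) (i : ℕ) :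
    bracketTerm f g i ∈ seriesParity K ((r + s) % 2) := by
  have hp : ∀ (a : Letter) (r : ℕ), r < 2 → ∀ f ∈ seriesParity K r,
      pderivG a f ∈ seriesParity K ((r + 1) % 2) := fun a r hr f hf =>
    pderivG_mem_seriesParity hf (by omega) (by omega)
  have hs' := signG_mem_seriesParity hf
  refine Submodule.neg_mem _ (Submodule.add_mem _ ?_ ?_)
  · exact gmul_mem_seriesParity (hp _ _ hr _ hs') (hp _ _ hs _ hg) (by omega)
  · exact gmul_mem_seriesParity (hp _ _ hr _ hs') (hp _ _ hs _ hg) (by omega)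

theorem squareTerm_mem_seriesParity {f : Series K} (hf : f ∈ seriesParity K 1) (i : ℕ) :
    squareTerm f i ∈ seriesParity K 0 :=
  gmul_mem_seriesParity (pderivG_mem_seriesParity (t := 0) hf (by norm_num) (by norm_num))
    (pderivG_mem_seriesParity (t := 0) hf (by norm_num) (by norm_num)) (by norm_num)

theorem bracketTerm_of_odd {f : Series K} (hf : f ∈ seriesParity K 1) (g : Series K) (i : ℕ) :
    bracketTerm f g i =
      pderivG (lx i) f ⋆ pderivG (ly i) g + pderivG (lx i) g ⋆ pderivG (ly i) f := by
  have he : pderivG (ly i) f ∈ seriesParity K 0 :=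
    pderivG_mem_seriesParity hf (by norm_num) (by norm_num)
  rw [bracketTerm, signG_of_odd hf, pderivG_neg, pderivG_neg, neg_gmul, neg_gmul, ← neg_add,
    neg_neg, gmul_comm_of_even he]

theorem squareTerm_add {f g : Series K} (hf : f ∈ seriesParity K 1) (i : ℕ) :
    squareTerm (f + g) i = squareTerm f i + squareTerm g i + bracketTerm f g i := by
  rw [bracketTerm_of_odd hf]
  simp only [squareTerm, pderivG_add, gmul_add, add_gmul]
  abel

theorem squareTerm_smul (c : K) (f : Series K) (i : ℕ) :
    squareTerm (c • f) i = (c ^ 2) • squareTerm f i := by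
  simp only [squareTerm, pderivG_smul, gmul_smul, smul_gmul, smul_smul, pow_two]

theorem gmul_parity {i j : Bool} {f g : Series K} (hf : f ∈ (poissonData K).par i)
    (hg : g ∈ (poissonData K).par j) : f ⋆ g ∈ (poissonData K).par (xor i j) := by
  cases i <;> cases j <;> exact gmul_mem_seriesParity hf hg (by norm_num)

theorem bracketTerm_parity {i j : Bool} {f g : Series K} (hf : f ∈ (poissonData K).par i)
    (hg : g ∈ (poissonData K).par j) (k : ℕ) :
    bracketTerm f g k ∈ (poissonData K).par (xor i j) := by
  cases i <;> cases j <;>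
    exact bracketTerm_mem_seriesParity (by norm_num) (by norm_num) hf hg k

theorem par_eq_seriesSupported (i : Bool) :
    (poissonData K).par i = seriesSupported K fun S => S.card % 2 = i.toNat := by
  cases i
  · exact seriesParity_eq 0
  · exact seriesParity_eq 1

theorem pbracket_parity {i j : Bool} {f g : Series K} (hf : f ∈ (poissonData K).par i)
    (hg : g ∈ (poissonData K).par j) : pbracket f g ∈ (poissonData K).par (xor i j) := by
  have h := bracketTerm_parity hf hg
  rw [par_eq_seriesSupported] at h ⊢
  exact pbracket_mem_seriesSupported h

/-- The bracket as a bilinear map. -/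
def pbracketLin : Series K →ₗ[K] Series K →ₗ[K] Series K :=
  LinearMap.mk₂ K pbracket
    (by
      intro f f' g
      funext S
      simp only [pbracket, ← bracketTermLin_apply, map_add, LinearMap.add_apply, Pi.add_apply,
        Finset.sum_add_distrib])
    (by
      intro c f g
      funext S
      simp only [pbracket, ← bracketTermLin_apply, map_smul, LinearMap.smul_apply, Pi.smul_apply,
        Finset.smul_sum])
    (by
      intro f g g'
      funext S
      simp only [pbracket, ← bracketTermLin_apply, map_add, Pi.add_apply,
        Finset.sum_add_distrib])
    (by
      intro c f g
      funext S
      simp only [pbracket, ← bracketTermLin_apply, map_smul, Pi.smul_apply,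
        Finset.smul_sum])

theorem poissonData_isRegular : (poissonData K).IsRegular where
  op_bilinear := by
    rintro _ (rfl | rfl)
    · exact ⟨gmulLin, fun _ _ => rfl⟩
    · exact ⟨pbracketLin, fun _ _ => rfl⟩
  op_parity := by
    rintro _ (rfl | rfl) i j a ha b hb
    · exact gmul_parity ha hb
    · exact pbracket_parity ha hb
  sq_parity := by
    rintro _ rfl a ha
    have h := fun i => squareTerm_mem_seriesParity ha i
    change psquare a ∈ seriesParity K 0
    rw [seriesParity_eq] at h ⊢
    exact psquare_mem_seriesSupported h
  sq_smul := by
    rintro _ rfl c a -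
    funext S
    change ∑ i ∈ _, squareTerm (c • a) i S = c ^ 2 • ∑ i ∈ _, squareTerm a i S
    simp only [squareTerm_smul, Pi.smul_apply, Finset.smul_sum]
  sq_add := by
    rintro _ rfl
    refine ⟨pbracket, Or.inr rfl, fun a ha b _ => ?_⟩
    funext S
    change ∑ i ∈ _, squareTerm (a + b) i S = ∑ i ∈ _, squareTerm a i S + ∑ i ∈ _, squareTerm b i S +
      ∑ i ∈ _, bracketTerm a b i S
    simp only [squareTerm_add ha, Pi.add_apply, Finset.sum_add_distrib]
  parity_disjoint := seriesParity_inf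

theorem truncSquare_add {f g : Series K} (hf : f ∈ seriesParity K 1) (M : ℕ) :
    truncSquare M (f + g) = truncSquare M f + truncSquare M g + truncBracket M f g := by
  simp only [truncSquare, truncBracket, squareTerm_add hf, Finset.sum_add_distrib]

/-- The bracket with finitely many terms as a bilinear map. -/
def truncBracketLin (M : ℕ) : Series K →ₗ[K] Series K →ₗ[K] Series K :=
  ∑ i ∈ Finset.range M, bracketTermLin i

theorem truncBracketLin_apply (M : ℕ) (f g : Series K) :
    truncBracketLin M f g = truncBracket M f g := by
  simp only [truncBracketLin, truncBracket, LinearMap.sum_apply, bracketTermLin_apply]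

theorem truncData_isRegular (M : ℕ) : (truncData K M).IsRegular where
  op_bilinear := by
    rintro _ (rfl | rfl)
    · exact ⟨gmulLin, fun _ _ => rfl⟩
    · exact ⟨truncBracketLin M, fun _ _ => (truncBracketLin_apply _ _ _).symm⟩
  op_parity := by
    rintro _ (rfl | rfl) i j a ha b hb
    · exact gmul_parity ha hb
    · exact Submodule.sum_mem _ fun k _ => bracketTerm_parity ha hb k
  sq_parity := by
    rintro _ rfl a ha
    exact Submodule.sum_mem _ fun k _ => squareTerm_mem_seriesParity ha k
  sq_smul := by
    rintro _ rfl c a -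
    simp only [truncSquare, squareTerm_smul, Finset.smul_sum]
  sq_add := by
    rintro _ rfl
    exact ⟨truncBracket M, Or.inr rfl, fun a ha b _ => truncSquare_add ha M⟩
  parity_disjoint := seriesParity_inf

theorem truncBracket_neg_left (M : ℕ) (f g : Series K) :
    truncBracket M (-f) g = -truncBracket M f g := by
  simp only [← truncBracketLin_apply, map_neg, LinearMap.neg_apply]

theorem truncBracket_add_left (M : ℕ) (f f' g : Series K) :
    truncBracket M (f + f') g = truncBracket M f g + truncBracket M f' g := by
  simp only [← truncBracketLin_apply, map_add, LinearMap.add_apply]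

/-! #### Derivation rules for the bracket -/

/-- The letter dual to `a` with respect to the bracket. -/
def dualLetter (a : Letter) : Letter :=
  Sum.elim (fun i => ly i) (fun i => lx i) (ofLex a)

theorem letter_cases (a : Letter) : (∃ i, a = lx i) ∨ ∃ i, a = ly i := by
  rcases h : ofLex a with i | i
  · exact Or.inl ⟨i, by rw [lx, ← h]; rfl⟩
  · exact Or.inr ⟨i, by rw [ly, ← h]; rfl⟩

theorem lx_inj {i j : ℕ} : lx i = lx j ↔ i = j :=
  ⟨fun h => Sum.inl_injective (toLex.injective h), fun h => h ▸ rfl⟩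

theorem ly_inj {i j : ℕ} : ly i = ly j ↔ i = j :=
  ⟨fun h => Sum.inr_injective (toLex.injective h), fun h => h ▸ rfl⟩

theorem dualLetter_lx (i : ℕ) : dualLetter (lx i) = ly i := rfl

theorem dualLetter_ly (i : ℕ) : dualLetter (ly i) = lx i := rfl

theorem letterIndex_lx (i : ℕ) : letterIndex (lx i) = i := rfl

theorem letterIndex_ly (i : ℕ) : letterIndex (ly i) = i := rfl

theorem sum_range_ite_eq (M j : ℕ) (u : ℕ → Series K) :
    ∑ i ∈ Finset.range M, (if i = j then u i else 0) = if j < M then u j else 0 := by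
  rw [Finset.sum_ite_eq']
  simp only [Finset.mem_range]

/-- Only the term whose index is that of `a` can differentiate the letter away; from all terms the
letter also comes out in front without a net sign. -/
theorem truncBracket_letter_gmul (M : ℕ) (a : Letter) (f g : Series K) :
    truncBracket M (letterG K a ⋆ f) g =
      (if letterIndex a < M then signG f ⋆ pderivG (dualLetter a) g else 0) +
        letterG K a ⋆ truncBracket M f g := by
  rw [truncBracket, truncBracket, gmul_sum]
  rcases letter_cases a with ⟨j, rfl⟩ | ⟨j, rfl⟩
  · rw [dualLetter_lx, letterIndex_lx,
      ← sum_range_ite_eq M j fun i => signG f ⋆ pderivG (ly i) g, ← Finset.sum_add_distrib]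
    refine Finset.sum_congr rfl fun i _ => ?_
    simp only [bracketTerm, signG_gmul, signG_letter, neg_gmul, pderivG_neg, pderivG_letter_gmul,
      sub_gmul, gmul_assoc, gmul_add, gmul_neg, (lx_ne_ly j i), if_false, lx_inj, zero_gmul]
    split_ifs
    · abel
    · rw [zero_gmul]; abel
  · rw [dualLetter_ly, letterIndex_ly,
      ← sum_range_ite_eq M j fun i => signG f ⋆ pderivG (lx i) g, ← Finset.sum_add_distrib]
    refine Finset.sum_congr rfl fun i _ => ?_
    simp only [bracketTerm, signG_gmul, signG_letter, neg_gmul, pderivG_neg, pderivG_letter_gmul,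
      sub_gmul, gmul_assoc, gmul_add, gmul_neg, (lx_ne_ly i j).symm, if_false, ly_inj, zero_gmul]
    split_ifs
    · abel
    · rw [zero_gmul]; abel

theorem truncBracket_gmul_letter (M : ℕ) (a : Letter) (f g : Series K) :
    truncBracket M f (letterG K a ⋆ g) =
      letterG K a ⋆ truncBracket M (signG f) g -
        (if letterIndex a < M then pderivG (dualLetter a) (signG f) ⋆ g else 0) := by
  have move : ∀ u v : Series K, u ⋆ (letterG K a ⋆ v) = letterG K a ⋆ (signG u ⋆ v) := fun u v => by
    rw [← gmul_assoc, gmul_letter, gmul_assoc]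
  rw [truncBracket, truncBracket, gmul_sum]
  rcases letter_cases a with ⟨j, rfl⟩ | ⟨j, rfl⟩
  · rw [dualLetter_lx, letterIndex_lx,
      ← sum_range_ite_eq M j fun i => pderivG (ly i) (signG f) ⋆ g, ← Finset.sum_sub_distrib]
    refine Finset.sum_congr rfl fun i _ => ?_
    simp only [bracketTerm, pderivG_letter_gmul, gmul_sub, move, neg_gmul, gmul_add, gmul_neg, (lx_ne_ly j i), if_false,
      lx_inj, gmul_zero, signG_signG, signG_neg, pderivG_signG]
    split_ifs
    · abel
    · rw [gmul_zero]; abel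
  · rw [dualLetter_ly, letterIndex_ly,
      ← sum_range_ite_eq M j fun i => pderivG (lx i) (signG f) ⋆ g, ← Finset.sum_sub_distrib]
    refine Finset.sum_congr rfl fun i _ => ?_
    simp only [bracketTerm, pderivG_letter_gmul, gmul_sub, move, neg_gmul, gmul_add, gmul_neg, (lx_ne_ly i j).symm, if_false,
      ly_inj, gmul_zero, signG_signG, signG_neg, pderivG_signG]
    split_ifs
    · abel
    · rw [gmul_zero]; abel

theorem truncBracket_unit_left (M : ℕ) (g : Series K) : truncBracket M (unitG K) g = 0 := by
  refine Finset.sum_eq_zero fun i _ => ?_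
  simp only [bracketTerm, signG_unit, pderivG_unit, zero_gmul, add_zero, neg_zero]

theorem truncBracket_unit_right (M : ℕ) (g : Series K) : truncBracket M g (unitG K) = 0 := by
  refine Finset.sum_eq_zero fun i _ => ?_
  simp only [bracketTerm, pderivG_unit, gmul_zero, add_zero, neg_zero]

theorem pbracket_unit_left (g : Series K) : pbracket (unitG K) g = 0 := by
  funext S
  refine Finset.sum_eq_zero fun i _ => ?_
  simp only [bracketTerm, signG_unit, pderivG_unit, zero_gmul, add_zero, neg_zero]
  rfl

theorem pbracket_unit_right (g : Series K) : pbracket g (unitG K) = 0 := by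
  funext S
  refine Finset.sum_eq_zero fun i _ => ?_
  simp only [bracketTerm, pderivG_unit, gmul_zero, add_zero, neg_zero]
  rfl

theorem truncSquare_unit (M : ℕ) : truncSquare M (unitG K) = 0 := by
  refine Finset.sum_eq_zero fun i _ => ?_
  simp only [squareTerm, pderivG_unit, gmul_zero]

/-- The bracket has constant coefficients, so partial derivatives are superderivations of it. -/
theorem pderivG_truncBracket (M : ℕ) (a : Letter) (f g : Series K) :
    pderivG a (truncBracket M f g) =
      truncBracket M (pderivG a f) g + truncBracket M (signG f) (pderivG a g) := by
  rw [truncBracket, truncBracket, truncBracket, pderivG_sum, ← Finset.sum_add_distrib]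
  refine Finset.sum_congr rfl fun i _ => ?_
  simp only [bracketTerm, pderivG_neg, pderivG_add, pderivG_gmul, pderivG_signG,
    pderivG_pderivG a, signG_neg, neg_gmul, gmul_neg, neg_neg, signG_signG]
  abel

/-- The characteristic-free form of differentiating `½{f, f}`. -/
theorem pderivG_truncSquare (M : ℕ) (a : Letter) {f : Series K} (hf : f ∈ seriesParity K 1) :
    pderivG a (truncSquare M f) = -truncBracket M f (pderivG a f) := by
  rw [truncBracket, truncSquare, pderivG_sum, ← Finset.sum_neg_distrib]
  refine Finset.sum_congr rfl fun i _ => ?_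
  have he : pderivG (lx i) f ∈ seriesParity K 0 :=
    pderivG_mem_seriesParity hf (by norm_num) (by norm_num)
  rw [squareTerm, pderivG_gmul, signG_of_even he, bracketTerm_of_odd hf, pderivG_pderivG a,
    pderivG_pderivG a, neg_gmul, gmul_neg]
  abel

/-- In every term other than the one with index `j` the letter occurs twice. No division by two is
involved. -/
theorem truncSquare_lx_gmul (M j : ℕ) (f : Series K) :
    truncSquare M (letterG K (lx j) ⋆ f) =
      -(if j < M then letterG K (lx j) ⋆ (signG f ⋆ pderivG (ly j) f) else 0) := by
  have move : ∀ (a : Letter) (u v : Series K),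
      u ⋆ (letterG K a ⋆ v) = letterG K a ⋆ (signG u ⋆ v) := fun a u v => by
    rw [← gmul_assoc, gmul_letter, gmul_assoc]
  rw [truncSquare, ← sum_range_ite_eq M j fun i => letterG K (lx j) ⋆ (signG f ⋆ pderivG (ly i) f),
    ← Finset.sum_neg_distrib]
  refine Finset.sum_congr rfl fun i _ => ?_
  simp only [squareTerm, pderivG_letter_gmul, sub_gmul, (lx_ne_ly j i), if_false, lx_inj,
    zero_sub, gmul_neg, gmul_assoc, move _ (pderivG _ _), letter_gmul_letter_gmul, sub_zero]
  split_ifs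
  · rw [move]
  · rw [zero_gmul]

theorem truncSquare_ly_gmul (M j : ℕ) (f : Series K) :
    truncSquare M (letterG K (ly j) ⋆ f) =
      -(if j < M then letterG K (ly j) ⋆ (pderivG (lx j) f ⋆ f) else 0) := by
  have move : ∀ (a : Letter) (u v : Series K),
      u ⋆ (letterG K a ⋆ v) = letterG K a ⋆ (signG u ⋆ v) := fun a u v => by
    rw [← gmul_assoc, gmul_letter, gmul_assoc]
  rw [truncSquare, ← sum_range_ite_eq M j fun i => letterG K (ly j) ⋆ (pderivG (lx i) f ⋆ f),
    ← Finset.sum_neg_distrib]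
  refine Finset.sum_congr rfl fun i _ => ?_
  have h0 : (letterG K (ly j) ⋆ pderivG (lx i) f) ⋆ (letterG K (ly j) ⋆ pderivG (ly i) f) = 0 := by
    rw [gmul_assoc, move, letter_gmul_letter_gmul]
  rw [squareTerm, pderivG_letter_gmul, pderivG_letter_gmul, if_neg (lx_ne_ly i j).symm, zero_sub,
    neg_gmul, gmul_sub, h0, sub_zero, ← gmul_assoc]
  simp only [ly_inj]
  split_ifs
  · rfl
  · rw [gmul_zero]

end Poisson

section PoissonPivots

variable {K : Type u} [Field K]

local infixl:70 " ⋆ " => gmul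

/-! #### The pivot elements of the Poisson superalgebra -/

theorem pivotLetters_zero (n : ℕ) : pivotLetters n 0 = {ly n} := by
  simp [pivotLetters]

theorem pivotLetters_succ (n l : ℕ) :
    pivotLetters n (l + 1) = insert (lx n) (insert (lx (n + 1)) (pivotLetters (n + 3) l)) := by
  have h : ∀ f : ℕ → Letter, (Finset.range (l + 1)).image f =
      insert (f 0) ((Finset.range l).image fun m => f (m + 1)) := by
    intro f
    ext a
    simp only [Finset.mem_image, Finset.mem_insert, Finset.mem_range,
      Nat.exists_lt_succ_left (p := fun m => f m = a), eq_comm (a := a)]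
  have e : ∀ m, n + 3 * (m + 1) = n + 3 + 3 * m := by intro m; ring
  rw [pivotLetters, pivotLetters, h, h]
  simp only [e, mul_zero, add_zero]
  ext a
  simp only [Finset.mem_insert, Finset.mem_union]
  tauto

theorem le_letterIndex_of_mem_pivotLetters {n l : ℕ} {a : Letter} (h : a ∈ pivotLetters n l) :
    n ≤ letterIndex a := by
  simp only [pivotLetters, Finset.mem_insert, Finset.mem_union, Finset.mem_image] at h
  rcases h with rfl | ⟨m, -, rfl⟩ | ⟨m, -, rfl⟩ <;>
    simp only [letterIndex_lx, letterIndex_ly] <;> omega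

theorem lx_lt_of_lt_letterIndex {i : ℕ} {a : Letter} (h : i < letterIndex a) : lx i < a := by
  rcases letter_cases a with ⟨j, rfl⟩ | ⟨j, rfl⟩
  · exact Sum.Lex.inl_lt_inl_iff.2 h
  · exact Sum.Lex.inl_lt_inr i j

theorem letter_gmul_apply_of_lt {a : Letter} {f : Series K}
    (h : ∀ S, f S ≠ 0 → ∀ b ∈ S, a < b) (S : Finset Letter) :
    (letterG K a ⋆ f) S = if a ∈ S then f (S.erase a) else 0 := by
  rw [letter_gmul_apply]
  split_ifs with ha
  · by_cases h0 : f (S.erase a) = 0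
    · rw [h0, mul_zero]
    · have : (S.erase a).filter (· < a) = ∅ :=
        Finset.filter_eq_empty_iff.2 fun b hb => (h _ h0 b hb).not_gt
      rw [letterSign, this, Finset.card_empty, pow_zero, one_mul]
  · rfl

theorem exists_eq_pivotLetters {n : ℕ} {S : Finset Letter} (h : pivotV K n S ≠ 0) :
    ∃ l, S = pivotLetters n l := by
  by_contra hS
  exact h (if_neg hS)

/-- Low `x` letters precede every letter of the tail, so no signs arise and the recursion is one of
sets of letters. -/
theorem pivotV_eq (n : ℕ) : pivotV K n =
    letterG K (ly n) + letterG K (lx n) ⋆ (letterG K (lx (n + 1)) ⋆ pivotV K (n + 3)) := by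
  have h1 : ∀ S, pivotV K (n + 3) S ≠ 0 → ∀ b ∈ S, n + 3 ≤ letterIndex b := by
    intro S hS b hb
    obtain ⟨l, rfl⟩ := exists_eq_pivotLetters hS
    exact le_letterIndex_of_mem_pivotLetters hb
  have e1 := letter_gmul_apply_of_lt (a := lx (n + 1)) fun S hS b hb =>
    lx_lt_of_lt_letterIndex (h1 S hS b hb |>.trans' (by omega))
  have h2 : ∀ S, (letterG K (lx (n + 1)) ⋆ pivotV K (n + 3)) S ≠ 0 → ∀ b ∈ S, lx n < b := by
    intro S hS b hb
    rw [e1] at hS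
    by_cases hm : lx (n + 1) ∈ S
    · rw [if_pos hm] at hS
      refine lx_lt_of_lt_letterIndex ?_
      by_cases hb' : b = lx (n + 1)
      · rw [hb', letterIndex_lx]; omega
      · have := h1 _ hS b (Finset.mem_erase.2 ⟨hb', hb⟩)
        omega
    · rw [if_neg hm] at hS
      exact absurd rfl hS
  funext S
  rw [Pi.add_apply, letter_gmul_apply_of_lt h2]
  by_cases hx : lx n ∈ S
  · have hS : letterG K (ly n) S = 0 := by
      refine Pi.single_eq_of_ne ?_ _
      rintro rfl
      exact lx_ne_ly n n (Finset.mem_singleton.1 hx).symm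
    rw [if_pos hx, hS, zero_add, e1, pivotV, pivotV]
    by_cases hx' : lx (n + 1) ∈ S.erase (lx n)
    · rw [if_pos hx']
      congr 1
      refine propext ⟨?_, ?_⟩
      · rintro ⟨l, rfl⟩
        cases l with
        | zero =>
          rw [pivotLetters_zero, Finset.mem_singleton] at hx
          exact absurd hx.symm (lx_ne_ly _ _)
        | succ l =>
          refine ⟨l, ?_⟩
          have hn : ∀ i, i < n + 3 → lx i ∉ pivotLetters (n + 3) l := fun i hi hm => by
            have := le_letterIndex_of_mem_pivotLetters hm
            rw [letterIndex_lx] at this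
            omega
          rw [pivotLetters_succ, Finset.erase_insert, Finset.erase_insert (hn _ (by omega))]
          rw [Finset.mem_insert, lx_inj, not_or]
          exact ⟨by omega, hn _ (by omega)⟩
      · rintro ⟨l, hl⟩
        refine ⟨l + 1, ?_⟩
        rw [pivotLetters_succ, ← hl, Finset.insert_erase hx', Finset.insert_erase hx]
    · rw [if_neg hx', if_neg]
      rintro ⟨l, rfl⟩
      refine hx' ?_
      cases l with
      | zero =>
        rw [pivotLetters_zero, Finset.mem_singleton] at hx
        exact absurd hx.symm (lx_ne_ly _ _)
      | succ l =>
        rw [pivotLetters_succ, Finset.mem_erase, Ne, lx_inj]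
        exact ⟨by omega, Finset.mem_insert_of_mem (Finset.mem_insert_self _ _)⟩
  · rw [if_neg hx, add_zero, pivotV]
    by_cases hS : S = {ly n}
    · rw [if_pos ⟨0, by rw [hS, pivotLetters_zero]⟩, hS, letterG, Pi.single_eq_same]
    · rw [letterG, Pi.single_eq_of_ne hS, if_neg]
      rintro ⟨l, rfl⟩
      cases l with
      | zero => exact hS (pivotLetters_zero n)
      | succ l =>
        rw [pivotLetters_succ] at hx
        exact hx (Finset.mem_insert_self _ _)

theorem pivotV_ne_zero (n : ℕ) : pivotV K n ≠ 0 := by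
  intro h
  have : pivotV K n {ly n} = 1 := if_pos ⟨0, (pivotLetters_zero n).symm⟩
  rw [h] at this
  exact zero_ne_one this

/-- A property of sets of letters that holds for `y_n` and is inherited by `x_n x_{n+1} S` holds
for the monomials of the pivot elements. -/
theorem pivotLetters_induction {P : ℕ → Finset Letter → Prop} (h0 : ∀ n, P n {ly n})
    (h1 : ∀ n S, lx n ∉ insert (lx (n + 1)) S → lx (n + 1) ∉ S → P (n + 3) S →
      P n (insert (lx n) (insert (lx (n + 1)) S))) (l : ℕ) : ∀ n, P n (pivotLetters n l) := by
  induction l with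
  | zero => intro n; rw [pivotLetters_zero]; exact h0 n
  | succ l ih =>
    intro n
    rw [pivotLetters_succ]
    have hn : ∀ i, i < n + 3 → lx i ∉ pivotLetters (n + 3) l := fun i hi hm => by
      have := le_letterIndex_of_mem_pivotLetters hm
      rw [letterIndex_lx] at this
      omega
    refine h1 n _ ?_ (hn _ (by omega)) (ih (n + 3))
    rw [Finset.mem_insert, lx_inj, not_or]
    exact ⟨by omega, hn _ (by omega)⟩

theorem pivotV_mem_seriesSupported {P : ℕ → Finset Letter → Prop} (h0 : ∀ n, P n {ly n})
    (h1 : ∀ n S, lx n ∉ insert (lx (n + 1)) S → lx (n + 1) ∉ S → P (n + 3) S →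
      P n (insert (lx n) (insert (lx (n + 1)) S))) (n : ℕ) :
    pivotV K n ∈ seriesSupported K (P n) := by
  intro S hS
  obtain ⟨l, rfl⟩ := exists_eq_pivotLetters hS
  exact pivotLetters_induction h0 h1 l n

theorem pivotV_odd (n : ℕ) : pivotV K n ∈ seriesParity K 1 := by
  rw [seriesParity_eq]
  refine pivotV_mem_seriesSupported (P := fun _ S => S.card % 2 = 1) (fun n => by simp) ?_ n
  intro n S h1 h2 h3
  rw [Finset.card_insert_of_notMem h1, Finset.card_insert_of_notMem h2]
  omega

/-- The weight of a letter. -/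
def letterWeight (a : Letter) : Fin 3 → ℤ :=
  Sum.elim (fun i => -pivotWeight i) (fun i => pivotWeight i) (ofLex a)

theorem letterWeight_lx (i : ℕ) : letterWeight (lx i) = -pivotWeight i := rfl

theorem letterWeight_ly (i : ℕ) : letterWeight (ly i) = pivotWeight i := rfl

theorem letterWeight_dualLetter (a : Letter) : letterWeight (dualLetter a) = -letterWeight a := by
  rcases letter_cases a with ⟨i, rfl⟩ | ⟨i, rfl⟩
  · rw [dualLetter_lx, letterWeight_lx, letterWeight_ly, neg_neg]
  · rfl

variable (K) in
/-- The formal sums of monomials of weight `d`. -/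
def seriesWeight (d : Fin 3 → ℤ) : Submodule K (Series K) :=
  seriesSupported K fun S => ∑ a ∈ S, letterWeight a = d

theorem gmul_mem_seriesWeight {f g : Series K} {d e : Fin 3 → ℤ} (hf : f ∈ seriesWeight K d)
    (hg : g ∈ seriesWeight K e) : f ⋆ g ∈ seriesWeight K (d + e) :=
  gmul_mem_seriesSupported hf hg fun T U h h1 h2 => by rw [Finset.sum_union h, h1, h2]

theorem weight_union_of_insert {T U : Finset Letter} {i : ℕ} {d e : Fin 3 → ℤ}
    (h : Disjoint T U) (hT : lx i ∉ T) (hU : ly i ∉ U)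
    (h1 : ∑ a ∈ insert (lx i) T, letterWeight a = d)
    (h2 : ∑ a ∈ insert (ly i) U, letterWeight a = e) :
    ∑ a ∈ T ∪ U, letterWeight a = d + e := by
  rw [Finset.sum_union h, ← h1, ← h2, Finset.sum_insert hT, Finset.sum_insert hU, letterWeight_lx,
    letterWeight_ly]
  abel

theorem pbracket_mem_seriesWeight {f g : Series K} {d e : Fin 3 → ℤ} (hf : f ∈ seriesWeight K d)
    (hg : g ∈ seriesWeight K e) : pbracket f g ∈ seriesWeight K (d + e) :=
  pbracket_mem_seriesSupported fun _ => bracketTerm_mem_seriesSupported hf hg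
    (fun _ _ h hT hU h1 h2 => weight_union_of_insert h hT hU h1 h2)
    fun T U h hT hU h1 h2 => by
      rw [Finset.union_comm, add_comm]
      exact weight_union_of_insert h.symm hU hT h2 h1

theorem psquare_mem_seriesWeight {f : Series K} {d : Fin 3 → ℤ} (hf : f ∈ seriesWeight K d) :
    psquare f ∈ seriesWeight K (d + d) :=
  psquare_mem_seriesSupported fun _ => squareTerm_mem_seriesSupported hf
    fun _ _ h hT hU h1 h2 => weight_union_of_insert h hT hU h1 h2

theorem pivotV_mem_seriesWeight (n : ℕ) : pivotV K n ∈ seriesWeight K (pivotWeight n) := by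
  refine pivotV_mem_seriesSupported (P := fun n S => ∑ a ∈ S, letterWeight a = pivotWeight n)
    (fun n => Finset.sum_singleton _ _) ?_ n
  intro n S h1 h2 h3
  rw [Finset.sum_insert h1, Finset.sum_insert h2, h3, letterWeight_lx, letterWeight_lx,
    pivotWeight_add_three]
  abel

theorem poisson_monomial_mem_seriesWeight {d : Fin 3 → ℕ} {x : Series K}
    (hx : (poissonData K).IsMonomial (pivotsV K) d x) : x ∈ seriesWeight K (latticePoint d) := by
  induction hx with
  | gen i => rw [latticePoint_single]; exact pivotV_mem_seriesWeight _
  | op m d e x y hm _ _ hx hy =>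
    rw [map_add]
    rcases hm with rfl | rfl
    · exact gmul_mem_seriesWeight hx hy
    · exact pbracket_mem_seriesWeight hx hy
  | sq q d x hq _ _ hx =>
    obtain rfl := hq
    rw [two_smul, map_add]
    exact psquare_mem_seriesWeight hx

theorem poisson_part_le {Γ : Set (Fin 3 → ℕ)} : (poissonData K).part (pivotsV K) Γ ≤
    seriesSupported K fun S => ∃ d ∈ Γ, ∑ a ∈ S, letterWeight a = latticePoint d := by
  rw [SuperData.part, Submodule.span_le]
  rintro x ⟨d, hd, hx⟩
  exact seriesSupported_mono (fun S hS => ⟨d, hd, hS⟩) (poisson_monomial_mem_seriesWeight hx)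

theorem poisson_part_inf {Γ Δ : Set (Fin 3 → ℕ)} (h : Disjoint Γ Δ) :
    (poissonData K).part (pivotsV K) Γ ⊓ (poissonData K).part (pivotsV K) Δ = ⊥ := by
  rw [eq_bot_iff]
  refine (inf_le_inf poisson_part_le poisson_part_le).trans (seriesSupported_inf ?_).le
  rintro S ⟨d, hd, h1⟩ ⟨e, he, h2⟩
  rw [h1] at h2
  exact Set.disjoint_left.1 h hd (latticePoint_injective h2 ▸ he)

/-! #### The completion -/

theorem gmul_mem_Htilde {f g : Series K} (hf : f ∈ Htilde K) (hg : g ∈ Htilde K) :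
    f ⋆ g ∈ Htilde K := by
  refine gmul_mem_seriesSupported hf hg fun T U _ h1 h2 i hi => ?_
  rcases Finset.mem_union.1 hi with h | h
  · obtain ⟨j, hj, hm⟩ := h1 i h
    exact ⟨j, hj, Finset.mem_union_left _ hm⟩
  · obtain ⟨j, hj, hm⟩ := h2 i h
    exact ⟨j, hj, Finset.mem_union_right _ hm⟩

/-- A contraction removes `y_i` from one factor, but the other factor contained `x_i` and hence some
`y_j` with `j > i`, which takes over as the dominating letter. -/
theorem exists_lt_of_union {T U : Finset Letter} {i : ℕ}
    (h1 : ∀ k, lx k ∈ insert (lx i) T → ∃ j, k < j ∧ ly j ∈ insert (lx i) T)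
    (h2 : ∀ k, lx k ∈ insert (ly i) U → ∃ j, k < j ∧ ly j ∈ insert (ly i) U)
    (k : ℕ) (hk : lx k ∈ T ∪ U) : ∃ j, k < j ∧ ly j ∈ T ∪ U := by
  have h1' : ∀ k, lx k ∈ insert (lx i) T → ∃ j, k < j ∧ ly j ∈ T := by
    intro k hk
    obtain ⟨j, hj, hm⟩ := h1 k hk
    exact ⟨j, hj, (Finset.mem_insert.1 hm).resolve_left (lx_ne_ly i j)⟩
  rcases Finset.mem_union.1 hk with h | h
  · obtain ⟨j, hj, hm⟩ := h1' k (Finset.mem_insert_of_mem h)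
    exact ⟨j, hj, Finset.mem_union_left _ hm⟩
  · obtain ⟨j, hj, hm⟩ := h2 k (Finset.mem_insert_of_mem h)
    rcases Finset.mem_insert.1 hm with h' | h'
    · obtain ⟨j', hj', hm'⟩ := h1' i (Finset.mem_insert_self _ _)
      rw [ly_inj] at h'
      exact ⟨j', by omega, Finset.mem_union_left _ hm'⟩
    · exact ⟨j, hj, Finset.mem_union_right _ h'⟩

theorem pbracket_mem_Htilde {f g : Series K} (hf : f ∈ Htilde K) (hg : g ∈ Htilde K) :
    pbracket f g ∈ Htilde K :=
  pbracket_mem_seriesSupported fun _ => bracketTerm_mem_seriesSupported hf hg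
    (fun _ _ _ _ _ h1 h2 => exists_lt_of_union h1 h2)
    fun T U _ _ _ h1 h2 => by
      rw [Finset.union_comm]
      exact exists_lt_of_union h2 h1

theorem psquare_mem_Htilde {f : Series K} (hf : f ∈ Htilde K) : psquare f ∈ Htilde K :=
  psquare_mem_seriesSupported fun _ => squareTerm_mem_seriesSupported hf
    fun _ _ _ _ _ h1 h2 => exists_lt_of_union h1 h2

theorem pivotV_mem_Htilde (n : ℕ) : pivotV K n ∈ Htilde K := by
  -- The extra clause, a `y` of index at least `n`, is needed for the induction: it dominates the
  -- new letters `x_n` and `x_{n+1}`.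
  suffices h : pivotV K n ∈ seriesSupported K fun S =>
      (∀ i, lx i ∈ S → ∃ j, i < j ∧ ly j ∈ S) ∧ ∃ j, n ≤ j ∧ ly j ∈ S from
    seriesSupported_mono (fun S hS => hS.1) h
  refine pivotV_mem_seriesSupported (P := fun n S =>
    (∀ i, lx i ∈ S → ∃ j, i < j ∧ ly j ∈ S) ∧ ∃ j, n ≤ j ∧ ly j ∈ S) (fun n => ⟨?_, ?_⟩) ?_ n
  · intro i hi
    exact absurd (Finset.mem_singleton.1 hi).symm (lx_ne_ly _ _)
  · exact ⟨n, le_rfl, Finset.mem_singleton_self _⟩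
  · rintro n S - - ⟨h, j, hj, hm⟩
    have hm' : ly j ∈ insert (lx n) (insert (lx (n + 1)) S) :=
      Finset.mem_insert_of_mem (Finset.mem_insert_of_mem hm)
    refine ⟨fun i hi => ?_, j, by omega, hm'⟩
    rcases Finset.mem_insert.1 hi with h' | h'
    · exact ⟨j, by rw [lx_inj] at h'; omega, hm'⟩
    · rcases Finset.mem_insert.1 h' with h' | h'
      · exact ⟨j, by rw [lx_inj] at h'; omega, hm'⟩
      · obtain ⟨k, hk, hmk⟩ := h i h'
        exact ⟨k, hk, Finset.mem_insert_of_mem (Finset.mem_insert_of_mem hmk)⟩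

theorem squareTerm_eq_zero {f : Series K} (hf : f ∈ Htilde K) {S : Finset Letter} {i : ℕ}
    (hi : S.sup letterIndex ≤ i) : squareTerm f i S = 0 := by
  by_contra h
  obtain ⟨T, hT, ha, -⟩ := exists_of_gmul_ne_zero h
  obtain ⟨j, hj, hm⟩ := exists_lt_of_pderivG_lx hf ha
  have h1 : letterIndex (ly j) ≤ S.sup letterIndex := Finset.le_sup (hT hm)
  rw [letterIndex_ly] at h1
  omega

theorem pbracket_apply_eq {f g : Series K} (hf : f ∈ Htilde K) (hg : g ∈ Htilde K) {M : ℕ}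
    {S : Finset Letter} (hM : S.sup letterIndex ≤ M) : pbracket f g S = truncBracket M f g S := by
  rw [truncBracket, Finset.sum_apply]
  refine Finset.sum_subset (Finset.range_mono hM) fun i _ hi => ?_
  exact bracketTerm_eq_zero hf hg (not_lt.1 fun h => hi (Finset.mem_range.2 h))

theorem psquare_apply_eq {f : Series K} (hf : f ∈ Htilde K) {M : ℕ} {S : Finset Letter}
    (hM : S.sup letterIndex ≤ M) : psquare f S = truncSquare M f S := by
  rw [truncSquare, Finset.sum_apply]
  refine Finset.sum_subset (Finset.range_mono hM) fun i _ hi => ?_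
  exact squareTerm_eq_zero hf (not_lt.1 fun h => hi (Finset.mem_range.2 h))

/-! #### The pivot elements as monomials -/

theorem pderivG_pivotV {a : Letter} {n : ℕ} (h : letterIndex a < n) :
    pderivG a (pivotV K n) = 0 := by
  funext S
  by_contra hne
  obtain ⟨l, hl⟩ := exists_eq_pivotLetters (of_pderivG_ne_zero hne).2
  have := le_letterIndex_of_mem_pivotLetters (hl ▸ Finset.mem_insert_self a S)
  omega

theorem pderivG_ly_pivotV (n : ℕ) : pderivG (ly n) (pivotV K n) = unitG K := by
  rw [pivotV_eq, pderivG_add, pderivG_letter, if_pos rfl, pderivG_letter_gmul,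
    if_neg (lx_ne_ly _ _), pderivG_letter_gmul, if_neg (lx_ne_ly _ _),
    pderivG_pivotV (by rw [letterIndex_ly]; omega), gmul_zero, sub_zero, gmul_zero, sub_zero,
    add_zero]

theorem truncBracket_letter {M : ℕ} {a : Letter} (h : letterIndex a < M) (g : Series K) :
    truncBracket M (letterG K a) g = pderivG (dualLetter a) g := by
  have := truncBracket_letter_gmul M a (unitG K) g
  rwa [gmul_unit, if_pos h, signG_unit, unit_gmul, truncBracket_unit_left, gmul_zero,
    add_zero] at this

/-- Write `V_n = y_n + x_n u`: the squares of both summands vanish and the polarization term is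
`{y_n, x_n u} = u`. -/
theorem truncSquare_pivotV {M n : ℕ} (h : n < M) :
    truncSquare M (pivotV K n) = letterG K (lx (n + 1)) ⋆ pivotV K (n + 3) := by
  have hu : ∀ a : Letter, letterIndex a ≤ n →
      pderivG a (letterG K (lx (n + 1)) ⋆ pivotV K (n + 3)) = 0 := by
    intro a ha
    have hne : a ≠ lx (n + 1) := by
      rintro rfl
      rw [letterIndex_lx] at ha
      omega
    rw [pderivG_letter_gmul, if_neg hne, pderivG_pivotV (by omega), gmul_zero, sub_zero]
  have hy : truncSquare M (letterG K (ly n)) = 0 := by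
    have := truncSquare_ly_gmul M n (unitG K)
    rwa [gmul_unit, pderivG_unit, zero_gmul, gmul_zero, ite_self, neg_zero] at this
  rw [pivotV_eq, truncSquare_add (letterG_mem_seriesParity _), hy, truncSquare_lx_gmul,
    hu _ (letterIndex_ly n).le, gmul_zero, gmul_zero, ite_self, neg_zero, zero_add, zero_add,
    truncBracket_letter h, dualLetter_ly, pderivG_letter_gmul, if_pos rfl,
    hu _ (letterIndex_lx n).le, gmul_zero, sub_zero]

theorem truncBracket_pivotV {M n : ℕ} (h : n < M) :
    truncBracket M (pivotV K n) (letterG K (lx n) ⋆ pivotV K (n + 2)) = pivotV K (n + 2) := by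
  have h0 : letterG K (lx n) ⋆ truncBracket M (pivotV K n) (pivotV K (n + 2)) = 0 := by
    rw [pivotV_eq n, truncBracket_add_left, truncBracket_letter h, dualLetter_ly,
      pderivG_pivotV (by rw [letterIndex_lx]; omega), zero_add, truncBracket_letter_gmul,
      dualLetter_lx, pderivG_pivotV (by rw [letterIndex_ly]; omega), gmul_zero, ite_self, zero_add,
      letter_gmul_letter_gmul]
  rw [truncBracket_gmul_letter, signG_of_odd (pivotV_odd n), truncBracket_neg_left, gmul_neg, h0,
    letterIndex_lx, if_pos h, dualLetter_lx, pderivG_neg, pderivG_ly_pivotV, neg_gmul, unit_gmul,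
    neg_zero, zero_sub, neg_neg]

theorem psquare_pivotV (n : ℕ) :
    psquare (pivotV K n) = letterG K (lx (n + 1)) ⋆ pivotV K (n + 3) := by
  funext S
  -- The truncation may depend on the coefficient considered; it must cover `S` and the index `n`.
  rw [psquare_apply_eq (pivotV_mem_Htilde n) (le_max_left (S.sup letterIndex) (n + 1)),
    truncSquare_pivotV ((Nat.lt_succ_self n).trans_le (le_max_right _ _))]

theorem pbracket_psquare_pivotV (n : ℕ) :
    pbracket (pivotV K (n + 1)) (psquare (pivotV K n)) = pivotV K (n + 3) := by
  funext S
  rw [pbracket_apply_eq (pivotV_mem_Htilde _) (psquare_mem_Htilde (pivotV_mem_Htilde n))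
    (le_max_left (S.sup letterIndex) (n + 2)), psquare_pivotV,
    truncBracket_pivotV ((Nat.lt_succ_self (n + 1)).trans_le (le_max_right _ _))]

theorem poisson_monomial_pivotV (n : ℕ) :
    (poissonData K).IsMonomial (pivotsV K) (pivotDegree n) (pivotV K n) := by
  induction n using Nat.strong_induction_on with
  | _ n ih =>
    match n with
    | 0 => exact SuperData.IsMonomial.gen 0
    | 1 => exact SuperData.IsMonomial.gen 1
    | 2 => exact SuperData.IsMonomial.gen 2
    | n + 3 =>
      have h1 := SuperData.IsMonomial.sq (D := poissonData K) psquare _ _ rfl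
        (pivotV_odd n) (ih n (by omega))
      have h2 := SuperData.IsMonomial.op (D := poissonData K) pbracket _ _ _ _ (Or.inr rfl)
        (ih (n + 1) (by omega)) h1
      rw [pbracket_psquare_pivotV] at h2
      exact h2

end PoissonPivots

section PoissonNormalForms

variable {K : Type u} [Field K]

local infixl:70 " ⋆ " => gmul

/-! #### Normal forms of monomials in the pivot elements -/

/-- `1` and the monomials in `V_n, V_{n+1}, V_{n+2}` with respect to the bracket of the letters
with numbers below `M`. -/
inductive PoissonWord (M n : ℕ) : (Fin 3 → ℤ) → Series K → Prop
  | unit : PoissonWord M n 0 (unitG K)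
  | monomial (e : Fin 3 → ℕ) (w : Series K) :
      (truncData K M).IsMonomial (fun i : Fin 3 => pivotV K (n + i)) e w →
      PoissonWord M n (∑ i : Fin 3, e i • pivotWeight (n + i)) w

theorem sum_add_smul_pivotWeight (n : ℕ) (d e : Fin 3 → ℕ) :
    ∑ i : Fin 3, (d + e) i • pivotWeight (n + i) =
      ∑ i : Fin 3, d i • pivotWeight (n + i) + ∑ i : Fin 3, e i • pivotWeight (n + i) := by
  simp only [Pi.add_apply, add_smul, Finset.sum_add_distrib]

theorem PoissonWord.pivot (M n : ℕ) (i : Fin 3) :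
    PoissonWord M n (pivotWeight (n + i)) (pivotV K (n + i)) := by
  have := PoissonWord.monomial (K := K) (M := M) (n := n) _ _ (SuperData.IsMonomial.gen i)
  have h0 := sum_single_smul_pivotWeight n 0 i
  simp only [zero_add, Pi.zero_apply, zero_smul, Finset.sum_const_zero] at h0
  rwa [h0] at this

theorem PoissonWord.gmul {M n : ℕ} {d e : Fin 3 → ℤ} {f g : Series K} (hf : PoissonWord M n d f)
    (hg : PoissonWord M n e g) : PoissonWord M n (d + e) (f ⋆ g) := by
  cases hf with
  | unit => rwa [zero_add, unit_gmul]
  | monomial d f hf =>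
    cases hg with
    | unit => rw [add_zero, gmul_unit]; exact PoissonWord.monomial d f hf
    | monomial e g hg =>
      rw [← sum_add_smul_pivotWeight]
      exact PoissonWord.monomial _ _ (SuperData.IsMonomial.op _ _ _ _ _ (Or.inl rfl) hf hg)

theorem PoissonWord.truncBracket {M n : ℕ} {d e : Fin 3 → ℤ} {f g : Series K}
    (hf : PoissonWord M n d f) (hg : PoissonWord M n e g) :
    _root_.truncBracket M f g = 0 ∨ PoissonWord M n (d + e) (_root_.truncBracket M f g) := by
  cases hf with
  | unit => exact Or.inl (truncBracket_unit_left M g)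
  | monomial d f hf =>
    cases hg with
    | unit => exact Or.inl (truncBracket_unit_right M f)
    | monomial e g hg =>
      rw [← sum_add_smul_pivotWeight]
      exact Or.inr
        (PoissonWord.monomial _ _ (SuperData.IsMonomial.op _ _ _ _ _ (Or.inr rfl) hf hg))

theorem PoissonWord.truncSquare {M n : ℕ} {d : Fin 3 → ℤ} {f : Series K}
    (hf : PoissonWord M n d f) (ho : f ∈ seriesParity K 1) :
    _root_.truncSquare M f = 0 ∨ PoissonWord M n (d + d) (_root_.truncSquare M f) := by
  cases hf with
  | unit => exact Or.inl (truncSquare_unit M)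
  | monomial d f hf =>
    rw [← sum_add_smul_pivotWeight, ← two_smul ℕ d]
    exact Or.inr (PoissonWord.monomial _ _ (SuperData.IsMonomial.sq _ _ _ rfl ho hf))

theorem signG_of_par {i : Bool} {f : Series K} (h : f ∈ (poissonData K).par i) :
    signG f = f ∨ signG f = -f := by
  cases i
  · exact Or.inl (signG_of_even h)
  · exact Or.inr (signG_of_odd h)

theorem unitG_even : unitG K ∈ seriesParity K 0 := by
  intro S hS
  refine Pi.single_eq_of_ne ?_ _
  rintro rfl
  exact hS rfl

theorem PoissonWord.parity {M n : ℕ} {d : Fin 3 → ℤ} {f : Series K} (hf : PoissonWord M n d f) :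
    ∃ i, f ∈ (poissonData K).par i := by
  cases hf with
  | unit => exact ⟨false, unitG_even⟩
  | monomial e f hf => exact hf.parity (truncData_isRegular M) fun i => pivotV_odd _

variable (K) in
/-- The span of the words of weight `d`. -/
def wordSpan (M n : ℕ) (d : Fin 3 → ℤ) : Submodule K (Series K) :=
  Submodule.span K {w | PoissonWord M n d w}

theorem gmul_mem_wordSpan {M n : ℕ} {d e : Fin 3 → ℤ} : ∀ f ∈ wordSpan K M n d,
    ∀ g ∈ wordSpan K M n e, f ⋆ g ∈ wordSpan K M n (d + e) :=
  (truncData_isRegular M).op_mem_span (Or.inl rfl) fun _ ha _ hb =>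
    Submodule.subset_span (PoissonWord.gmul ha hb)

theorem truncBracket_mem_wordSpan {M n : ℕ} {d e : Fin 3 → ℤ} : ∀ f ∈ wordSpan K M n d,
    ∀ g ∈ wordSpan K M n e, truncBracket M f g ∈ wordSpan K M n (d + e) :=
  (truncData_isRegular M).op_mem_span (Or.inr rfl) fun a ha b hb => by
    rcases PoissonWord.truncBracket ha hb with h | h
    · rw [h]; exact Submodule.zero_mem _
    · exact Submodule.subset_span h

/-- The letters that are split off from the monomials. -/
def IsLowLetter (n : ℕ) (a : Letter) : Prop := letterIndex a < n ∨ a = lx n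

/-- The derivative dual to a low letter kills `V_n, V_{n+1}, V_{n+2}`, apart from `∂V_n/∂y_n = 1`;
the derivation rules extend this to words. The unit that appears is the reason for counting `1` as a
word. -/
theorem pderivG_mem_wordSpan {M n : ℕ} {a : Letter} (ha : IsLowLetter n a) {d : Fin 3 → ℤ}
    {w : Series K} (hw : PoissonWord M n d w) :
    pderivG (dualLetter a) w ∈ wordSpan K M n (letterWeight a + d) := by
  cases hw with
  | unit => rw [pderivG_unit]; exact Submodule.zero_mem _
  | monomial e w hw =>
    have hmul : ∀ {u : Fin 3 → ℕ} {v : Series K},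
        (truncData K M).IsMonomial (fun i : Fin 3 => pivotV K (n + i)) u v →
        v ∈ wordSpan K M n (∑ i : Fin 3, u i • pivotWeight (n + i)) := fun h =>
      Submodule.subset_span (PoissonWord.monomial _ _ h)
    have hsign : ∀ {u : Fin 3 → ℕ} {v : Series K},
        (truncData K M).IsMonomial (fun i : Fin 3 => pivotV K (n + i)) u v →
        signG v ∈ wordSpan K M n (∑ i : Fin 3, u i • pivotWeight (n + i)) := by
      intro u v h
      obtain ⟨i, hi⟩ := h.parity (truncData_isRegular M) fun i => pivotV_odd _
      rcases signG_of_par hi with h' | h' <;> rw [h']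
      · exact hmul h
      · exact Submodule.neg_mem _ (hmul h)
    induction hw with
    | gen i =>
      by_cases h : letterIndex (dualLetter a) < n + i
      · rw [pderivG_pivotV h]; exact Submodule.zero_mem _
      · obtain rfl : a = lx n := by
          refine ha.resolve_left fun h' => h ?_
          rcases letter_cases a with ⟨j, rfl⟩ | ⟨j, rfl⟩
          · rw [dualLetter_lx, letterIndex_ly]; rw [letterIndex_lx] at h'; omega
          · rw [dualLetter_ly, letterIndex_lx]; rw [letterIndex_ly] at h'; omega
        rw [dualLetter_lx, letterIndex_ly] at h
        obtain rfl : i = 0 := by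
          apply Fin.ext
          rw [Fin.val_zero]
          omega
        have h0 := sum_single_smul_pivotWeight n 0 0
        simp only [zero_add, Pi.zero_apply, zero_smul, Finset.sum_const_zero, Fin.val_zero,
          add_zero] at h0 ⊢
        rw [dualLetter_lx, pderivG_ly_pivotV, letterWeight_lx, h0, neg_add_cancel]
        exact Submodule.subset_span PoissonWord.unit
    | op m d e x y hm hx hy ihx ihy =>
      rw [sum_add_smul_pivotWeight]
      have h1 : letterWeight a + (∑ i : Fin 3, d i • pivotWeight (n + i) +
          ∑ i : Fin 3, e i • pivotWeight (n + i)) =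
          ∑ i : Fin 3, d i • pivotWeight (n + i) + (letterWeight a +
          ∑ i : Fin 3, e i • pivotWeight (n + i)) := by abel
      rcases hm with rfl | rfl
      · rw [pderivG_gmul]
        refine Submodule.add_mem _ ?_ ?_
        · rw [← add_assoc]
          exact gmul_mem_wordSpan _ ihx _ (hmul hy)
        · rw [h1]
          exact gmul_mem_wordSpan _ (hsign hx) _ ihy
      · rw [pderivG_truncBracket]
        refine Submodule.add_mem _ ?_ ?_
        · rw [← add_assoc]
          exact truncBracket_mem_wordSpan _ ihx _ (hmul hy)
        · rw [h1]
          exact truncBracket_mem_wordSpan _ (hsign hx) _ ihy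
    | sq q d x hq ho hx ihx =>
      obtain rfl := hq
      rw [pderivG_truncSquare M _ ho, two_smul, sum_add_smul_pivotWeight, add_left_comm]
      exact Submodule.neg_mem _ (truncBracket_mem_wordSpan _ (hmul hx) _ ihx)

/-- The words multiplied from the left by low letters, together with their weights. -/
inductive LetterForm (M n : ℕ) : (Fin 3 → ℤ) → Series K → Prop
  | word (d : Fin 3 → ℤ) (w : Series K) : PoissonWord M n d w → LetterForm M n d w
  | letter (a : Letter) (d : Fin 3 → ℤ) (f : Series K) : IsLowLetter n a → LetterForm M n d f →
      LetterForm M n (letterWeight a + d) (letterG K a ⋆ f)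

theorem LetterForm.parity {M n : ℕ} {d : Fin 3 → ℤ} {f : Series K} (hf : LetterForm M n d f) :
    ∃ i, f ∈ (poissonData K).par i := by
  induction hf with
  | word d w hw => exact hw.parity
  | letter a d f _ _ ih =>
    obtain ⟨i, hi⟩ := ih
    exact ⟨_, gmul_parity (i := true) (letterG_mem_seriesParity a) hi⟩

variable (K) in
/-- The span of the normal forms of weight `d`. -/
def formSpan (M n : ℕ) (d : Fin 3 → ℤ) : Submodule K (Series K) :=
  Submodule.span K {f | LetterForm M n d f}

theorem wordSpan_le_formSpan (M n : ℕ) (d : Fin 3 → ℤ) : wordSpan K M n d ≤ formSpan K M n d :=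
  Submodule.span_mono fun _ h => LetterForm.word _ _ h

theorem LetterForm.signG_mem {M n : ℕ} {d : Fin 3 → ℤ} {f : Series K} (hf : LetterForm M n d f) :
    signG f ∈ formSpan K M n d := by
  obtain ⟨i, hi⟩ := hf.parity
  rcases signG_of_par hi with h | h <;> rw [h]
  · exact Submodule.subset_span hf
  · exact Submodule.neg_mem _ (Submodule.subset_span hf)

theorem letter_gmul_mem_formSpan {M n : ℕ} {a : Letter} (ha : IsLowLetter n a) {d : Fin 3 → ℤ}
    {f : Series K} (hf : f ∈ formSpan K M n d) :
    letterG K a ⋆ f ∈ formSpan K M n (letterWeight a + d) :=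
  Submodule.span_le (p := (formSpan K M n (letterWeight a + d)).comap (gmulLin (letterG K a))).2
    (fun _ h => Submodule.subset_span (LetterForm.letter a d _ ha h)) hf

theorem pderivG_mem_formSpan {M n : ℕ} {a : Letter} (ha : IsLowLetter n a) {d : Fin 3 → ℤ}
    {f : Series K} (hf : f ∈ formSpan K M n d) :
    pderivG (dualLetter a) f ∈ formSpan K M n (letterWeight a + d) := by
  refine Submodule.span_le
    (p := (formSpan K M n (letterWeight a + d)).comap (pderivLin (dualLetter a))).2 ?_ hf
  clear hf
  intro f hf
  change pderivG (dualLetter a) f ∈ formSpan K M n (letterWeight a + d)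
  induction hf with
  | word d w hw => exact wordSpan_le_formSpan _ _ _ (pderivG_mem_wordSpan ha hw)
  | letter b d f hb hf ih =>
    rw [pderivG_letter_gmul]
    refine Submodule.sub_mem _ ?_ ?_
    · split_ifs with h
      · rw [← h, letterWeight_dualLetter, add_neg_cancel_left]
        exact Submodule.subset_span hf
      · exact Submodule.zero_mem _
    · rw [add_left_comm]
      exact letter_gmul_mem_formSpan hb ih

theorem gmul_mem_formSpan {M n : ℕ} {d e : Fin 3 → ℤ} : ∀ f ∈ formSpan K M n d,
    ∀ g ∈ formSpan K M n e, f ⋆ g ∈ formSpan K M n (d + e) := by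
  refine (truncData_isRegular M).op_mem_span (Or.inl rfl) fun f hf g hg => ?_
  induction hf with
  | letter a d f ha _ ih =>
    rw [gmul_assoc, add_assoc]
    exact letter_gmul_mem_formSpan ha ih
  | word d w hw =>
    induction hg with
    | word e v hv => exact Submodule.subset_span (LetterForm.word _ _ (hw.gmul hv))
    | letter a e f ha hf ih =>
      have h : w ⋆ (letterG K a ⋆ f) = letterG K a ⋆ (signG w ⋆ f) := by
        rw [← gmul_assoc, gmul_letter, gmul_assoc]
      rw [h, add_left_comm]
      refine letter_gmul_mem_formSpan ha ?_
      obtain ⟨i, hi⟩ := hw.parity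
      rcases signG_of_par hi with h' | h' <;> rw [h']
      · exact ih
      · rw [neg_gmul]; exact Submodule.neg_mem _ ih

/-- Letters are pulled out by the Leibniz rule. The correction terms are derivatives with respect to
dual low letters, under which the normal forms are stable. Finiteness of the bracket makes these
manipulations legitimate. -/
theorem truncBracket_mem_formSpan {M n : ℕ} {d e : Fin 3 → ℤ} : ∀ f ∈ formSpan K M n d,
    ∀ g ∈ formSpan K M n e, truncBracket M f g ∈ formSpan K M n (d + e) := by
  refine (truncData_isRegular M).op_mem_span (Or.inr rfl) fun f hf g hg => ?_
  induction hf with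
  | letter a d f ha hf ih =>
    rw [truncBracket_letter_gmul]
    refine Submodule.add_mem _ ?_ ?_
    · split_ifs
      · rw [add_comm (letterWeight a), add_assoc]
        exact gmul_mem_formSpan _ hf.signG_mem _
          (pderivG_mem_formSpan ha (Submodule.subset_span hg))
      · exact Submodule.zero_mem _
    · rw [add_assoc]
      exact letter_gmul_mem_formSpan ha ih
  | word d w hw =>
    induction hg with
    | word e v hv =>
      rcases hw.truncBracket hv with h | h
      · rw [h]; exact Submodule.zero_mem _
      · exact Submodule.subset_span (LetterForm.word _ _ h)
    | letter a e f ha hf ih =>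
      rw [truncBracket_gmul_letter]
      refine Submodule.sub_mem _ ?_ ?_
      · rw [add_left_comm]
        refine letter_gmul_mem_formSpan ha ?_
        obtain ⟨i, hi⟩ := hw.parity
        rcases signG_of_par hi with h' | h' <;> rw [h']
        · exact ih
        · rw [truncBracket_neg_left]; exact Submodule.neg_mem _ ih
      · split_ifs
        · rw [add_left_comm, ← add_assoc]
          exact gmul_mem_formSpan _
            (pderivG_mem_formSpan ha (LetterForm.word _ _ hw).signG_mem) _
            (Submodule.subset_span hf)
        · exact Submodule.zero_mem _

/-- The square of a letter times `f` involves `f` only through the product with its derivative in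
the dual letter, so the previous closure properties suffice in every characteristic. -/
theorem truncSquare_mem_formSpan {M n : ℕ} {d : Fin 3 → ℤ} : ∀ f ∈ formSpan K M n d,
    f ∈ seriesParity K 1 → truncSquare M f ∈ formSpan K M n (d + d) := by
  refine (truncData_isRegular M).sq_mem_of_span rfl
    (fun f hf => SuperData.par_cases (D := truncData K M) hf.parity.choose_spec) ?_ ?_
  · intro f hf ho
    cases hf with
    | word d w hw =>
      rcases hw.truncSquare ho with h | h
      · rw [h]; exact Submodule.zero_mem _
      · exact Submodule.subset_span (LetterForm.word _ _ h)
    | letter a d f ha hf =>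
      have hf' : f ∈ formSpan K M n d := Submodule.subset_span hf
      have h1 : letterWeight a + d + (letterWeight a + d) =
          letterWeight a + (d + (letterWeight a + d)) := by abel
      have h2 : letterWeight a + d + (letterWeight a + d) =
          letterWeight a + (letterWeight a + d + d) := by abel
      rcases letter_cases a with ⟨j, rfl⟩ | ⟨j, rfl⟩
      · rw [truncSquare_lx_gmul]
        refine Submodule.neg_mem _ ?_
        split_ifs
        · rw [h1]
          exact letter_gmul_mem_formSpan ha
            (gmul_mem_formSpan _ hf.signG_mem _ (pderivG_mem_formSpan ha hf'))
        · exact Submodule.zero_mem _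
      · rw [truncSquare_ly_gmul]
        refine Submodule.neg_mem _ ?_
        split_ifs
        · rw [h2]
          exact letter_gmul_mem_formSpan ha
            (gmul_mem_formSpan _ (pderivG_mem_formSpan ha hf') _ hf')
        · exact Submodule.zero_mem _
  · intro m hm f hf g hg
    rcases hm with rfl | rfl
    · exact gmul_mem_formSpan _ (Submodule.subset_span hf) _ (Submodule.subset_span hg)
    · exact truncBracket_mem_formSpan _ (Submodule.subset_span hf) _ (Submodule.subset_span hg)

theorem pivotV_mem_formSpan (M : ℕ) {n : ℕ} (k : ℕ) (hk : k ≤ n + 2) :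
    pivotV K k ∈ formSpan K M n (pivotWeight k) := by
  induction hm : n + 2 - k using Nat.strong_induction_on generalizing k with
  | _ m ih =>
    rcases le_or_gt n k with h | h
    · have := PoissonWord.pivot (K := K) M n ⟨k - n, by omega⟩
      simp only [Nat.add_sub_cancel' h] at this
      exact Submodule.subset_span (LetterForm.word _ _ this)
    · rw [pivotV_eq]
      refine Submodule.add_mem _ ?_ ?_
      · have := LetterForm.letter (ly k) _ _ (Or.inl h)
          (LetterForm.word _ _ (PoissonWord.unit (K := K) (M := M) (n := n)))
        rw [add_zero, gmul_unit] at this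
        exact Submodule.subset_span this
      · have h1 := ih (n + 2 - (k + 3)) (by omega) (k + 3) (by omega) rfl
        have hl : IsLowLetter n (lx (k + 1)) := by
          rcases Nat.lt_or_ge (k + 1) n with h' | h'
          · exact Or.inl h'
          · exact Or.inr (by rw [lx_inj]; omega)
        have h2 := letter_gmul_mem_formSpan (Or.inl h : IsLowLetter n (lx k))
          (letter_gmul_mem_formSpan hl h1)
        convert h2 using 1
        rw [pivotWeight_add_three, letterWeight_lx, letterWeight_lx]
        abel_nf

theorem trunc_monomial_mem_formSpan (M n : ℕ) {d : Fin 3 → ℕ} {x : Series K}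
    (hx : (truncData K M).IsMonomial (pivotsV K) d x) : x ∈ formSpan K M n (latticePoint d) := by
  induction hx with
  | gen i =>
    rw [latticePoint_single]
    exact pivotV_mem_formSpan M _ (by omega)
  | op m d e x y hm _ _ hx hy =>
    rw [map_add]
    rcases hm with rfl | rfl
    · exact gmul_mem_formSpan _ hx _ hy
    · exact truncBracket_mem_formSpan _ hx _ hy
  | sq q d x hq ho _ hx =>
    obtain rfl := hq
    rw [two_smul, map_add]
    exact truncSquare_mem_formSpan _ hx ho

/-! #### The weights of the normal forms -/

/-- The set of low letters. -/
def lowLetters (n : ℕ) : Finset Letter :=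
  (Finset.range (n + 1)).image lx ∪ (Finset.range n).image ly

theorem mem_lowLetters {n : ℕ} {a : Letter} (h : IsLowLetter n a) : a ∈ lowLetters n := by
  simp only [lowLetters, Finset.mem_union, Finset.mem_image, Finset.mem_range]
  rcases h with h | rfl
  · rcases letter_cases a with ⟨j, rfl⟩ | ⟨j, rfl⟩
    · rw [letterIndex_lx] at h
      exact Or.inl ⟨j, by omega, rfl⟩
    · exact Or.inr ⟨j, h, rfl⟩
  · exact Or.inl ⟨n, by omega, rfl⟩

theorem LetterForm.exists_factorization {M n : ℕ} {d : Fin 3 → ℤ} {f : Series K}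
    (hf : LetterForm M n d f) : ∃ r w, ∃ c : Fin 3 → ℤ, ∃ e : Fin 3 → ℕ, f = r ⋆ w ∧
      r ∈ seriesSupported K (fun S => S ⊆ lowLetters n ∧ ∑ a ∈ S, letterWeight a = c) ∧
      d = c + ∑ i : Fin 3, e i • pivotWeight (n + i) := by
  induction hf with
  | word d w hw =>
    obtain ⟨e, he⟩ : ∃ e : Fin 3 → ℕ, d = ∑ i : Fin 3, e i • pivotWeight (n + i) := by
      cases hw with
      | unit => exact ⟨0, by simp⟩
      | monomial e w _ => exact ⟨e, rfl⟩
    refine ⟨unitG K, w, 0, e, (unit_gmul w).symm, fun S hS => ?_, by rw [he, zero_add]⟩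
    obtain rfl : S = ∅ := by
      by_contra h
      exact hS (Pi.single_eq_of_ne h _)
    exact ⟨Finset.empty_subset _, Finset.sum_empty⟩
  | letter a d f ha _ ih =>
    obtain ⟨r, w, c, e, rfl, hr, rfl⟩ := ih
    refine ⟨letterG K a ⋆ r, w, letterWeight a + c, e, (gmul_assoc _ _ _).symm, ?_, by abel⟩
    have hl : letterG K a ∈ seriesSupported K fun S => S = {a} := by
      intro S hS
      by_contra h
      exact hS (Pi.single_eq_of_ne h _)
    refine gmul_mem_seriesSupported hl hr ?_
    rintro T U h rfl ⟨h1, h2⟩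
    refine ⟨Finset.union_subset (Finset.singleton_subset_iff.2 (mem_lowLetters ha)) h1, ?_⟩
    rw [Finset.sum_union h, h2, Finset.sum_singleton]

/-- The finite set of corrections depends on `n` alone. This uniformity in `M` permits a different
truncation for each monomial. -/
theorem trunc_monomial_weight (n : ℕ) {M : ℕ} {d : Fin 3 → ℕ} {x : Series K}
    (hx : (truncData K M).IsMonomial (pivotsV K) d x) (hx0 : x ≠ 0) :
    ∃ f ∈ (lowLetters n).powerset.image fun S => ∑ a ∈ S, letterWeight a, ∃ e : Fin 3 → ℕ,
      latticePoint d = f + ∑ i : Fin 3, e i • pivotWeight (n + i) := by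
  have hmem := trunc_monomial_mem_formSpan M n hx
  obtain ⟨a, ha, ha0⟩ : ∃ a, LetterForm (K := K) M n (latticePoint d) a ∧ a ≠ 0 := by
    by_contra! hz
    have : formSpan K M n (latticePoint d) = ⊥ := by
      rw [formSpan, Submodule.span_eq_bot]
      exact hz
    rw [this] at hmem
    exact hx0 hmem
  obtain ⟨r, w, c, e, rfl, hr, he⟩ := ha.exists_factorization
  obtain ⟨S, hS⟩ : ∃ S, r S ≠ 0 := by
    by_contra! h
    have : r = 0 := funext h
    rw [this, zero_gmul] at ha0
    exact ha0 rfl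
  obtain ⟨h1, h2⟩ := hr S hS
  exact ⟨c, Finset.mem_image.2 ⟨S, Finset.mem_powerset.2 h1, h2⟩, e, he⟩

/-! #### Comparison of the full and the truncated bracket -/

/-- `f` and `g` have the same coefficients at the monomials in the letters with numbers below
`M`. -/
def AgreeBelow (M : ℕ) (f g : Series K) : Prop :=
  ∀ S : Finset Letter, (∀ a ∈ S, letterIndex a < M) → f S = g S

namespace AgreeBelow

variable {M : ℕ} {f f' g g' : Series K}

theorem gmul (hf : AgreeBelow M f f') (hg : AgreeBelow M g g') :
    AgreeBelow M (f ⋆ g) (f' ⋆ g') := by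
  intro S hS
  rw [gmul_apply, gmul_apply]
  refine Finset.sum_congr rfl fun T hT => ?_
  rw [hf T fun a ha => hS a (Finset.mem_powerset.1 hT ha),
    hg (S \ T) fun a ha => hS a (Finset.sdiff_subset ha)]

theorem signG (hf : AgreeBelow M f f') : AgreeBelow M (signG f) (_root_.signG f') := by
  intro S hS
  rw [signG_apply, signG_apply, hf S hS]

theorem pderivG {a : Letter} (ha : letterIndex a < M) (hf : AgreeBelow M f f') :
    AgreeBelow M (pderivG a f) (_root_.pderivG a f') := by
  intro S hS
  by_cases h : a ∈ S
  · rw [pderivG_of_mem h, pderivG_of_mem h]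
  · rw [pderivG_of_notMem h, pderivG_of_notMem h, hf]
    intro b hb
    rcases Finset.mem_insert.1 hb with rfl | hb
    · exact ha
    · exact hS b hb

theorem bracketTerm {i : ℕ} (hi : i < M) (hf : AgreeBelow M f f') (hg : AgreeBelow M g g') :
    AgreeBelow M (bracketTerm f g i) (_root_.bracketTerm f' g' i) := by
  intro S hS
  have h1 := (hf.signG.pderivG (a := lx i) hi).gmul (hg.pderivG (a := ly i) hi) S hS
  have h2 := (hf.signG.pderivG (a := ly i) hi).gmul (hg.pderivG (a := lx i) hi) S hS
  simp only [_root_.bracketTerm, Pi.neg_apply, Pi.add_apply, h1, h2]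

theorem sup_le {S : Finset Letter} (hS : ∀ a ∈ S, letterIndex a < M) : S.sup letterIndex ≤ M :=
  Finset.sup_le fun a ha => (hS a ha).le

theorem pbracket (hfH : f ∈ Htilde K) (hgH : g ∈ Htilde K) (hf : AgreeBelow M f f')
    (hg : AgreeBelow M g g') : AgreeBelow M (pbracket f g) (truncBracket M f' g') := by
  intro S hS
  rw [pbracket_apply_eq hfH hgH (sup_le hS), truncBracket, truncBracket, Finset.sum_apply,
    Finset.sum_apply]
  exact Finset.sum_congr rfl fun i hi => hf.bracketTerm (Finset.mem_range.1 hi) hg S hS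

theorem psquare (hfH : f ∈ Htilde K) (hf : AgreeBelow M f f') :
    AgreeBelow M (psquare f) (truncSquare M f') := by
  intro S hS
  rw [psquare_apply_eq hfH (sup_le hS), truncSquare, truncSquare, Finset.sum_apply,
    Finset.sum_apply]
  exact Finset.sum_congr rfl fun i hi => (hf.pderivG (a := lx i) (Finset.mem_range.1 hi)).gmul
    (hf.pderivG (a := ly i) (Finset.mem_range.1 hi)) S hS

end AgreeBelow

/-- Replacing every bracket and square by its truncation leaves the coefficients below `M`
unchanged, because the omitted terms vanish there and the retained derivatives use only letters
below `M`. Parities are matched so that an odd element to be squared has an odd counterpart. -/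
theorem poisson_monomial_agreeBelow (M : ℕ) {d : Fin 3 → ℕ} {x : Series K}
    (hx : (poissonData K).IsMonomial (pivotsV K) d x) : x ∈ Htilde K ∧ (x = 0 ∨
      ∃ x', (truncData K M).IsMonomial (pivotsV K) d x' ∧ AgreeBelow M x x' ∧
        ∃ i, x ∈ (poissonData K).par i ∧ x' ∈ (poissonData K).par i) := by
  have hR := poissonData_isRegular (K := K)
  induction hx with
  | gen i =>
    exact ⟨pivotV_mem_Htilde _, Or.inr ⟨_, SuperData.IsMonomial.gen i, fun _ _ => rfl, true,
      pivotV_odd _, pivotV_odd _⟩⟩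
  | op m d e x y hm _ _ hx hy =>
    obtain ⟨hxH, hx⟩ := hx
    obtain ⟨hyH, hy⟩ := hy
    have hH : m x y ∈ Htilde K := by
      rcases hm with rfl | rfl
      · exact gmul_mem_Htilde hxH hyH
      · exact pbracket_mem_Htilde hxH hyH
    refine ⟨hH, ?_⟩
    rcases hx with rfl | ⟨x', hx', hxa, i, hi, hi'⟩
    · exact Or.inl (hR.op_zero_left hm y)
    rcases hy with rfl | ⟨y', hy', hya, j, hj, hj'⟩
    · exact Or.inl (hR.op_zero_right hm x)
    right
    rcases hm with rfl | rfl
    · exact ⟨_, SuperData.IsMonomial.op _ _ _ _ _ (Or.inl rfl) hx' hy', hxa.gmul hya, _,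
        gmul_parity hi hj, gmul_parity hi' hj'⟩
    · exact ⟨_, SuperData.IsMonomial.op _ _ _ _ _ (Or.inr rfl) hx' hy',
        hxa.pbracket hxH hyH hya, _, pbracket_parity hi hj,
        (truncData_isRegular M).op_parity _ (Or.inr rfl) _ _ _ hi' _ hj'⟩
  | sq q d x hq ho _ hx =>
    obtain ⟨hxH, hx⟩ := hx
    obtain rfl := hq
    refine ⟨psquare_mem_Htilde hxH, ?_⟩
    rcases hx with rfl | ⟨x', hx', hxa, i, hi, hi'⟩
    · exact Or.inl (hR.sq_zero rfl)
    -- An element recorded as even but squared as an odd one is zero, so no counterpart is needed.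
    cases i
    · left
      rw [hR.eq_zero_of_par hi ho]
      exact hR.sq_zero rfl
    · exact Or.inr ⟨_, SuperData.IsMonomial.sq _ _ _ rfl hi' hx', hxa.psquare hxH, false,
        hR.sq_parity _ rfl _ ho, (truncData_isRegular M).sq_parity _ rfl _ hi'⟩

theorem poisson_selfSimilar :
    SelfSimilar {d | ∃ x, (poissonData K).IsMonomial (pivotsV K) d x ∧ x ≠ 0} := by
  intro n
  refine ⟨_, ((lowLetters n).powerset.image fun S => ∑ a ∈ S, letterWeight a).finite_toSet, ?_⟩
  rintro d ⟨x, hx, hx0⟩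
  obtain ⟨S, hS⟩ : ∃ S, x S ≠ 0 := by
    by_contra! h
    exact hx0 (funext h)
  -- The truncation is chosen to see one nonzero coefficient of `x`, so the truncated monomial is
  -- nonzero as well.
  obtain ⟨x', hx', ha, -⟩ :=
    (poisson_monomial_agreeBelow (S.sup letterIndex + 1) hx).2.resolve_left hx0
  refine trunc_monomial_weight n hx' fun h => hS ?_
  rw [ha S fun a ha => Nat.lt_succ_of_le (Finset.le_sup ha), h]
  rfl

theorem poissonData_isPlaneGraded : (poissonData K).IsPlaneGraded (pivotsV K) where
  regular := poissonData_isRegular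
  gen_odd _ := pivotV_odd _
  disjoint _ _ := poisson_part_inf
  selfSimilar := poisson_selfSimilar
  pivot n := ⟨_, Submodule.subset_span (poisson_monomial_pivotV n), pivotV_ne_zero n⟩

end PoissonNormalForms

/-! ### The Jordan superalgebras -/

namespace SuperData

variable {K V W : Type u} [Field K] [AddCommGroup V] [Module K V] [AddCommGroup W] [Module K W]

/-- Decompositions whose images under a linear map are different are different. -/
theorem sym2_ne_of_map (π : W →ₗ[K] V) {A B A' B' : Submodule K W}
    (h : s(A.map π, B.map π) ≠ s(A'.map π, B'.map π)) : s(A, B) ≠ s(A', B') :=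
  fun h' => h (congrArg (Sym2.map (Submodule.map π)) h')

end SuperData

/-! ### The Kantor double of the Poisson superalgebra -/

section PoissonDouble

variable {K : Type u} [Field K]

theorem poissonData_isKantorBase :
    (poissonData K).IsKantorBase gmul pbracket signLin (unitG K) where
  regular := poissonData_isRegular
  mul_mem := Or.inl rfl
  br_mem := Or.inr rfl
  sgn_even _ := signG_of_even
  sgn_odd _ := signG_of_odd
  unit_even := unitG_even
  unit_mul := unit_gmul
  mul_unit := gmul_unit
  unit_br := pbracket_unit_left
  br_unit := pbracket_unit_right

/-- The unit is neutral for the product and central for the bracket, and it is even, so adjoining it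
adds just a line. -/
theorem algP_eq : algP K = algPo K ⊔ Submodule.span K {unitG K} := by
  have hR := poissonData_isRegular (K := K)
  have hsub : (poissonData K).IsSubalgebra (algPo K) := SuperData.isSubalgebra_adjoin _
  refine le_antisymm (SuperData.adjoin_le ⟨?_, ?_⟩ ?_) (sup_le ?_ ?_)
  · intro m hm
    have h : ∀ f : Series K, (m (unitG K) f = f ∧ m f (unitG K) = f) ∨
        (m (unitG K) f = 0 ∧ m f (unitG K) = 0) := by
      intro f
      rcases hm with rfl | rfl
      · exact Or.inl ⟨unit_gmul f, gmul_unit f⟩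
      · exact Or.inr ⟨pbracket_unit_left f, pbracket_unit_right f⟩
    have h1 : unitG K ∈ algPo K ⊔ Submodule.span K {unitG K} :=
      Submodule.mem_sup_right (Submodule.mem_span_singleton_self _)
    have hl : ∀ f ∈ algPo K ⊔ Submodule.span K {unitG K},
        m (unitG K) f ∈ algPo K ⊔ Submodule.span K {unitG K} := by
      intro f hf
      rcases h f with h' | h' <;> rw [h'.1]
      · exact hf
      · exact Submodule.zero_mem _
    have hr : ∀ f ∈ algPo K ⊔ Submodule.span K {unitG K},
        m f (unitG K) ∈ algPo K ⊔ Submodule.span K {unitG K} := by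
      intro f hf
      rcases h f with h' | h' <;> rw [h'.2]
      · exact hf
      · exact Submodule.zero_mem _
    have hs : ∀ a ∈ Submodule.span K {unitG K}, ∀ b ∈ algPo K ⊔ Submodule.span K {unitG K},
        m a b ∈ algPo K ⊔ Submodule.span K {unitG K} := by
      obtain ⟨B, hB⟩ := hR.op_bilinear m hm
      intro a ha b hb
      obtain ⟨c, rfl⟩ := Submodule.mem_span_singleton.1 ha
      rw [hB, map_smul, LinearMap.smul_apply, ← hB]
      exact Submodule.smul_mem _ c (hl b hb)
    refine hR.op_mem_sup hm ?_ ?_ ?_ ?_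
    · exact fun a ha b hb => Submodule.mem_sup_left (hsub.1 m hm a ha b hb)
    · obtain ⟨B, hB⟩ := hR.op_bilinear m hm
      intro a ha b hb
      obtain ⟨c, rfl⟩ := Submodule.mem_span_singleton.1 hb
      rw [hB, map_smul, ← hB]
      exact Submodule.smul_mem _ c (hr a (Submodule.mem_sup_left ha))
    · exact fun a ha b hb => hs a ha b (Submodule.mem_sup_left hb)
    · exact fun a ha b hb => hs a ha b (Submodule.mem_sup_right hb)
  · intro q hq
    refine hR.sq_mem_sup ?_ ?_ fun a ha ho => Submodule.mem_sup_left (hsub.2 q hq a ha ho)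
    · rw [Submodule.span_le, Set.singleton_subset_iff]
      exact unitG_even
    · rw [algPo, SuperData.adjoin_range_eq_part hR poissonData_isPlaneGraded.gen_odd]
      exact SuperData.isGraded_part hR poissonData_isPlaneGraded.gen_odd _
  · refine Set.insert_subset ?_ fun f hf => ?_
    · exact Submodule.mem_sup_right (Submodule.mem_span_singleton_self _)
    · exact Submodule.mem_sup_left (SuperData.subset_adjoin _ hf)
  · exact SuperData.adjoin_mono (Set.subset_insert _ _)
  · rw [Submodule.span_le, Set.singleton_subset_iff]
    exact SuperData.subset_adjoin _ (Set.mem_insert _ _)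

/-- The unit has weight zero and lies on the plane: one side has `ℓ ≥ 0` on its monomials, the other
`ℓ < 0`. -/
theorem splitP_sup_unit_inf (p : ℝ × ℝ) :
    ((splitP K p).1 ⊔ Submodule.span K {unitG K}) ⊓ (splitP K p).2 = ⊥ := by
  have h0 : planeForm p 0 = 0 := by
    have := planeForm_add p 0 0
    rw [add_zero] at this
    linarith
  have h : ∀ q, (poissonData K).half (pivotsV K) q ≤
      seriesSupported K fun S => 0 < planeForm q (∑ a ∈ S, letterWeight a) := by
    intro q
    rw [SuperData.half_eq_part]
    refine poisson_part_le.trans (seriesSupported_mono ?_)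
    rintro S ⟨d, hd, h⟩
    rw [h]
    exact hd
  have h1 : (splitP K p).1 ⊔ Submodule.span K {unitG K} ≤
      seriesSupported K fun S => 0 ≤ planeForm p (∑ a ∈ S, letterWeight a) := by
    refine sup_le ((h p).trans (seriesSupported_mono fun S hS => hS.le)) ?_
    rw [Submodule.span_le, Set.singleton_subset_iff]
    intro S hS
    obtain rfl : S = ∅ := by
      by_contra h
      exact hS (Pi.single_eq_of_ne h _)
    rw [Finset.sum_empty, h0]
  rw [eq_bot_iff]
  refine (inf_le_inf h1 (h (-p))).trans (seriesSupported_inf fun S h1 h2 => ?_).le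
  rw [planeForm_neg] at h2
  linarith

theorem kantorData_splitsByPlanes : (kantorData K).SplitsByPlanes (algJo K) (splitJ K) := by
  have hP := poissonData_isPlaneGraded (K := K)
  refine SuperData.splitsByPlanes_of (fun p hp => ?_) fun p hp q hq hpq => ?_
  · have := poissonData_isKantorBase.isNilDecomposition (hP.half_isSubalgebra p)
      (hP.half_isSubalgebra (-p)) (hP.half_isGraded p) (hP.half_isGraded (-p))
      (hP.half_nilFiltered p) (hP.half_nilFiltered (-p)) (splitP_sup_unit_inf p)
    rw [hP.half_sup_half_neg hp] at this
    rw [algJo, algP_eq]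
    exact this
  -- Forgetting the barred coordinate recovers the decomposition of the Poisson superalgebra without
  -- unit.
  · refine SuperData.sym2_ne_of_map (LinearMap.fst K (Series K) (Series K)) ?_
    rw [splitJ, splitJ, Submodule.prod_map_fst, Submodule.prod_map_fst, Submodule.prod_map_fst,
      Submodule.prod_map_fst]
    exact hP.plane_injective hp hq hpq

end PoissonDouble

/-! ### The Kantor double of the Lie superalgebra with adjoined unit -/

section LieDouble

variable (K : Type u) [Field K]

/-- The Poisson superalgebra `⟨1⟩ ⊕ End Λ` with zero product on `End Λ`. -/
noncomputable def trivData : SuperData K (K × EndGr K) where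
  even := (⊤ : Submodule K K).prod (endEven K)
  odd := (⊥ : Submodule K K).prod (endOdd K)
  ops := {trivMul K, trivBracket K}
  sqs := ∅

/-- The product of `⟨1⟩ ⊕ End Λ` as a bilinear map. -/
noncomputable def trivMulLin : (K × EndGr K) →ₗ[K] (K × EndGr K) →ₗ[K] (K × EndGr K) :=
  LinearMap.mk₂ K (trivMul K)
    (fun a a' b => Prod.ext (add_mul _ _ _) (by
      simp only [trivMul, Prod.fst_add, Prod.snd_add, add_smul, smul_add]; abel))
    (fun c a b => Prod.ext (mul_assoc _ _ _) (by
      simp only [trivMul, Prod.smul_fst, Prod.smul_snd, smul_add, smul_eq_mul, smul_smul,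
        mul_comm c]))
    (fun a b b' => Prod.ext (mul_add _ _ _) (by
      simp only [trivMul, Prod.fst_add, Prod.snd_add, add_smul, smul_add]; abel))
    (fun c a b => Prod.ext (mul_left_comm _ _ _) (by
      simp only [trivMul, Prod.smul_fst, Prod.smul_snd, smul_add, smul_eq_mul, smul_smul,
        mul_comm c]))

/-- The bracket of `⟨1⟩ ⊕ End Λ` as a bilinear map. -/
noncomputable def trivBracketLin : (K × EndGr K) →ₗ[K] (K × EndGr K) →ₗ[K] (K × EndGr K) :=
  (superCommLin.compl₁₂ (LinearMap.snd K K (EndGr K)) (LinearMap.snd K K (EndGr K))).compr₂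
    (LinearMap.inr K K (EndGr K))

/-- The parity automorphism of `⟨1⟩ ⊕ End Λ` as a linear map. -/
noncomputable def trivSignLin : (K × EndGr K) →ₗ[K] (K × EndGr K) where
  toFun := trivSign K
  map_add' a b := Prod.ext rfl (by
    simp only [trivSign, Prod.snd_add, evenPart_add, oddPart_add]; abel)
  map_smul' c a := Prod.ext rfl (by
    simp only [trivSign, Prod.smul_snd, evenPart_smul, oddPart_smul, RingHom.id_apply, smul_sub])

theorem trivData_isRegular : (trivData K).IsRegular where
  op_bilinear := by
    rintro _ (rfl | rfl)
    · exact ⟨trivMulLin K, fun _ _ => rfl⟩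
    · exact ⟨trivBracketLin K, fun _ _ => rfl⟩
  op_parity := by
    have h0 : ∀ i, ∀ a ∈ (trivData K).par i, a.2 ∈ (lieData K).par i := by
      intro i a ha
      cases i <;> exact ha.2
    rintro _ (rfl | rfl) i j a ha b hb
    · cases i <;> cases j
      · exact ⟨trivial, (endEven K).add_mem ((endEven K).smul_mem _ hb.2)
          ((endEven K).smul_mem _ ha.2)⟩
      · have hb1 : b.1 = 0 := hb.1
        refine ⟨?_, ?_⟩
        · change a.1 * b.1 = 0
          rw [hb1, mul_zero]
        · change a.1 • b.2 + b.1 • a.2 ∈ endOdd K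
          rw [hb1, zero_smul, add_zero]
          exact (endOdd K).smul_mem _ hb.2
      · have ha1 : a.1 = 0 := ha.1
        refine ⟨?_, ?_⟩
        · change a.1 * b.1 = 0
          rw [ha1, zero_mul]
        · change a.1 • b.2 + b.1 • a.2 ∈ endOdd K
          rw [ha1, zero_smul, zero_add]
          exact (endOdd K).smul_mem _ ha.2
      · have ha1 : a.1 = 0 := ha.1
        have hb1 : b.1 = 0 := hb.1
        refine ⟨trivial, ?_⟩
        change a.1 • b.2 + b.1 • a.2 ∈ endEven K
        rw [ha1, hb1, zero_smul, zero_smul, add_zero]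
        exact (endEven K).zero_mem
    · have := superComm_parity (h0 i a ha) (h0 j b hb)
      revert this
      cases xor i j
      · exact fun h => ⟨trivial, h⟩
      · exact fun h => ⟨rfl, h⟩
  sq_parity _ h := h.elim
  sq_smul _ h := h.elim
  sq_add _ h := h.elim
  parity_disjoint := by
    change (⊤ : Submodule K K).prod (endEven K) ⊓ (⊥ : Submodule K K).prod (endOdd K) = ⊥
    rw [Submodule.prod_inf_prod, endEven_inf_endOdd, inf_bot_eq, Submodule.prod_bot]

theorem trivData_isKantorBase :
    (trivData K).IsKantorBase (trivMul K) (trivBracket K) (trivSignLin K) (1, 0) where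
  regular := trivData_isRegular K
  mul_mem := Or.inl rfl
  br_mem := Or.inr rfl
  sgn_even a ha := Prod.ext rfl (by
    change evenPart a.2 - oddPart a.2 = a.2
    rw [evenPart_of_even ha.2, oddPart_of_even ha.2, sub_zero])
  sgn_odd a ha := Prod.ext (by
    have : a.1 = 0 := ha.1
    change a.1 = -a.1
    rw [this, neg_zero]) (by
    change evenPart a.2 - oddPart a.2 = -a.2
    rw [evenPart_of_odd ha.2, oddPart_of_odd ha.2, zero_sub])
  unit_even := ⟨trivial, (endEven K).zero_mem⟩
  unit_mul a := by simp [trivMul]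
  mul_unit a := by simp [trivMul]
  unit_br a := Prod.ext rfl (superCommLin.map_zero₂ a.2)
  br_unit a := Prod.ext rfl ((superCommLin a.2).map_zero)

variable {K}

theorem trivMul_mem_prod {A B C : Submodule K (EndGr K)} :
    ∀ a ∈ (⊥ : Submodule K K).prod A, ∀ b ∈ (⊥ : Submodule K K).prod B,
      trivMul K a b ∈ (⊥ : Submodule K K).prod C := by
  intro a ha b hb
  have ha1 : a.1 = 0 := ha.1
  have hb1 : b.1 = 0 := hb.1
  rw [trivMul, ha1, hb1, mul_zero, zero_smul, zero_smul, add_zero]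
  exact Submodule.zero_mem _

theorem trivData_isSubalgebra {A : Submodule K (EndGr K)} (hA : (lieData K).IsSubalgebra A) :
    (trivData K).IsSubalgebra ((⊥ : Submodule K K).prod A) := by
  refine ⟨?_, fun _ h => h.elim⟩
  rintro _ (rfl | rfl)
  · exact trivMul_mem_prod
  · exact fun a ha b hb => ⟨rfl, hA.1 _ rfl _ ha.2 _ hb.2⟩

theorem trivData_isGraded {A : Submodule K (EndGr K)} (hA : (lieData K).IsGraded A) :
    (trivData K).IsGraded ((⊥ : Submodule K K).prod A) := by
  rintro ⟨c, a⟩ ⟨hc, ha⟩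
  obtain rfl : c = 0 := hc
  obtain ⟨u, hu, v, hv, rfl⟩ := Submodule.mem_sup.1 (hA ha)
  refine Submodule.mem_sup.2 ⟨(0, u), ⟨⟨rfl, hu.1⟩, ⟨trivial, hu.2⟩⟩, (0, v),
    ⟨⟨rfl, hv.1⟩, ⟨rfl, hv.2⟩⟩, ?_⟩
  exact Prod.ext (add_zero 0) rfl

/-- The product vanishes on the Lie part, so a filtration for the bracket alone is enough. -/
theorem trivData_nilFiltered {A : Submodule K (EndGr K)} (hA : (lieData K).NilFiltered A) :
    (trivData K).NilFiltered ((⊥ : Submodule K K).prod A) := by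
  classical
  intro T hT
  obtain ⟨S, hS, hg, hTS⟩ := hA (T.image Prod.snd) (by
    intro a ha
    obtain ⟨t, ht, rfl⟩ := Finset.mem_image.1 (Finset.mem_coe.1 ha)
    exact (hT ht).2)
  refine ⟨fun i => (⊥ : Submodule K K).prod (S i), ⟨?_, ?_, fun _ h => h.elim, ?_⟩,
    fun i => trivData_isGraded (hg i), fun t ht => ⟨(hT ht).1, hTS ?_⟩⟩
  · exact fun i j hij => Submodule.prod_mono le_rfl (hS.antitone hij)
  · rintro _ (rfl | rfl) i j
    · exact trivMul_mem_prod
    · exact fun a ha b hb => ⟨rfl, hS.op_mem _ rfl _ _ _ ha.2 _ hb.2⟩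
  · obtain ⟨N, hN⟩ := hS.eventually_bot
    exact ⟨N, by rw [hN, Submodule.prod_bot]⟩
  · exact Finset.mem_coe.2 (Finset.mem_image_of_mem _ ht)

theorem prod_sup_span_unit (A : Submodule K (EndGr K)) :
    (⊥ : Submodule K K).prod A ⊔ Submodule.span K {((1 : K), (0 : EndGr K))} =
      (⊤ : Submodule K K).prod A := by
  refine le_antisymm (sup_le (Submodule.prod_mono bot_le le_rfl) ?_) ?_
  · rw [Submodule.span_le, Set.singleton_subset_iff]
    exact ⟨trivial, A.zero_mem⟩
  · rintro ⟨c, a⟩ ⟨-, ha⟩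
    refine Submodule.mem_sup.2 ⟨(0, a), ⟨rfl, ha⟩, c • (1, 0),
      Submodule.smul_mem _ c (Submodule.mem_span_singleton_self _), ?_⟩
    simp

theorem jorData_splitsByPlanes : (jorData K).SplitsByPlanes (algKo K) (splitK K) := by
  have hQ := lieData_isPlaneGraded (K := K)
  refine SuperData.splitsByPlanes_of (fun p hp => ?_) fun p hp q hq hpq => ?_
  · have := (trivData_isKantorBase K).isNilDecomposition
      (trivData_isSubalgebra (hQ.half_isSubalgebra p))
      (trivData_isSubalgebra (hQ.half_isSubalgebra (-p)))
      (trivData_isGraded (hQ.half_isGraded p)) (trivData_isGraded (hQ.half_isGraded (-p)))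
      (trivData_nilFiltered (hQ.half_nilFiltered p))
      (trivData_nilFiltered (hQ.half_nilFiltered (-p))) (by
        rw [prod_sup_span_unit, Submodule.prod_inf_prod, hQ.half_inf_half_neg, inf_bot_eq,
          Submodule.prod_bot])
    rw [Submodule.prod_sup_prod, hQ.half_sup_half_neg hp, sup_bot_eq, prod_sup_span_unit,
      prod_sup_span_unit] at this
    exact this
  · refine SuperData.sym2_ne_of_map ((LinearMap.snd K K (EndGr K)).comp
      (LinearMap.fst K (K × EndGr K) (K × EndGr K))) ?_
    simp only [splitK, Submodule.map_comp, Submodule.prod_map_fst, Submodule.prod_map_snd]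
    exact hQ.plane_injective hp hq hpq

end LieDouble

theorem mainTheorem8 (K : Type u) [Field K] :
    (lieData K).SplitsByPlanes (algQ K) (splitQ K) ∧
    (assocData K).SplitsByPlanes (algA K) (splitA K) ∧
    (poissonData K).SplitsByPlanes (algPo K) (splitP K) ∧
    ((2 : K) ≠ 0 →
      (kantorData K).SplitsByPlanes (algJo K) (splitJ K) ∧
      (jorData K).SplitsByPlanes (algKo K) (splitK K)) :=
  ⟨lieData_isPlaneGraded.splitsByPlanes, assocData_isPlaneGraded.splitsByPlanes,
    poissonData_isPlaneGraded.splitsByPlanes,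
    fun _ => ⟨kantorData_splitsByPlanes, jorData_splitsByPlanes⟩⟩
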